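/- Let $F$ be a non-archimedean local field with ring of integers $\mathfrak o_F$, maximal ideal $\mathfrak p_F$ and normalized valuation $v_F$, and let $\psi : F \to \mathbb C^\times$ be a smooth additive character of conductor $\mathfrak p_F$ (trivial on $\mathfrak p_F$, non-trivial on $\mathfrak o_F$). Let $D$ be a finite-dimensional central division $F$-algebra, with ring of integers $\mathfrak o_D$ and maximal ideal $\mathfrak p_D$, let $V$ be a finite-dimensional right $D$-vector space, $A = \mathrm{End}_D(V) \cong M_m(D)$, $G = A^\times \cong \mathrm{GL}_m(D)$, and let $\mathrm{Trd}_{A/F}$ be the reduced trace. Let $\mathfrak A$ be a principal hereditary $\mathfrak o_F$-order in $A$, that is, a hereditary order of the form $\mathfrak A = \{a \in A : a\mathcal L_j \subseteq \mathcal L_j \text{ for all } j \in \mathbb Z\}$ for a strictly decreasing sequence $(\mathcal L_i)_{i\in\mathbb Z}$ of $\mathfrak o_D$-lattices in $V$ (compact open $\mathfrak o_D$-submodules) such that $\mathcal L_{i+e'} = \mathcal L_i \mathfrak p_D$ for all $i$, for some integer $e' \ge 1$, and such that the index $[\mathcal L_i : \mathcal L_{i+1}]$ does not depend on $i$. Let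 $\mathfrak P$ be the Jacobson radical of $\mathfrak A$, let $e(\mathfrak A|\mathfrak o_F)$ be the positive integer $e$ with $\mathfrak p_F\mathfrak A = \mathfrak P^{e}$, and put $\mathbf U^0(\mathfrak A) = \mathfrak A^\times$ and $\mathbf U^k(\mathfrak A) = 1 + \mathfrak P^k$ for $k \ge 1$. Let $\chi : G \to \mathbb C^\times$ be a smooth character, and let $n \ge 0$ be an integer such that $\chi$ is trivial on $\mathbf U^{n+1}(\mathfrak A)$ but not on $\mathbf U^{n}(\mathfrak A)$. Then there exists $c \in F^\times$ such that $v_F(c) = -n/e(\mathfrak A|\mathfrak o_F)$ and $$\chi(1+y) = \psi\bigl(\mathrm{Trd}_{A/F}(cy)\bigr) \qquad \text{for all } y \in \mathfrak P^{\lfloor n/2\rfloor+1},$$ where $1 + y \in \mathbf U^{\lfloor n/2\rfloor+1}(\mathfrak A) \subseteq G$. -/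

import Mathlib

open ValuativeRel
open scoped TensorProduct

universe u v w

namespace PrincipalOrder

noncomputable section

/-! ### The base field -/

/-- The normalized valuation `v_F : Fˣ → ℤ` of a non-archimedean local field, surjective onto `ℤ`
and non-negative on the ring of integers.  (The value at `0` is not meaningful.) -/
def ord (F : Type u) [Field F] [ValuativeRel F] [TopologicalSpace F]
    [IsNonarchimedeanLocalField F] (x : F) : ℤ :=
  -WithZero.log (IsNonarchimedeanLocalField.valueGroupWithZeroIsoInt F (valuation F x))

/-- `ψ` is a smooth additive character of `F` of conductor `𝔭_F`: it is locally constant, trivial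
on the maximal ideal `𝔭_F` and non-trivial on the ring of integers `𝔬_F`. -/
structure IsSmoothOfConductorMaximalIdeal (F : Type u) [Field F] [ValuativeRel F]
    [TopologicalSpace F] [IsNonarchimedeanLocalField F] (ψ : AddChar F ℂ) : Prop where
  smooth : IsLocallyConstant ψ
  trivial_on : ∀ x : 𝒪[F], x ∈ 𝓂[F] → ψ (x : F) = 1
  nontrivial_on : ∃ x : 𝒪[F], ψ (x : F) ≠ 1

/-! ### The reduced trace -/

/-- The linear form `t` on the `F`-algebra `A` is computed by the matrix trace after a splitting
`K ⊗_F A ≃ M_N(K)` over some extension field `K` of `F`. For a central simple algebra `A` there is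
exactly one such `t`; it is the reduced trace, and it does not depend on the splitting. -/
def IsReducedTrace (F : Type u) [Field F] (A : Type v) [Ring A] [Algebra F A]
    (t : A →ₗ[F] F) : Prop :=
  ∃ (K : Type u) (_ : Field K) (_ : Algebra F K) (N : ℕ)
    (φ : (K ⊗[F] A) ≃ₐ[K] Matrix (Fin N) (Fin N) K),
    ∀ a : A, algebraMap F K (t a) = (φ (1 ⊗ₜ[F] a)).trace

open Classical in
/-- The reduced trace `Trd_{A/F}` of a central simple `F`-algebra `A`. -/
def reducedTrace (F : Type u) [Field F] (A : Type v) [Ring A] [Algebra F A] : A →ₗ[F] F :=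
  if h : ∃ t : A →ₗ[F] F, IsReducedTrace F A t then h.choose else 0

/-! ### Lattice chains in a right `D`-vector space -/

section Chains

variable (F : Type u) [Field F] [ValuativeRel F] [TopologicalSpace F]
  [IsNonarchimedeanLocalField F]
  (D : Type v) [DivisionRing D] [Algebra F D]
  {V : Type w} [AddCommGroup V] [Module Dᵐᵒᵖ V] [Module F V]

/-- The ring of integers `𝔬_D`: the elements of `D` that are integral over `𝔬_F`. -/
def ringOfIntegers : Set D := {a | IsIntegral 𝒪[F] a}

/-- The maximal ideal `𝔭_D` of `𝔬_D`: the integral elements with no integral inverse. -/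
def maximalIdeal : Set D :=
  {a | a ∈ ringOfIntegers F D ∧ ¬ ∃ b ∈ ringOfIntegers F D, a * b = 1}

/-- `L` is an `𝔬_D`-lattice in the right `D`-vector space `V`: an `𝔬_D`-submodule that is compact
and open for the canonical topology of `V` as a finite-dimensional `F`-vector space. -/
structure IsLattice (L : AddSubgroup V) : Prop where
  smul_mem : ∀ a ∈ ringOfIntegers F D, ∀ x ∈ L, MulOpposite.op a • x ∈ L
  isCompact : @IsCompact V (moduleTopology F V) (L : Set V)
  isOpen : @IsOpen V (moduleTopology F V) (L : Set V)

/-- The subgroup `L 𝔭_D` of `V`, generated by the products `x a` with `x ∈ L` and `a ∈ 𝔭_D`. -/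
def mulMaximalIdeal (L : AddSubgroup V) : AddSubgroup V :=
  AddSubgroup.closure {y | ∃ x ∈ L, ∃ a ∈ maximalIdeal F D, y = MulOpposite.op a • x}

/-- `(L i)_{i ∈ ℤ}` is a uniform `𝔬_D`-chain in `V`. -/
structure IsUniformChain (L : ℤ → AddSubgroup V) : Prop where
  isLattice : ∀ i, IsLattice F D (L i)
  strictAnti : StrictAnti L
  periodic : ∃ e : ℕ, 0 < e ∧ ∀ i, L (i + e) = mulMaximalIdeal F D (L i)
  uniform : ∀ i j, (L (i + 1)).relIndex (L i) = (L (j + 1)).relIndex (L j)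

end Chains

/-! ### Hereditary orders in `A = End_D(V)` and their filtrations -/

/-- A ring is hereditary if all its left ideals and all its right ideals are projective. -/
structure IsHereditaryRing (R : Type w) [Ring R] : Prop where
  left : ∀ I : Submodule R R, Module.Projective R I
  right : ∀ I : Submodule Rᵐᵒᵖ R, Module.Projective Rᵐᵒᵖ I

section Orders

variable {F : Type u} [Field F] [ValuativeRel F] [TopologicalSpace F]
  [IsNonarchimedeanLocalField F]
  {D : Type v} [DivisionRing D] [Algebra F D]
  {V : Type w} [AddCommGroup V] [Module Dᵐᵒᵖ V] [Module F V] [IsScalarTower F Dᵐᵒᵖ V]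

/-- `𝔄` is a principal hereditary `𝔬_F`-order in `End_D(V)`: it is hereditary, and it is the
stabilizer `{a | a L_j ⊆ L_j for all j}` of a uniform `𝔬_D`-chain `L` in `V`. -/
structure IsPrincipalHereditaryOrder (𝔄 : Subalgebra 𝒪[F] (Module.End Dᵐᵒᵖ V)) : Prop where
  isHereditary : IsHereditaryRing 𝔄
  exists_chain : ∃ L : ℤ → AddSubgroup V, IsUniformChain F D L ∧
    ∀ a : Module.End Dᵐᵒᵖ V, a ∈ 𝔄 ↔ ∀ j, ∀ x ∈ L j, a x ∈ L j

/-- The radical `𝔓` of `𝔄`. -/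
def radical (𝔄 : Subalgebra 𝒪[F] (Module.End Dᵐᵒᵖ V)) : Ideal 𝔄 := Ring.jacobson 𝔄

/-- `e(𝔄 | 𝔬_F)`: the integer `e` such that `𝔭_F 𝔄 = 𝔓 ^ e`. (For a hereditary order the powers of
`𝔓` are distinct, so that the set below has one element.) -/
def ramificationIndex (𝔄 : Subalgebra 𝒪[F] (Module.End Dᵐᵒᵖ V)) : ℕ :=
  sInf {e : ℕ | radical 𝔄 ^ e = 𝓂[F].map (algebraMap 𝒪[F] 𝔄)}

/-- The subset `𝐔ⁿ(𝔄)` of `G = End_D(V)ˣ`: it is `𝔄ˣ` for `n = 0` and `1 + 𝔓 ^ n` for `n > 0`. -/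
def unitFiltration (𝔄 : Subalgebra 𝒪[F] (Module.End Dᵐᵒᵖ V)) (n : ℕ) :
    Set (Module.End Dᵐᵒᵖ V)ˣ :=
  if n = 0 then {g | (g : Module.End Dᵐᵒᵖ V) ∈ 𝔄 ∧ ((g⁻¹ : _ˣ) : Module.End Dᵐᵒᵖ V) ∈ 𝔄}
  else {g | ∃ y ∈ radical 𝔄 ^ n, (g : Module.End Dᵐᵒᵖ V) = 1 + (y : Module.End Dᵐᵒᵖ V)}

end Orders

/-- `χ` is a smooth character of `Aˣ`: its kernel is open, where `A` has its canonical topology as a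
finite-dimensional `F`-vector space and `Aˣ` has the resulting topology of a unit group. -/
def IsSmoothCharacter (F : Type u) [Field F] [TopologicalSpace F] {A : Type v} [Ring A]
    [Algebra F A] (χ : Aˣ →* ℂˣ) : Prop :=
  letI : TopologicalSpace A := moduleTopology F A
  IsOpen (χ.ker : Set Aˣ)

end

end PrincipalOrder

/-!
Write `A = End_D(V)`, `G = Aˣ` and `t` for the reduced trace. The function `y ↦ χ (1 + y)` is
additive on `𝔓 ^ m` for `m = ⌊n / 2⌋ + 1`, since `2 m ≥ n + 1` (`oneAddChar_add`), and it is
invariant under conjugation. The proof shows that such a function factors through `t`.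

*The order.* A basis of `V` over `D` can be chosen such that each lattice of the chain splits along
it (`exists_isPeriodicFiltration`), as in the theory of norms on vector spaces over local fields. In
terms of the matrix units of this basis one sees that `𝔓 ^ r` consists of the endomorphisms that
raise the level in the chain by `r` at least (`radical_pow`), and that `E = e(𝔄 | 𝔬_F)` is the
product of the period of the chain and the ramification index of `D` (`ramificationIndex_eq`).

*The character.* Conjugation by diagonal matrices shows that `χ` is trivial on the elementary
matrices `1 + x e_ij` (`oneAddChar_unit_of_ne`), and conjugation by permutation matrices that
`χ (1 + x e_jj)` does not depend on `j`. There remains a function `θ (x) = χ (1 + x e_00)` on a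
fractional ideal of `D`, additive and invariant under conjugation by `Dˣ`. Let `τ` be the reduced
trace of `D`, let `a_l` be an orthogonal `F`-basis of `D` and `b_l` its dual basis with respect to
`τ`, so that `∑ a_l w b_l = ∑ b_l w a_l = τ (w)` for all `w`, the Casimir identity. If `u` is an
integer of `D` with `τ (u) = 1`, then
`θ (x) = θ (∑ x a_l u b_l) = θ (∑ b_l x a_l u) = θ (τ (x) u)` (`oneAddChar_unit_eq`), all terms
lying in the given fractional ideal since the two bases have opposite valuations. As `s ↦ θ (s u)` is a
character of a fractional ideal of `F`, it is `s ↦ ψ (c s)` for some `c` in `F`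
(`exists_eq_char_mul`), which yields `χ (1 + y) = ψ (c t (y))` (`exists_oneAddChar_eq`). Since
`t (𝔓 ^ s) = 𝔭_F ^ ⌈s / E⌉`, the hypothesis on `n` determines the valuation of `c`
(`ord_eq_neg_div`); for `n = 0` one can take `c = 1`.

*The reduced trace.* The element `u` exists since a splitting field of `D` turns a suitable lift of
a generator of the residue field of `D` into a matrix whose characteristic polynomial lifts the
minimal polynomial of that generator (`IsNormalizedValuation.exists_trace_eq_unit`); this uses
`[D : F] ≤ e f` and `e, f ≤ √[D : F]`. Existence of the reduced trace of `A` follows from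
Wedderburn's theorem over an algebraic closure, where `A` remains simple
(`isSimpleRing_tensorProduct`), and from one element whose trace is a non-zero element of `F`
(`exists_isReducedTrace`).
-/

namespace PrincipalOrder

/-! ### The valuation of `F` and self-duality -/

section LocalField

variable {F : Type u} [Field F] [ValuativeRel F] [TopologicalSpace F]
  [IsNonarchimedeanLocalField F]

lemma ord_mul {x y : F} (hx : x ≠ 0) (hy : y ≠ 0) : ord F (x * y) = ord F x + ord F y := by
  unfold ord
  rw [map_mul, map_mul, WithZero.log_mul (by simpa using hx) (by simpa using hy)]
  ring

@[simp] lemma ord_one : ord F 1 = 0 := by simp [ord]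

@[simp] lemma ord_zero : ord F 0 = 0 := by simp [ord]

@[simp] lemma ord_neg (x : F) : ord F (-x) = ord F x := by simp [ord]

lemma ord_inv (x : F) : ord F x⁻¹ = - ord F x := by
  simp [ord, WithZero.log_inv]

lemma ord_pow (x : F) (n : ℕ) : ord F (x ^ n) = n * ord F x := by
  simp [ord, WithZero.log_pow]

lemma ord_zpow (x : F) (n : ℤ) : ord F (x ^ n) = n * ord F x := by
  simp [ord, WithZero.log_zpow]

lemma ord_le_iff {x y : F} (hx : x ≠ 0) (hy : y ≠ 0) :
    ord F x ≤ ord F y ↔ valuation F y ≤ valuation F x := by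
  unfold ord
  rw [neg_le_neg_iff, WithZero.log_le_log (by simpa using hy) (by simpa using hx)]
  exact map_le_map_iff (IsNonarchimedeanLocalField.valueGroupWithZeroIsoInt F)

lemma le_ord_add {x y : F} (hx : x ≠ 0) (hy : y ≠ 0) (hxy : x + y ≠ 0) :
    min (ord F x) (ord F y) ≤ ord F (x + y) := by
  rcases le_total (ord F x) (ord F y) with h | h
  · rw [min_eq_left h, ord_le_iff hx hxy]
    exact (valuation F).map_add_le le_rfl ((ord_le_iff hx hy).1 h)
  · rw [min_eq_right h, ord_le_iff hy hxy]
    exact (valuation F).map_add_le ((ord_le_iff hy hx).1 h) le_rfl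

variable (F) in
lemma exists_ord_eq (n : ℤ) : ∃ x : F, x ≠ 0 ∧ ord F x = n := by
  obtain ⟨x, hx⟩ := valuation_surjective
    ((IsNonarchimedeanLocalField.valueGroupWithZeroIsoInt F).symm (WithZero.exp (-n)))
  have h : ord F x = n := by simp [ord, hx]
  refine ⟨x, ?_, h⟩
  rintro rfl
  rw [map_zero] at hx
  have := congrArg (IsNonarchimedeanLocalField.valueGroupWithZeroIsoInt F) hx
  simp at this
  exact WithZero.exp_ne_zero this.symm

variable (F) in
/-- The fractional ideal `𝔭_F ^ n` for `n : ℤ`, as an additive subgroup of `F`. -/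
noncomputable def fracIdeal (n : ℤ) : AddSubgroup F where
  carrier := {x | x = 0 ∨ n ≤ ord F x}
  zero_mem' := Or.inl rfl
  neg_mem' := by rintro x (rfl | h) <;> simp_all
  add_mem' := by
    intro x y hx hy
    by_cases h0 : x = 0
    · simpa [h0] using hy
    by_cases h1 : y = 0
    · simpa [h1] using hx
    by_cases h2 : x + y = 0
    · exact Or.inl h2
    · exact Or.inr ((le_min (hx.resolve_left h0) (hy.resolve_left h1)).trans (le_ord_add h0 h1 h2))

lemma mem_fracIdeal {n : ℤ} {x : F} : x ∈ fracIdeal F n ↔ x = 0 ∨ n ≤ ord F x := Iff.rfl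

lemma mem_fracIdeal_of_ne {n : ℤ} {x : F} (hx : x ≠ 0) : x ∈ fracIdeal F n ↔ n ≤ ord F x := by
  simp [mem_fracIdeal, hx]

lemma fracIdeal_anti {m n : ℤ} (h : m ≤ n) : fracIdeal F n ≤ fracIdeal F m := by
  rintro x (rfl | hx)
  · exact zero_mem _
  · exact Or.inr (h.trans hx)

lemma mul_mem_fracIdeal {m n : ℤ} {x y : F} (hx : x ∈ fracIdeal F m) (hy : y ∈ fracIdeal F n) :
    x * y ∈ fracIdeal F (m + n) := by
  by_cases h0 : x = 0
  · simp [h0, zero_mem]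
  by_cases h1 : y = 0
  · simp [h1, zero_mem]
  rw [mem_fracIdeal_of_ne h0] at hx
  rw [mem_fracIdeal_of_ne h1] at hy
  rw [mem_fracIdeal_of_ne (mul_ne_zero h0 h1), ord_mul h0 h1]
  exact add_le_add hx hy

lemma mul_mem_fracIdeal_iff {n : ℤ} {c x : F} (hc : c ≠ 0) :
    c * x ∈ fracIdeal F (n + ord F c) ↔ x ∈ fracIdeal F n := by
  by_cases hx : x = 0
  · simp [hx, zero_mem]
  rw [mem_fracIdeal_of_ne hx, mem_fracIdeal_of_ne (mul_ne_zero hc hx), ord_mul hc hx]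
  constructor <;> intro h <;> linarith

/-- A non-zero finite family in `F` has a multiple with integral entries, one of them a unit. -/
lemma exists_mul_primitive {ι : Type*} [Finite ι] {g : ι → F} (hg : g ≠ 0) :
    ∃ t : F, t ≠ 0 ∧ (∀ i, t * g i ∈ fracIdeal F 0) ∧ ∃ i, t * g i ∉ fracIdeal F 1 := by
  classical
  have := Fintype.ofFinite ι
  obtain ⟨j, hj⟩ := Function.ne_iff.1 hg
  have hne : (Finset.univ.filter fun i => g i ≠ 0).Nonempty := ⟨j, by simpa using hj⟩
  obtain ⟨i₀, hi₀, hmin⟩ := Finset.exists_min_image _ (fun i => ord F (g i)) hne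
  have hi₀' : g i₀ ≠ 0 := by simpa using hi₀
  obtain ⟨t, ht0, ht⟩ := exists_ord_eq F (-ord F (g i₀))
  refine ⟨t, ht0, fun i => ?_, i₀, ?_⟩
  · by_cases h : g i = 0
    · simp [h, zero_mem]
    · have := hmin i (by simpa using h)
      rw [mem_fracIdeal_of_ne (mul_ne_zero ht0 h), ord_mul ht0 h, ht]
      omega
  · rw [mem_fracIdeal_of_ne (mul_ne_zero ht0 hi₀'), ord_mul ht0 hi₀', ht]
    omega

lemma mem_integer_iff {x : F} : x ∈ 𝒪[F] ↔ x ∈ fracIdeal F 0 := by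
  by_cases hx : x = 0
  · simp [hx, zero_mem]
  rw [mem_fracIdeal_of_ne hx, Valuation.mem_integer_iff, ← ord_one (F := F),
    ord_le_iff one_ne_zero hx, map_one]

lemma integer_ord_nonneg (x : 𝒪[F]) : 0 ≤ ord F (x : F) := by
  rcases mem_integer_iff.1 x.2 with h | h
  · simp [h]
  · exact h

lemma isUnit_integer_iff {x : 𝒪[F]} : IsUnit x ↔ (x : F) ≠ 0 ∧ ord F (x : F) = 0 := by
  constructor
  · rintro h
    obtain ⟨y, hy⟩ := h.exists_right_inv
    have hy' : (x : F) * y = 1 := by exact_mod_cast congrArg Subtype.val hy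
    have hx0 : (x : F) ≠ 0 := left_ne_zero_of_mul_eq_one hy'
    have hy0 : (y : F) ≠ 0 := right_ne_zero_of_mul_eq_one hy'
    refine ⟨hx0, ?_⟩
    have := ord_mul hx0 hy0
    rw [hy', ord_one] at this
    have := integer_ord_nonneg x
    have := integer_ord_nonneg y
    linarith
  · rintro ⟨h0, h⟩
    have : (x : F)⁻¹ ∈ 𝒪[F] := by
      rw [mem_integer_iff]; right; rw [ord_inv, h, neg_zero]
    exact IsUnit.of_mul_eq_one ⟨_, this⟩ (Subtype.ext (mul_inv_cancel₀ h0))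

lemma mem_maximalIdeal_iff {x : 𝒪[F]} : x ∈ 𝓂[F] ↔ (x : F) ∈ fracIdeal F 1 := by
  rw [IsLocalRing.mem_maximalIdeal, mem_nonunits_iff, isUnit_integer_iff, mem_fracIdeal]
  have := integer_ord_nonneg x
  by_cases hx : (x : F) = 0
  · simp [hx]
  · simp only [hx, ne_eq, not_false_eq_true, true_and, false_or]
    omega

/-- The ideal `𝔭_F ^ n` of `𝔬_F` for `n : ℕ`, described by the valuation. -/
noncomputable def fracIdealNat (F : Type u) [Field F] [ValuativeRel F] [TopologicalSpace F]
    [IsNonarchimedeanLocalField F] (n : ℕ) : Ideal 𝒪[F] where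
  carrier := {x | (x : F) ∈ fracIdeal F n}
  zero_mem' := zero_mem (fracIdeal F n)
  add_mem' := fun hx hy => (fracIdeal F n).add_mem hx hy
  smul_mem' := fun c x hx => by
    have := mul_mem_fracIdeal (mem_integer_iff.1 c.2) hx
    simpa using this

lemma mem_fracIdealNat {n : ℕ} {x : 𝒪[F]} : x ∈ fracIdealNat F n ↔ (x : F) ∈ fracIdeal F n := by
  rfl

lemma fracIdealNat_eq (n : ℕ) : fracIdealNat F n = 𝓂[F] ^ n := by
  obtain ⟨π, hπ0, hπ⟩ := exists_ord_eq F 1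
  have hπO : π ∈ 𝒪[F] := by rw [mem_integer_iff]; right; omega
  have hm : 𝓂[F] = Ideal.span {⟨π, hπO⟩} := by
    ext x
    rw [mem_maximalIdeal_iff, Ideal.mem_span_singleton']
    constructor
    · intro hx
      refine ⟨⟨x * π⁻¹, ?_⟩, Subtype.ext (by simp [hπ0])⟩
      rw [mem_integer_iff]
      have : π⁻¹ ∈ fracIdeal F (-1) := by right; rw [ord_inv]; omega
      simpa using mul_mem_fracIdeal hx this
    · rintro ⟨a, rfl⟩
      have : π ∈ fracIdeal F 1 := by right; omega
      simpa using mul_mem_fracIdeal (mem_integer_iff.1 a.2) this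
  rw [hm, Ideal.span_singleton_pow]
  ext x
  rw [mem_fracIdealNat, Ideal.mem_span_singleton']
  constructor
  · intro hx
    refine ⟨⟨x * (π ^ n)⁻¹, ?_⟩, Subtype.ext (by simp [hπ0])⟩
    rw [mem_integer_iff]
    have : (π ^ n)⁻¹ ∈ fracIdeal F (-n) := by right; rw [ord_inv, ord_pow, hπ]; omega
    simpa using mul_mem_fracIdeal hx this
  · rintro ⟨a, rfl⟩
    have : π ^ n ∈ fracIdeal F n := by right; rw [ord_pow, hπ]; omega
    simpa using mul_mem_fracIdeal (mem_integer_iff.1 a.2) this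

instance finite_quotient_fracIdealNat (n : ℕ) : Finite (𝒪[F] ⧸ fracIdealNat F n) := by
  rw [fracIdealNat_eq]
  have hfg : (𝓂[F] : Ideal 𝒪[F]).FG := IsNoetherian.noetherian _
  have : Finite (𝒪[F] ⧸ 𝓂[F]) := inferInstanceAs (Finite 𝓀[F])
  exact Ideal.finite_quotient_pow hfg n

/-- Self-duality of `F`: every character of `𝔭_F ^ j / 𝔭_F ^ (j + s)` is `t ↦ ψ (c t)`. As
`c ↦ ψ (c ·)` is injective on the finite ring `𝔬_F / 𝔭_F ^ s`, it is onto by counting. -/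
lemma exists_eq_char_mul (ψ : AddChar F ℂ) (hψ : IsSmoothOfConductorMaximalIdeal F ψ)
    (j : ℤ) (s : ℕ) (θ : F → ℂ) (hadd : ∀ x ∈ fracIdeal F j, ∀ y ∈ fracIdeal F j,
      θ (x + y) = θ x * θ y) (htriv : ∀ x ∈ fracIdeal F (j + s), θ x = 1) :
    ∃ c : F, ∀ x ∈ fracIdeal F j, θ x = ψ (c * x) := by
  classical
  obtain ⟨π, hπ0, hπ⟩ := exists_ord_eq F 1
  let R := 𝒪[F] ⧸ fracIdealNat F s
  have : Fintype R := Fintype.ofFinite R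
  have hψ1 : ∀ x ∈ fracIdeal F 1, ψ x = 1 := fun x hx =>
    hψ.trivial_on ⟨x, mem_integer_iff.2 (fracIdeal_anti (by norm_num) hx)⟩
      (mem_maximalIdeal_iff.2 hx)
  -- a function on `𝔬_F` that is multiplicative and trivial on the ideal descends to the quotient
  have desc : ∀ f : F → ℂ, (∀ x ∈ fracIdeal F 0, ∀ y ∈ fracIdeal F 0, f (x + y) = f x * f y) →
      (∀ x ∈ fracIdeal F s, f x = 1) →
      ∃ g : AddChar R ℂ, ∀ x : 𝒪[F], g (Ideal.Quotient.mk _ x) = f x := by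
    intro f hf hf1
    have h0 : f 0 = 1 := hf1 0 (zero_mem _)
    refine ⟨⟨fun r => Quotient.liftOn' r (fun x : 𝒪[F] => f x) ?_, ?_, ?_⟩, fun x => rfl⟩
    · intro x y hxy
      have hxy' : x - y ∈ fracIdealNat F s := (Submodule.quotientRel_def _).1 hxy
      have : (x : F) = y + (x - y : 𝒪[F]) := by push_cast; ring
      change f x = f y
      rw [this, hf _ (mem_integer_iff.1 y.2) _ (mem_integer_iff.1 (x - y).2),
        hf1 _ (mem_fracIdealNat.1 hxy'), mul_one]
    · exact h0
    · intro a b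
      obtain ⟨x, rfl⟩ := Ideal.Quotient.mk_surjective a
      obtain ⟨y, rfl⟩ := Ideal.Quotient.mk_surjective b
      rw [← map_add]
      exact hf _ (mem_integer_iff.1 x.2) _ (mem_integer_iff.1 y.2)
  have hz : ∀ m : ℤ, π ^ m ∈ fracIdeal F m := fun m => by right; rw [ord_zpow, hπ]; omega
  obtain ⟨g, hg⟩ := desc (fun x => ψ (π ^ (1 - s : ℤ) * x))
    (fun x _ y _ => by simp [mul_add, AddChar.map_add_eq_mul])
    (fun x hx => hψ1 _ (by simpa using mul_mem_fracIdeal (hz (1 - s)) hx))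
  obtain ⟨h, hh⟩ := desc (fun x => θ (π ^ j * x))
    (fun x hx y hy => by
      rw [mul_add]
      exact hadd _ (by simpa using mul_mem_fracIdeal (hz j) hx) _
        (by simpa using mul_mem_fracIdeal (hz j) hy))
    (fun x hx => htriv _ (by simpa using mul_mem_fracIdeal (hz j) hx))
  -- the character `g` has conductor exactly `𝔭_F ^ s`, since `ψ` is non-trivial on `𝔬_F`
  have hprim : g.IsPrimitive := by
    intro a ha hga
    obtain ⟨x, rfl⟩ := Ideal.Quotient.mk_surjective a
    rw [Ne, Ideal.Quotient.eq_zero_iff_mem, mem_fracIdealNat, mem_fracIdeal, not_or] at ha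
    obtain ⟨y, hy⟩ := hψ.nontrivial_on
    apply hy
    let z : F := (π ^ (1 - s : ℤ) * x)⁻¹ * y
    have hz' : z ∈ 𝒪[F] := by
      rw [mem_integer_iff]
      have : (π ^ (1 - s : ℤ) * x)⁻¹ ∈ fracIdeal F 0 := by
        right
        rw [ord_inv, ord_mul (zpow_ne_zero _ hπ0) ha.1, ord_zpow, hπ]
        omega
      exact (zero_add (0 : ℤ)) ▸ mul_mem_fracIdeal this (mem_integer_iff.1 y.2)
    have := congrFun (congrArg DFunLike.coe hga) (Ideal.Quotient.mk _ ⟨z, hz'⟩)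
    rw [AddChar.mulShift_apply, ← map_mul, hg] at this
    simp only [AddChar.one_apply] at this
    rw [← this]
    congr 1
    have : π ^ (1 - s : ℤ) ≠ 0 := zpow_ne_zero _ hπ0
    have := ha.1
    simp only [z, Subring.coe_mul]
    field_simp
  have hbij : Function.Bijective g.mulShift := by
    rw [Fintype.bijective_iff_injective_and_card]
    exact ⟨AddChar.to_mulShift_inj_of_isPrimitive hprim, AddChar.card_eq.symm⟩
  obtain ⟨a, ha⟩ := hbij.2 h
  obtain ⟨x, rfl⟩ := Ideal.Quotient.mk_surjective a
  refine ⟨π ^ (1 - s : ℤ) * x * (π ^ j)⁻¹, fun t ht => ?_⟩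
  have hπj : π ^ j ≠ 0 := zpow_ne_zero _ hπ0
  have hyO : (π ^ j)⁻¹ * t ∈ 𝒪[F] := by
    rw [mem_integer_iff, ← zpow_neg]
    simpa using mul_mem_fracIdeal (hz (-j)) ht
  have := congrFun (congrArg DFunLike.coe ha) (Ideal.Quotient.mk _ ⟨_, hyO⟩)
  rw [AddChar.mulShift_apply, ← map_mul, hg, hh] at this
  simp only [Subring.coe_mul] at this
  rw [mul_inv_cancel_left₀ hπj] at this
  rw [← this]
  congr 1
  ring

end LocalField

/-! ### Filtrations and orthogonal bases -/

section Filtration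

variable {M : Type*} [AddCommGroup M]

/-- A decreasing filtration of an abelian group by subgroups that is exhaustive and separated. -/
structure IsFiltration (L : ℤ → AddSubgroup M) : Prop where
  anti : Antitone L
  exhaustive : ∀ x, ∃ i, x ∈ L i
  separated : ∀ x, x ≠ 0 → ∃ i, x ∉ L i

/-- The largest `i` with `x ∈ L i`.  It is meaningful for `x ≠ 0` only. -/
noncomputable def level (L : ℤ → AddSubgroup M) (x : M) : ℤ := sSup {i | x ∈ L i}

lemma IsFiltration.mem_iff {L : ℤ → AddSubgroup M} (hL : IsFiltration L) {x : M} (hx : x ≠ 0)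
    (i : ℤ) : x ∈ L i ↔ i ≤ level L x := by
  obtain ⟨j, hj⟩ := hL.separated x hx
  have hb : BddAbove {i | x ∈ L i} := by
    refine ⟨j, fun i hi => ?_⟩
    by_contra h
    exact hj (hL.anti (not_le.1 h).le hi)
  constructor
  · exact fun h => le_csSup hb h
  · intro h
    exact hL.anti h (Int.csSup_mem (s := {i | x ∈ L i}) (hL.exhaustive x) hb)

lemma IsFiltration.mem_level {L : ℤ → AddSubgroup M} (hL : IsFiltration L) {x : M} (hx : x ≠ 0) :
    x ∈ L (level L x) := (hL.mem_iff hx _).2 le_rfl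

lemma IsFiltration.eq_zero_of_forall {L : ℤ → AddSubgroup M} (hL : IsFiltration L) {x : M}
    (h : ∀ i, x ∈ L i) : x = 0 := by
  by_contra hx
  obtain ⟨i, hi⟩ := hL.separated x hx
  exact hi (h i)

variable {R : Type*} [DivisionRing R] [Module R M]

/-- A family of non-zero vectors is orthogonal for a filtration `L` if a linear combination lies
in `L i` only if each of its terms does. -/
def IsOrthogonal (L : ℤ → AddSubgroup M) {k : ℕ} (b : Fin k → M) : Prop :=
  (∀ j, b j ≠ 0) ∧ ∀ (c : Fin k → R) (i : ℤ), ∑ j, c j • b j ∈ L i → ∀ j, c j • b j ∈ L i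

lemma IsOrthogonal.linearIndependent {L : ℤ → AddSubgroup M} (hL : IsFiltration L) {k : ℕ}
    {b : Fin k → M} (hb : IsOrthogonal (R := R) L b) : LinearIndependent R b := by
  rw [Fintype.linearIndependent_iff]
  intro c hc j
  have : c j • b j = 0 := hL.eq_zero_of_forall fun i => hb.2 c i (hc ▸ zero_mem _) j
  exact (smul_eq_zero.1 this).resolve_right (hb.1 j)

/-- A family of vectors orthogonal for `L` extends by any vector `x` that is a best approximation,
that is, whose level is maximal in its coset modulo the span of the family. -/
lemma IsOrthogonal.snoc {L : ℤ → AddSubgroup M} (hL : IsFiltration L) (s : R → ℤ)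
    (hs : ∀ c : R, c ≠ 0 → ∀ x i, c • x ∈ L (i + s c) ↔ x ∈ L i) {k : ℕ}
    {b : Fin k → M} (hb : IsOrthogonal (R := R) L b) {x : M} {n : ℤ} (hx : x ∈ L n)
    (hx' : ∀ w ∈ Submodule.span R (Set.range b), x + w ∉ L (n + 1)) :
    IsOrthogonal (R := R) L (Fin.snoc b x : Fin (k + 1) → M) := by
  have hx0 : x ≠ 0 := by
    rintro rfl
    exact hx' 0 (zero_mem _) (by simp [zero_mem])
  refine ⟨fun j => ?_, fun c i hc => ?_⟩
  · refine Fin.lastCases ?_ (fun j => ?_) j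
    · simpa using hx0
    · simpa using hb.1 j
  · rw [Fin.sum_univ_castSucc] at hc
    simp only [Fin.snoc_castSucc, Fin.snoc_last] at hc
    set w := ∑ j : Fin k, c j.castSucc • b j with hw
    have hlast : c (Fin.last k) • x ∈ L i := by
      by_cases h0 : c (Fin.last k) = 0
      · simp [h0, zero_mem]
      set a := c (Fin.last k)
      have hwspan : a⁻¹ • w ∈ Submodule.span R (Set.range b) :=
        Submodule.smul_mem _ _ (Submodule.sum_mem _ fun j _ =>
          Submodule.smul_mem _ _ (Submodule.subset_span ⟨j, rfl⟩))
      have h1 : x + a⁻¹ • w ∈ L (i - s a) := by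
        rw [← hs a h0, smul_add, smul_inv_smul₀ h0, add_comm (a • x)]
        simpa using hc
      have h2 : i - s a ≤ n := by
        by_contra hlt
        exact hx' _ hwspan (hL.anti (by omega) h1)
      have := (hs a h0 x n).2 hx
      exact hL.anti (by omega) this
    have hwi : w ∈ L i := by
      have := sub_mem hc hlast
      simpa using this
    intro j
    refine Fin.lastCases ?_ (fun j => ?_) j
    · simpa using hlast
    · simpa using hb.2 _ i hwi j

/-- Existence of orthogonal bases: a finite-dimensional vector space over a division ring with a
filtration that is compatible with scalars and for which subspaces are closed has a basis adapted
to the filtration. -/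
theorem exists_orthogonal_basis [FiniteDimensional R M] {L : ℤ → AddSubgroup M}
    (hL : IsFiltration L) (s : R → ℤ)
    (hs : ∀ c : R, c ≠ 0 → ∀ x i, c • x ∈ L (i + s c) ↔ x ∈ L i)
    (hclosed : ∀ (W : Submodule R M) (x : M), x ∉ W → ∃ B, ∀ w ∈ W, x + w ∉ L B) :
    ∃ (k : ℕ) (b : Module.Basis (Fin k) R M),
      ∀ i x, x ∈ L i ↔ ∀ j, b.repr x j • b j ∈ L i := by
  classical
  -- an orthogonal family of maximal length spans
  let P : ℕ → Prop := fun k => ∃ b : Fin k → M, IsOrthogonal (R := R) L b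
  have hP0 : P 0 := ⟨Fin.elim0, fun j => j.elim0, fun _ _ _ j => j.elim0⟩
  have hPb : ∀ k, P k → k ≤ Module.finrank R M := by
    rintro k ⟨b, hb⟩
    simpa using (hb.linearIndependent hL).fintype_card_le_finrank
  have hk := Nat.findGreatest_spec (P := P) (Nat.zero_le (Module.finrank R M)) hP0
  have hmax : ∀ m, P m → m ≤ Nat.findGreatest P (Module.finrank R M) := fun m hm =>
    Nat.le_findGreatest (hPb m hm) hm
  set k := Nat.findGreatest P (Module.finrank R M)
  obtain ⟨b, hb⟩ := hk
  have hspan : ⊤ ≤ Submodule.span R (Set.range b) := by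
    by_contra hne
    obtain ⟨x, -, hx⟩ := Set.not_subset.1 hne
    obtain ⟨B, hB⟩ := hclosed _ x hx
    have hbdd : BddAbove {i | ∃ w ∈ Submodule.span R (Set.range b), x + w ∈ L i} := by
      refine ⟨B, ?_⟩
      rintro i ⟨w, hw, hi⟩
      by_contra h
      exact hB w hw (hL.anti (not_le.1 h).le hi)
    have hnon : {i | ∃ w ∈ Submodule.span R (Set.range b), x + w ∈ L i}.Nonempty := by
      obtain ⟨i, hi⟩ := hL.exhaustive x
      exact ⟨i, 0, zero_mem _, by simpa using hi⟩
    obtain ⟨w, hw, hwn⟩ := Int.csSup_mem hnon hbdd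
    have := IsOrthogonal.snoc hL s hs hb hwn (by
      intro w' hw' h
      have := le_csSup hbdd ⟨w + w', add_mem hw hw', by rwa [← add_assoc]⟩
      omega)
    have := hmax _ ⟨_, this⟩
    omega
  let B := Module.Basis.mk (hb.linearIndependent hL) hspan
  have hBb : ∀ j, B j = b j := fun j => by simp [B]
  refine ⟨k, B, fun i x => ⟨fun hx j => ?_, fun hx => ?_⟩⟩
  · rw [hBb]
    refine hb.2 (fun j => B.repr x j) i ?_ j
    simp_rw [← hBb]
    rwa [B.sum_repr]
  · rw [← B.sum_repr x]
    exact sum_mem fun j _ => hx j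

end Filtration

/-! ### Traces of integral matrices -/

section IntegralMatrices

set_option linter.unusedSectionVars false

variable {F : Type u} [Field F] [ValuativeRel F] [TopologicalSpace F]
  [IsNonarchimedeanLocalField F]

lemma mem_integer_of_isIntegral {x : F} (hx : IsIntegral 𝒪[F] x) : x ∈ 𝒪[F] :=
  (Valuation.integer.integers (valuation F)).mem_of_integral hx

variable {K : Type*} [Field K] [Algebra F K] {r : ℕ}

lemma isIntegral_of_mem_spectrum {X : Matrix (Fin r) (Fin r) K}
    (hX : IsIntegral 𝒪[F] X) {μ : K} (hμ : μ ∈ spectrum K X) : IsIntegral 𝒪[F] μ := by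
  have : Nontrivial (Matrix (Fin r) (Fin r) K) := by
    by_contra h
    rw [not_nontrivial_iff_subsingleton] at h
    rw [spectrum.of_subsingleton] at hμ
    exact hμ
  obtain ⟨p, hp, hpX⟩ := hX
  have h1 : Polynomial.aeval X (p.map (algebraMap 𝒪[F] K)) = 0 := by
    rw [Polynomial.aeval_map_algebraMap]; exact hpX
  have h2 := spectrum.subset_polynomial_aeval X (p.map (algebraMap 𝒪[F] K)) ⟨μ, hμ, rfl⟩
  rw [h1, spectrum.zero_eq] at h2
  refine ⟨p, hp, ?_⟩
  simpa [Polynomial.eval_map] using h2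

lemma isIntegral_of_mem_roots_charpoly {X : Matrix (Fin r) (Fin r) K}
    (hX : IsIntegral 𝒪[F] X) {μ : K} (hμ : μ ∈ X.charpoly.roots) : IsIntegral 𝒪[F] μ :=
  isIntegral_of_mem_spectrum hX
    (Matrix.mem_spectrum_iff_isRoot_charpoly.2 (Polynomial.isRoot_of_mem_roots hμ))

lemma isIntegral_map_matrix {L : Type*} [Field L] [Algebra F L] (f : K →ₐ[F] L)
    {X : Matrix (Fin r) (Fin r) K} (hX : IsIntegral 𝒪[F] X) : IsIntegral 𝒪[F] (X.map f) :=
  hX.map ((f.mapMatrix (m := Fin r)).restrictScalars 𝒪[F])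

lemma isIntegral_det {X : Matrix (Fin r) (Fin r) F} (hX : IsIntegral 𝒪[F] X) :
    X.det ∈ 𝒪[F] := by
  apply mem_integer_of_isIntegral
  let Ω := AlgebraicClosure F
  have h := isIntegral_map_matrix (Algebra.ofId F Ω) hX
  have h1 : IsIntegral 𝒪[F] (X.map (Algebra.ofId F Ω)).det := by
    rw [Matrix.det_eq_prod_roots_charpoly]
    exact IsIntegral.multiset_prod fun μ hμ => isIntegral_of_mem_roots_charpoly h hμ
  have h2 : (X.map (Algebra.ofId F Ω)).det = algebraMap F Ω X.det := by
    rw [RingHom.map_det]; rfl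
  rw [h2] at h1
  exact (isIntegral_algHom_iff ((Algebra.ofId F Ω).restrictScalars 𝒪[F])
    (algebraMap F Ω).injective).1 h1

/-- The trace of an integral matrix `X` such that `X ^ m` is the product of an integral matrix and
an element of `𝔭_F` lies in `𝔭_F` if it lies in `F`: the eigenvalues of `X` lie in a prime ideal
above `𝔭_F` of the integral closure of `𝔬_F`. -/
lemma trace_mem_of_isIntegral {X : Matrix (Fin r) (Fin r) K} (hX : IsIntegral 𝒪[F] X) {t : F}
    (ht : algebraMap F K t = X.trace) {π : F} {m : ℕ} (hπ : π ≠ 0) (hπ1 : π ∈ fracIdeal F 1)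
    (hm : IsIntegral 𝒪[F] (π⁻¹ • X ^ m)) : t ∈ fracIdeal F 1 := by
  let Ω := AlgebraicClosure K
  let f : K →ₐ[F] Ω := IsScalarTower.toAlgHom F K Ω
  let Y := X.map f
  have hY : IsIntegral 𝒪[F] Y := isIntegral_map_matrix f hX
  have htr : algebraMap F Ω t = Y.charpoly.roots.sum := by
    rw [← Matrix.trace_eq_sum_roots_charpoly, IsScalarTower.algebraMap_apply F K Ω, ht,
      AddMonoidHom.map_trace]
    rfl
  have hroots : ∀ μ ∈ Y.charpoly.roots, IsIntegral 𝒪[F] μ := fun μ hμ =>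
    isIntegral_of_mem_roots_charpoly hY hμ
  have h1 : IsIntegral 𝒪[F] (algebraMap F Ω t) := htr ▸ IsIntegral.multiset_sum hroots
  have ht0 : t ∈ 𝒪[F] := mem_integer_of_isIntegral <|
    (isIntegral_algHom_iff ((Algebra.ofId F Ω).restrictScalars 𝒪[F])
      (algebraMap F Ω).injective).1 h1
  let O := integralClosure 𝒪[F] Ω
  have hinj : Function.Injective (algebraMap 𝒪[F] O) := by
    intro a b hab
    have : algebraMap F Ω a = algebraMap F Ω b := congrArg Subtype.val hab
    exact Subtype.ext ((algebraMap F Ω).injective this)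
  have : FaithfulSMul 𝒪[F] O := (faithfulSMul_iff_algebraMap_injective _ _).2 hinj
  obtain ⟨Q, -, hQ, hQ'⟩ := Ideal.exists_ideal_over_prime_of_isIntegral 𝓂[F] (⊥ : Ideal O) (by
    rw [Ideal.comap_bot_of_injective _ hinj]; exact bot_le)
  let π' : 𝒪[F] := ⟨π, mem_integer_iff.2 (fracIdeal_anti (by norm_num) hπ1)⟩
  have hπ' : algebraMap 𝒪[F] O π' ∈ Q := by
    rw [← Ideal.mem_comap, hQ']
    exact mem_maximalIdeal_iff.2 hπ1
  have key : ∀ μ (hμ : μ ∈ Y.charpoly.roots), (⟨μ, hroots μ hμ⟩ : O) ∈ Q := by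
    intro μ hμ
    have hμs : μ ∈ spectrum Ω Y :=
      Matrix.mem_spectrum_iff_isRoot_charpoly.2 (Polynomial.isRoot_of_mem_roots hμ)
    have hm' : IsIntegral 𝒪[F] (algebraMap F Ω π⁻¹ • Y ^ m) := by
      have := isIntegral_map_matrix f hm
      have e : (π⁻¹ • X ^ m).map f = algebraMap F Ω π⁻¹ • Y ^ m := by
        change f.mapMatrix (π⁻¹ • X ^ m) = _
        rw [map_smul, map_pow, algebraMap_smul]
        rfl
      rwa [e] at this
    have h2 : μ ^ m * algebraMap F Ω π⁻¹ ∈ spectrum Ω (algebraMap F Ω π⁻¹ • Y ^ m) := by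
      have := spectrum.subset_polynomial_aeval Y
        (Polynomial.C (algebraMap F Ω π⁻¹) * Polynomial.X ^ m) ⟨μ, hμs, rfl⟩
      rw [map_mul, Polynomial.aeval_C, map_pow, Polynomial.aeval_X, ← Algebra.smul_def] at this
      beta_reduce at this
      rwa [Polynomial.eval_mul, Polynomial.eval_C, Polynomial.eval_pow, Polynomial.eval_X,
        mul_comm] at this
    have h3 := isIntegral_of_mem_spectrum hm' h2
    have h4 : (⟨μ, hroots μ hμ⟩ : O) ^ m = ⟨_, h3⟩ * algebraMap 𝒪[F] O π' := by
      apply Subtype.ext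
      change μ ^ m = μ ^ m * algebraMap F Ω π⁻¹ * algebraMap F Ω π
      rw [mul_assoc, ← map_mul, inv_mul_cancel₀ hπ, map_one, mul_one]
    exact hQ.mem_of_pow_mem m (h4 ▸ Q.mul_mem_left _ hπ')
  have hsum : algebraMap 𝒪[F] O ⟨t, ht0⟩ ∈ Q := by
    have : algebraMap 𝒪[F] O ⟨t, ht0⟩ =
        (Y.charpoly.roots.attach.map fun μ => (⟨μ.1, hroots μ.1 μ.2⟩ : O)).sum := by
      apply Subtype.ext
      change algebraMap F Ω t = O.val _
      rw [htr, map_multiset_sum, Multiset.map_map]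
      conv_lhs => rw [← Multiset.attach_map_val Y.charpoly.roots]
      rfl
    rw [this]
    refine multiset_sum_mem _ fun a ha => ?_
    obtain ⟨μ, -, rfl⟩ := Multiset.mem_map.1 ha
    exact key μ.1 μ.2
  rw [← Ideal.mem_comap, hQ'] at hsum
  exact mem_maximalIdeal_iff.1 hsum

end IntegralMatrices

/-! ### The topology of `F` -/

section Topology

variable {F : Type u} [Field F] [ValuativeRel F] [TopologicalSpace F]
  [IsNonarchimedeanLocalField F]

lemma exists_fracIdeal_subset {U : Set F} (hU : U ∈ nhds (0 : F)) :
    ∃ n : ℤ, (fracIdeal F n : Set F) ⊆ U := by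
  obtain ⟨γ, hγ, h⟩ := (IsValuativeTopology.hasBasis_nhds_zero' F).mem_iff.1 hU
  obtain ⟨y, rfl⟩ := valuation_surjective γ
  have hy : y ≠ 0 := by rintro rfl; simp at hγ
  refine ⟨ord F y + 1, fun x hx => h ?_⟩
  rcases hx with rfl | hx
  · simpa [zero_lt_iff] using hy
  · by_cases hx0 : x = 0
    · simpa [hx0, zero_lt_iff] using hy
    rw [Set.mem_ofPred_eq, ← not_le, ← ord_le_iff hx0 hy]
    omega

variable (F) in
lemma isOpen_fracIdeal (n : ℤ) : IsOpen (fracIdeal F n : Set F) := by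
  apply AddSubgroup.isOpen_of_mem_nhds (g := 0)
  obtain ⟨y, hy, hyn⟩ := exists_ord_eq F (n - 1)
  refine (IsValuativeTopology.hasBasis_nhds_zero' F).mem_iff.2
    ⟨valuation F y, by simpa using hy, fun x hx => ?_⟩
  by_cases hx0 : x = 0
  · exact Or.inl hx0
  · right
    rw [Set.mem_ofPred_eq, ← not_le, ← ord_le_iff hx0 hy] at hx
    omega

lemma isClosed_fracIdeal (n : ℤ) : IsClosed (fracIdeal F n : Set F) :=
  AddSubgroup.isClosed_of_isOpen _ (isOpen_fracIdeal F n)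

lemma isCompact_fracIdeal_zero : IsCompact (fracIdeal F 0 : Set F) := by
  have h := IsNonarchimedeanLocalField.isCompact_closedBall F 1
  convert h using 1
  ext x
  rw [SetLike.mem_coe, ← mem_integer_iff]
  rfl

lemma exists_subset_fracIdeal {S : Set F} (hS : IsCompact S) :
    ∃ n : ℤ, S ⊆ fracIdeal F n := by
  obtain ⟨n, hn⟩ := hS.elim_directed_cover (fun n : ℤ => (fracIdeal F n : Set F))
    (isOpen_fracIdeal F) (fun x _ => Set.mem_iUnion.2 ⟨ord F x, Or.inr le_rfl⟩)
    (fun m n => ⟨min m n, fracIdeal_anti (min_le_left _ _), fracIdeal_anti (min_le_right _ _)⟩)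
  exact ⟨n, hn⟩

lemma exists_disjoint_fracIdeal {S : Set F} (hS : IsCompact S) (h0 : (0 : F) ∉ S) :
    ∃ n : ℤ, ∀ x ∈ S, x ∉ fracIdeal F n := by
  obtain ⟨n, hn⟩ := hS.elim_directed_cover (fun n : ℤ => (fracIdeal F n : Set F)ᶜ)
    (fun n => (isClosed_fracIdeal n).isOpen_compl)
    (fun x hx => Set.mem_iUnion.2 ⟨ord F x + 1, by
      rw [Set.mem_compl_iff, SetLike.mem_coe, mem_fracIdeal_of_ne (by rintro rfl; exact h0 hx)]
      omega⟩)
    (fun m n => ⟨max m n, Set.compl_subset_compl.2 (fracIdeal_anti (le_max_left _ _)),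
      Set.compl_subset_compl.2 (fracIdeal_anti (le_max_right _ _))⟩)
  exact ⟨n, hn⟩

end Topology

/-! ### The normalized valuation of a division algebra -/

section Valuation

set_option linter.unusedSectionVars false

variable (F : Type u) [Field F] [ValuativeRel F] [TopologicalSpace F]
  [IsNonarchimedeanLocalField F] (D : Type v) [DivisionRing D] [Algebra F D]

/-- `v` is the normalized valuation of the division algebra `D` (its value at `0` is not
meaningful), and `e` is the ramification index of `D` over `F`. -/
structure IsNormalizedValuation (v : D → ℤ) (e : ℕ) : Prop where
  map_mul : ∀ x y, x ≠ 0 → y ≠ 0 → v (x * y) = v x + v y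
  map_add : ∀ x y, x ≠ 0 → y ≠ 0 → x + y ≠ 0 → min (v x) (v y) ≤ v (x + y)
  integral_iff : ∀ x, x ≠ 0 → (x ∈ ringOfIntegers F D ↔ 0 ≤ v x)
  exists_eq_one : ∃ x, x ≠ 0 ∧ v x = 1
  map_algebraMap : ∀ c : F, c ≠ 0 → v (algebraMap F D c) = e * ord F c
  ramification_pos : 0 < e
  bounded : ∀ f : D →ₗ[F] F, ∃ n, ∀ x ∈ ringOfIntegers F D, f x ∈ fracIdeal F n

variable {F D}

lemma isIntegral_one_add {x : D} (hx : IsIntegral 𝒪[F] x) : IsIntegral 𝒪[F] (1 + x) := by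
  obtain ⟨p, hp, hpx⟩ := hx
  refine ⟨p.comp (Polynomial.X - Polynomial.C 1), hp.comp_X_sub_C 1, ?_⟩
  change Polynomial.aeval (1 + x) _ = 0
  rw [Polynomial.aeval_comp]
  rw [← hpx]
  simp [Polynomial.aeval_def]

omit [ValuativeRel F] [TopologicalSpace F] [IsNonarchimedeanLocalField F] in
lemma norm_ne_zero {x : D} (hx : x ≠ 0) : Algebra.norm F x ≠ 0 := by
  intro h
  have : Algebra.norm F (x * x⁻¹) = 1 := by rw [mul_inv_cancel₀ hx, map_one]
  rw [map_mul, h, zero_mul] at this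
  exact zero_ne_one this

variable [FiniteDimensional F D]

/-- The elements of `D` whose norm is integral have bounded coordinates: the norm is bounded away
from `0` on the primitive vectors, which form a compact set. -/
lemma exists_bound_repr {n : ℕ} (b : Module.Basis (Fin n) F D) :
    ∃ C : ℤ, ∀ x : D, x ≠ 0 → 0 ≤ ord F (Algebra.norm F x) → ∀ i, b.repr x i ∈ fracIdeal F C := by
  classical
  let f : (Fin n → F) → F := fun c => Algebra.norm F (∑ i, c i • b i)
  have hf : Continuous f := by
    have : f = fun c => (∑ i, c i • Algebra.leftMulMatrix b (b i)).det := by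
      funext c
      simp only [f]
      rw [Algebra.norm_eq_matrix_det b, map_sum]
      simp only [map_smul]
    rw [this]
    apply Continuous.matrix_det
    fun_prop
  let S : Set (Fin n → F) := {c | (∀ i, c i ∈ fracIdeal F 0) ∧ ∃ i, c i ∉ fracIdeal F 1}
  have hS : IsCompact S := by
    have h1 : IsCompact {c : Fin n → F | ∀ i, c i ∈ (fracIdeal F 0 : Set F)} :=
      isCompact_pi_infinite fun _ => isCompact_fracIdeal_zero
    have h2 : IsClosed {c : Fin n → F | ∃ i, c i ∉ fracIdeal F 1} := by
      rw [Set.ofPred_exists]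
      refine isClosed_iUnion_of_finite fun i => ?_
      exact ((isOpen_fracIdeal F 1).preimage (continuous_apply i)).isClosed_compl
    exact h1.inter_right h2
  obtain ⟨C, hC⟩ := exists_disjoint_fracIdeal (hS.image hf) (by
    rintro ⟨c, ⟨-, i, hi⟩, hc⟩
    have h0 : ∑ i, c i • b i = 0 := by
      by_contra h
      exact norm_ne_zero h hc
    have := Fintype.linearIndependent_iff.1 b.linearIndependent c h0 i
    exact hi (this ▸ zero_mem _))
  refine ⟨-|C|, fun x hx0 hx i => ?_⟩
  obtain ⟨t, ht0, hmem⟩ := exists_mul_primitive (g := b.repr x) (fun h => hx0 (by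
    rw [← b.sum_repr x, h]; simp))
  have hval := hC _ ⟨_, hmem, rfl⟩
  have e1 : f (fun i => t * b.repr x i) = t ^ n * Algebra.norm F x := by
    have : ∑ i, (t * b.repr x i) • b i = algebraMap F D t * x := by
      conv_rhs => rw [← b.sum_repr x]
      rw [← Algebra.smul_def, Finset.smul_sum]
      simp only [mul_smul]
    simp only [f]
    rw [this, map_mul, Algebra.norm_algebraMap, Module.finrank_eq_card_basis b, Fintype.card_fin]
  have hNx := norm_ne_zero (F := F) hx0
  rw [e1, mem_fracIdeal_of_ne (mul_ne_zero (pow_ne_zero _ ht0) hNx),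
    ord_mul (pow_ne_zero _ ht0) hNx, ord_pow] at hval
  have hn : (1 : ℤ) ≤ n := by
    have : 0 < n := Fin.pos_iff_nonempty.2 ⟨i⟩
    omega
  have h1 : C ≤ |C| := le_abs_self C
  have ht : ord F t ≤ |C| := by
    by_contra hlt
    push Not at hlt
    have h2 : 1 ≤ ord F t := by have := abs_nonneg C; omega
    nlinarith
  by_cases hi : b.repr x i = 0
  · exact Or.inl hi
  have := hmem.1 i
  rw [mem_fracIdeal_of_ne (mul_ne_zero ht0 hi), ord_mul ht0 hi] at this
  rw [mem_fracIdeal_of_ne hi]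
  omega

/-- An element of `D` is integral if and only if its norm is: if the norm of `x` is integral, then
the powers of `x` have bounded coordinates and generate a finite module over `𝔬_F`. -/
lemma ord_norm_nonneg_iff {x : D} (hx : x ≠ 0) :
    0 ≤ ord F (Algebra.norm F x) ↔ x ∈ ringOfIntegers F D := by
  let b := Module.finBasis F D
  constructor
  · intro h
    obtain ⟨C, hC⟩ := exists_bound_repr b
    obtain ⟨t, ht0, ht⟩ := exists_ord_eq F C
    let Λ : Submodule 𝒪[F] D := Submodule.span 𝒪[F] (Set.range fun i => t • b i)
    have hΛ : Λ.FG := Submodule.fg_span (Set.finite_range _)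
    have hpow : ∀ k : ℕ, x ^ k ∈ Λ := by
      intro k
      have := hC (x ^ k) (pow_ne_zero _ hx) (by rw [map_pow, ord_pow]; positivity)
      rw [← b.sum_repr (x ^ k)]
      refine Submodule.sum_mem _ fun i _ => ?_
      have hi : t⁻¹ * b.repr (x ^ k) i ∈ 𝒪[F] := by
        rw [mem_integer_iff]
        have h2 : t⁻¹ ∈ fracIdeal F (-C) := Or.inr (by rw [ord_inv, ht])
        simpa using mul_mem_fracIdeal h2 (this i)
      have e : b.repr (x ^ k) i • b i = (⟨_, hi⟩ : 𝒪[F]) • (t • b i) := by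
        change _ = (t⁻¹ * b.repr (x ^ k) i) • t • b i
        rw [smul_smul]
        congr 1
        field_simp
      rw [e]
      exact Submodule.smul_mem _ _ (Submodule.subset_span ⟨i, rfl⟩)
    have hle : (Algebra.adjoin 𝒪[F] {x}).toSubmodule ≤ Λ := by
      intro y hy
      rw [Subalgebra.mem_toSubmodule, Algebra.adjoin_singleton_eq_range_aeval] at hy
      obtain ⟨p, rfl⟩ := hy
      change Polynomial.aeval x p ∈ Λ
      rw [Polynomial.aeval_eq_sum_range]
      exact Submodule.sum_mem _ fun k _ => Submodule.smul_mem _ _ (hpow k)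
    have : IsNoetherian 𝒪[F] Λ := isNoetherian_of_fg_of_noetherian _ hΛ
    exact isIntegral_of_submodule_noetherian _ (isNoetherian_of_le hle) x
      (Algebra.self_mem_adjoin_singleton _ _)
  · intro h
    have h1 : IsIntegral 𝒪[F] (Algebra.leftMulMatrix b x) :=
      h.map ((Algebra.leftMulMatrix b).restrictScalars 𝒪[F])
    have h2 := isIntegral_det h1
    rw [← Algebra.norm_eq_matrix_det b] at h2
    exact integer_ord_nonneg ⟨_, h2⟩

variable (F D) in
/-- The division algebra `D` has a normalized valuation, a multiple of the valuation of the norm.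
The ultrametric inequality holds since `1 + x` is integral if `x` is. -/
theorem exists_isNormalizedValuation : ∃ (v : D → ℤ) (e : ℕ), IsNormalizedValuation F D v e := by
  classical
  let w : D → ℤ := fun x => ord F (Algebra.norm F x)
  have hw : ∀ x y, x ≠ 0 → y ≠ 0 → w (x * y) = w x + w y := fun x y hx hy => by
    simp only [w]; rw [map_mul, ord_mul (norm_ne_zero hx) (norm_ne_zero hy)]
  let H : AddSubgroup ℤ :=
    { carrier := {k | ∃ x, x ≠ 0 ∧ w x = k}
      zero_mem' := ⟨1, one_ne_zero, by simp [w]⟩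
      add_mem' := by
        rintro _ _ ⟨x, hx, rfl⟩ ⟨y, hy, rfl⟩
        exact ⟨x * y, mul_ne_zero hx hy, hw x y hx hy⟩
      neg_mem' := by
        rintro _ ⟨x, hx, rfl⟩
        refine ⟨x⁻¹, inv_ne_zero hx, ?_⟩
        have := hw x x⁻¹ hx (inv_ne_zero hx)
        rw [mul_inv_cancel₀ hx] at this
        simp only [w, map_one, ord_one] at this ⊢
        linarith }
  obtain ⟨a, ha⟩ := Int.subgroup_cyclic H
  have hmem : ∀ k, k ∈ H ↔ a ∣ k := fun k => by
    rw [ha, AddSubgroup.mem_closure_singleton]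
    exact ⟨fun ⟨n, hn⟩ => ⟨n, by rw [← hn, smul_eq_mul, mul_comm]⟩,
      fun ⟨n, hn⟩ => ⟨n, by rw [hn, smul_eq_mul, mul_comm]⟩⟩
  let d := Module.finrank F D
  have hd : 0 < d := Module.finrank_pos
  have hwF : ∀ c : F, w (algebraMap F D c) = d * ord F c := fun c => by
    simp only [w]; rw [Algebra.norm_algebraMap, ord_pow]
  have hdH : (d : ℤ) ∈ H := by
    obtain ⟨π, hπ0, hπ⟩ := exists_ord_eq F 1
    exact ⟨algebraMap F D π, by simpa using hπ0, by rw [hwF, hπ, mul_one]⟩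
  -- the positive generator of the group of valuations of norms
  let g : ℤ := |a|
  have hg0 : 0 < g := by
    rw [abs_pos]
    rintro rfl
    rw [hmem, zero_dvd_iff] at hdH
    omega
  have hgw : ∀ x, x ≠ 0 → g ∣ w x := fun x hx => (abs_dvd _ _).2 ((hmem _).1 ⟨x, hx, rfl⟩)
  have hgH : g ∈ H := by rw [hmem]; exact (dvd_abs a a).2 dvd_rfl
  have hgd : g ∣ d := (abs_dvd _ _).2 ((hmem _).1 hdH)
  have hint : ∀ x, x ≠ 0 → (x ∈ ringOfIntegers F D ↔ 0 ≤ w x / g) := fun x hx => by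
    rw [← ord_norm_nonneg_iff hx]
    exact ⟨fun h => Int.ediv_nonneg h hg0.le, fun h => by
      have := mul_nonneg h hg0.le
      rwa [Int.ediv_mul_cancel (hgw x hx)] at this⟩
  have hmul : ∀ x y, x ≠ 0 → y ≠ 0 → w (x * y) / g = w x / g + w y / g := fun x y hx hy => by
    rw [hw x y hx hy, Int.add_ediv_of_dvd_left (hgw x hx)]
  obtain ⟨e, he⟩ : ∃ e : ℕ, (d : ℤ) = g * e := by
    obtain ⟨e, he⟩ := hgd
    have : 0 ≤ e := by
      by_contra h
      push Not at h
      nlinarith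
    exact ⟨e.toNat, by rw [Int.toNat_of_nonneg this, he]⟩
  have haux : ∀ x y, x ≠ 0 → y ≠ 0 → x + y ≠ 0 → w x / g ≤ w y / g →
      w x / g ≤ w (x + y) / g := by
    intro x y hx hy hxy hle
    have e1 : x + y = x * (1 + x⁻¹ * y) := by rw [mul_add, mul_one, mul_inv_cancel_left₀ hx]
    have h1 : 1 + x⁻¹ * y ≠ 0 := by
      intro h; rw [h, mul_zero] at e1; exact hxy e1
    have h2 : x⁻¹ * y ≠ 0 := mul_ne_zero (inv_ne_zero hx) hy
    have h3 := hmul x (x⁻¹ * y) hx h2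
    rw [mul_inv_cancel_left₀ hx] at h3
    have h4 : x⁻¹ * y ∈ ringOfIntegers F D := by rw [hint _ h2]; omega
    have h5 := (hint _ h1).1 (isIntegral_one_add h4)
    rw [e1, hmul _ _ hx h1]
    omega
  refine ⟨fun x => w x / g, e, ⟨hmul, ?_, hint, ?_, ?_, ?_, ?_⟩⟩
  · intro x y hx hy hxy
    rcases le_total (w x / g) (w y / g) with h | h
    · exact (min_le_left _ _).trans (haux x y hx hy hxy h)
    · rw [add_comm] at hxy ⊢
      exact (min_le_right _ _).trans (haux y x hy hx hxy h)
  · obtain ⟨x, hx, hxg⟩ := hgH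
    exact ⟨x, hx, by simp only [hxg]; exact Int.ediv_self hg0.ne'⟩
  · intro c hc
    simp only [hwF, he]
    rw [mul_assoc, Int.mul_ediv_cancel_left _ hg0.ne']
  · by_contra h
    have : e = 0 := by omega
    simp [this] at he
    omega
  · intro f
    obtain ⟨C, hC⟩ := exists_bound_repr (Module.finBasis F D)
    let b := Module.finBasis F D
    have hcoef : ∃ m : ℤ, ∀ i, f (b i) ∈ fracIdeal F m := by
      obtain ⟨m, hm⟩ := exists_subset_fracIdeal (Set.finite_range fun i => f (b i)).isCompact
      exact ⟨m, fun i => hm ⟨i, rfl⟩⟩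
    obtain ⟨m, hm⟩ := hcoef
    refine ⟨C + m, fun x hx => ?_⟩
    by_cases hx0 : x = 0
    · simp [hx0, zero_mem]
    rw [← b.sum_repr x, map_sum]
    refine sum_mem fun i _ => ?_
    rw [map_smul, smul_eq_mul]
    exact mul_mem_fracIdeal (hC x hx0 ((ord_norm_nonneg_iff hx0).2 hx) i) (hm i)

end Valuation

/-! ### Filtrations with bounded linear forms -/

section Closed

variable {F : Type u} [Field F] [ValuativeRel F] [TopologicalSpace F]
  [IsNonarchimedeanLocalField F] {M : Type*} [AddCommGroup M] [Module F M]

/-- Subspaces are closed for a filtration on which the linear forms are bounded. -/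
lemma exists_add_notMem_of_bounded {L : ℤ → AddSubgroup M} {E : ℕ}
    (hs : ∀ c : F, c ≠ 0 → ∀ x i, c • x ∈ L (i + E * ord F c) ↔ x ∈ L i)
    (hb : ∀ f : M →ₗ[F] F, ∃ n, ∀ x ∈ L 0, f x ∈ fracIdeal F n)
    (W : Submodule F M) (x : M) (hx : x ∉ W) : ∃ B, ∀ w ∈ W, x + w ∉ L B := by
  obtain ⟨f, hfx, hf⟩ := Submodule.exists_le_ker_of_notMem hx
  obtain ⟨n, hn⟩ := hb f
  obtain ⟨t, ht0, ht⟩ := exists_ord_eq F (ord F (f x) + 1 - n)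
  refine ⟨E * ord F t, fun w hw h => ?_⟩
  have h1 : t⁻¹ • (x + w) ∈ L 0 := by
    rw [← hs t ht0, smul_inv_smul₀ ht0, zero_add]
    exact h
  have h2 := hn _ h1
  rw [map_smul, map_add, LinearMap.mem_ker.1 (hf hw), add_zero, smul_eq_mul,
    mem_fracIdeal_of_ne (mul_ne_zero (inv_ne_zero ht0) hfx), ord_mul (inv_ne_zero ht0) hfx,
    ord_inv, ht] at h2
  omega

lemma exists_notMem_of_bounded {L : ℤ → AddSubgroup M} {E : ℕ}
    (hs : ∀ c : F, c ≠ 0 → ∀ x i, c • x ∈ L (i + E * ord F c) ↔ x ∈ L i)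
    (hb : ∀ f : M →ₗ[F] F, ∃ n, ∀ x ∈ L 0, f x ∈ fracIdeal F n)
    (x : M) (hx : x ≠ 0) : ∃ B, x ∉ L B := by
  obtain ⟨B, hB⟩ := exists_add_notMem_of_bounded hs hb ⊥ x (by simpa using hx)
  exact ⟨B, by simpa using hB 0 (zero_mem _)⟩

end Closed

/-! ### Fractional ideals and residue field of a division algebra -/

namespace IsNormalizedValuation

variable {F : Type u} [Field F] [ValuativeRel F] [TopologicalSpace F]
  [IsNonarchimedeanLocalField F] {D : Type v} [DivisionRing D] [Algebra F D]
  {v : D → ℤ} {e : ℕ} (hv : IsNormalizedValuation F D v e)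

include hv

lemma map_one : v 1 = 0 := by
  have := hv.map_mul 1 1 one_ne_zero one_ne_zero
  rw [mul_one] at this
  omega

lemma map_neg (x : D) : v (-x) = v x := by
  by_cases hx : x = 0
  · simp [hx]
  have h1 := hv.map_mul (-1) (-1) (by simp) (by simp)
  rw [neg_one_mul, neg_neg, hv.map_one] at h1
  have h2 := hv.map_mul (-1) x (by simp) hx
  rw [neg_one_mul] at h2
  omega

lemma map_inv {x : D} (hx : x ≠ 0) : v x⁻¹ = - v x := by
  have := hv.map_mul x x⁻¹ hx (inv_ne_zero hx)
  rw [mul_inv_cancel₀ hx, hv.map_one] at this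
  omega

lemma map_pow {x : D} (hx : x ≠ 0) (n : ℕ) : v (x ^ n) = n * v x := by
  induction n with
  | zero => simp [hv.map_one]
  | succ n ih => rw [pow_succ, hv.map_mul _ _ (pow_ne_zero _ hx) hx, ih]; push_cast; ring

lemma exists_eq (n : ℤ) : ∃ x, x ≠ 0 ∧ v x = n := by
  obtain ⟨x, hx, h⟩ := hv.exists_eq_one
  rcases n with n | n
  · exact ⟨x ^ n, pow_ne_zero _ hx, by rw [hv.map_pow hx, h]; simp⟩
  · refine ⟨(x ^ (n + 1))⁻¹, inv_ne_zero (pow_ne_zero _ hx), ?_⟩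
    rw [hv.map_inv (pow_ne_zero _ hx), hv.map_pow hx, h, mul_one]
    rfl

/-- The fractional ideal `𝔭_D ^ i` for `i : ℤ`, as an additive subgroup of `D`. -/
def ideal (_hv : IsNormalizedValuation F D v e) (i : ℤ) : AddSubgroup D where
  carrier := {x | x = 0 ∨ i ≤ v x}
  zero_mem' := Or.inl rfl
  neg_mem' := by
    rintro x (rfl | h)
    · simp
    · exact Or.inr (by rwa [_hv.map_neg])
  add_mem' := by
    intro x y hx hy
    by_cases h0 : x = 0
    · simpa [h0] using hy
    by_cases h1 : y = 0
    · simpa [h1] using hx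
    by_cases h2 : x + y = 0
    · exact Or.inl h2
    · exact Or.inr ((le_min (hx.resolve_left h0) (hy.resolve_left h1)).trans
        (_hv.map_add x y h0 h1 h2))

lemma mem_ideal {i : ℤ} {x : D} : x ∈ hv.ideal i ↔ x = 0 ∨ i ≤ v x := Iff.rfl

lemma mem_ideal_of_ne {i : ℤ} {x : D} (hx : x ≠ 0) : x ∈ hv.ideal i ↔ i ≤ v x := by
  simp [mem_ideal, hx]

lemma ideal_anti : Antitone hv.ideal := by
  rintro i j h x (rfl | hx)
  · exact zero_mem _
  · exact Or.inr (h.trans hx)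

lemma mul_mem_ideal {i j : ℤ} {x y : D} (hx : x ∈ hv.ideal i) (hy : y ∈ hv.ideal j) :
    x * y ∈ hv.ideal (i + j) := by
  by_cases h0 : x = 0
  · simp [h0, zero_mem]
  by_cases h1 : y = 0
  · simp [h1, zero_mem]
  rw [mem_ideal_of_ne hv h0] at hx
  rw [mem_ideal_of_ne hv h1] at hy
  rw [mem_ideal_of_ne hv (mul_ne_zero h0 h1), hv.map_mul _ _ h0 h1]
  exact add_le_add hx hy

lemma mem_ringOfIntegers_iff {x : D} : x ∈ ringOfIntegers F D ↔ x ∈ hv.ideal 0 := by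
  by_cases hx : x = 0
  · subst hx
    exact ⟨fun _ => zero_mem _, fun _ => isIntegral_zero⟩
  · rw [hv.integral_iff x hx, mem_ideal_of_ne hv hx]

lemma mem_maximalIdeal_iff {x : D} : x ∈ maximalIdeal F D ↔ x ∈ hv.ideal 1 := by
  change (x ∈ ringOfIntegers F D ∧ ¬ ∃ b ∈ ringOfIntegers F D, x * b = 1) ↔ _
  rw [hv.mem_ringOfIntegers_iff]
  by_cases hx : x = 0
  · subst hx
    simp [zero_mem]
  rw [mem_ideal_of_ne hv hx, mem_ideal_of_ne hv hx]
  constructor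
  · rintro ⟨h0, h1⟩
    by_contra h
    refine h1 ⟨x⁻¹, ?_, mul_inv_cancel₀ hx⟩
    rw [hv.mem_ringOfIntegers_iff, mem_ideal_of_ne hv (inv_ne_zero hx), hv.map_inv hx]
    omega
  · intro h
    refine ⟨by omega, ?_⟩
    rintro ⟨b, hb, hxb⟩
    have hb0 : b ≠ 0 := right_ne_zero_of_mul_eq_one hxb
    rw [hv.mem_ringOfIntegers_iff, mem_ideal_of_ne hv hb0] at hb
    have := hv.map_mul x b hx hb0
    rw [hxb, hv.map_one] at this
    omega

lemma smul_eq_iff {c : F} (hc : c ≠ 0) (x : D) (i : ℤ) :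
    c • x ∈ hv.ideal (i + e * ord F c) ↔ x ∈ hv.ideal i := by
  by_cases hx : x = 0
  · simp [hx, zero_mem]
  have hc' : algebraMap F D c ≠ 0 := by simpa using hc
  rw [Algebra.smul_def, mem_ideal_of_ne hv hx, mem_ideal_of_ne hv (mul_ne_zero hc' hx),
    hv.map_mul _ _ hc' hx, hv.map_algebraMap c hc]
  omega

lemma algebraMap_mem {c : F} {m : ℤ} (hc : c ∈ fracIdeal F m) :
    algebraMap F D c ∈ hv.ideal (e * m) := by
  by_cases h : c = 0
  · simp [h, zero_mem]
  rw [mem_fracIdeal_of_ne h] at hc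
  rw [mem_ideal_of_ne hv (by simpa using h), hv.map_algebraMap c h]
  exact mul_le_mul_of_nonneg_left hc (by positivity)

lemma smul_mem {c : F} {m i : ℤ} {x : D} (hc : c ∈ fracIdeal F m) (hx : x ∈ hv.ideal i) :
    c • x ∈ hv.ideal (e * m + i) := by
  rw [Algebra.smul_def]
  exact hv.mul_mem_ideal (hv.algebraMap_mem hc) hx

lemma bounded_ideal (f : D →ₗ[F] F) : ∃ n, ∀ x ∈ hv.ideal 0, f x ∈ fracIdeal F n := by
  obtain ⟨n, hn⟩ := hv.bounded f
  exact ⟨n, fun x hx => hn x (hv.mem_ringOfIntegers_iff.2 hx)⟩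

lemma isFiltration : IsFiltration hv.ideal where
  anti := hv.ideal_anti
  exhaustive x := ⟨v x, Or.inr le_rfl⟩
  separated x hx := ⟨v x + 1, by rw [mem_ideal_of_ne hv hx]; omega⟩

/-- `D` has an `F`-basis that is orthogonal for its valuation. -/
lemma exists_orthogonal_basis [FiniteDimensional F D] :
    ∃ (k : ℕ) (b : Module.Basis (Fin k) F D),
      ∀ i x, x ∈ hv.ideal i ↔ ∀ j, b.repr x j • b j ∈ hv.ideal i :=
  PrincipalOrder.exists_orthogonal_basis hv.isFiltration (fun c => e * ord F c)
    (fun _ hc x i => hv.smul_eq_iff hc x i)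
    (exists_add_notMem_of_bounded (fun _ hc x i => hv.smul_eq_iff hc x i) hv.bounded_ideal)

/-- The ring of integers of `D` as a subring. -/
def integers (_hv : IsNormalizedValuation F D v e) : Subring D where
  __ := _hv.ideal 0
  one_mem' := Or.inr (by rw [_hv.map_one])
  mul_mem' := fun hx hy => by simpa using _hv.mul_mem_ideal hx hy

lemma mem_integers {x : D} : x ∈ hv.integers ↔ x ∈ hv.ideal 0 := Iff.rfl

/-- The inclusion of `𝔬_F` in the ring of integers of `D`. -/
noncomputable def integersMap (_hv : IsNormalizedValuation F D v e) : 𝒪[F] →+* _hv.integers :=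
  ((algebraMap F D).comp (𝒪[F]).subtype).codRestrict _hv.integers fun c => by
    have := _hv.algebraMap_mem (mem_integer_iff.1 c.2)
    rwa [mul_zero] at this

/-- `k` is the residue field of `D`, with reduction map `res`. -/
structure IsResidueField (_hv : IsNormalizedValuation F D v e) {k : Type*} [Ring k]
    (ι : 𝓀[F] →+* k) (res : _hv.integers →+* k) : Prop where
  surjective : Function.Surjective res
  eq_zero_iff : ∀ x, res x = 0 ↔ (x : D) ∈ _hv.ideal 1
  compat : ∀ c : 𝒪[F], res (_hv.integersMap c) = ι (IsLocalRing.residue _ c)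

omit hv in
/-- Lifts of elements of the residue field of `D` that are independent over the residue field of
`F` are independent over `F`. -/
lemma IsResidueField.linearIndependent {hv : IsNormalizedValuation F D v e} {k : Type*} [Ring k]
    {ι : 𝓀[F] →+* k} {res : hv.integers →+* k} (hres : hv.IsResidueField ι res)
    {κ : Type*} [Fintype κ] (x : κ → hv.integers)
    (hx : ∀ c : κ → 𝓀[F], ∑ i, ι (c i) * res (x i) = 0 → ∀ i, c i = 0) :
    LinearIndependent F fun i => (x i : D) := by
  rw [Fintype.linearIndependent_iff]
  intro g hg
  by_contra! hne
  obtain ⟨i₁, hi₁⟩ := hne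
  obtain ⟨t, ht0, hint, j, hj⟩ := exists_mul_primitive (g := g) (fun h => hi₁ (congrFun h i₁))
  let c : κ → 𝒪[F] := fun i => ⟨t * g i, mem_integer_iff.2 (hint i)⟩
  let c' : κ → hv.integers := fun i => hv.integersMap (c i)
  have hsum : ∑ i, c' i * x i = 0 := by
    apply Subtype.ext
    have h1 : ∀ i, ((c' i * x i : hv.integers) : D) = t • g i • (x i : D) := fun i => by
      rw [smul_smul, Algebra.smul_def]
      rfl
    push_cast
    simp only [← Subring.coe_mul, h1]
    rw [← Finset.smul_sum, hg, smul_zero]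
  have h0 := hx (fun i => IsLocalRing.residue _ (c i)) (by
    have := congrArg res hsum
    rw [map_sum, map_zero] at this
    rw [← this]
    refine Finset.sum_congr rfl fun i _ => ?_
    rw [_root_.map_mul, hres.compat]) j
  rw [IsLocalRing.residue_eq_zero_iff, PrincipalOrder.mem_maximalIdeal_iff] at h0
  exact hj h0

/-- The residue ring of `D` is a finite field. -/
lemma exists_isResidueField [FiniteDimensional F D] :
    ∃ (k : Type v) (_ : Field k) (_ : Finite k) (_ : Algebra 𝓀[F] k)
      (res : hv.integers →+* k), hv.IsResidueField (algebraMap 𝓀[F] k) res := by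
  classical
  let 𝔪 : Ideal hv.integers :=
    { carrier := {x | (x : D) ∈ hv.ideal 1}
      zero_mem' := zero_mem (hv.ideal 1)
      add_mem' := fun hx hy => (hv.ideal 1).add_mem hx hy
      smul_mem' := fun c x hx => by simpa using hv.mul_mem_ideal c.2 hx }
  have mem𝔪 : ∀ x, x ∈ 𝔪 ↔ (x : D) ∈ hv.ideal 1 := fun x => by rfl
  have h2 : 𝔪.IsTwoSided := ⟨fun {a} b ha => by
    rw [mem𝔪] at ha ⊢
    simpa using hv.mul_mem_ideal ha b.2⟩
  let k := hv.integers ⧸ 𝔪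
  let res : hv.integers →+* k := Ideal.Quotient.mk 𝔪
  have hres0 : ∀ x, res x = 0 ↔ (x : D) ∈ hv.ideal 1 := fun x => by
    rw [← mem𝔪]; exact Ideal.Quotient.eq_zero_iff_mem
  have : Nontrivial k := by
    refine ⟨1, 0, fun h => ?_⟩
    have h1 : res 1 = 0 := by rw [_root_.map_one]; exact h
    rw [hres0] at h1
    have h3 : (1 : D) ∈ hv.ideal 1 := h1
    rw [mem_ideal_of_ne hv one_ne_zero, hv.map_one] at h3
    omega
  let ι₀ : 𝒪[F] →+* k := res.comp hv.integersMap
  let ι : 𝓀[F] →+* k := Ideal.Quotient.lift 𝓂[F] ι₀ fun c hc => by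
    change res _ = 0
    rw [hres0]
    have := hv.algebraMap_mem (PrincipalOrder.mem_maximalIdeal_iff.1 hc)
    refine hv.ideal_anti ?_ this
    have := hv.ramification_pos
    omega
  have hR : hv.IsResidueField ι res :=
    ⟨Ideal.Quotient.mk_surjective, hres0, fun c => rfl⟩
  let inst : DivisionRing k := DivisionRing.ofIsUnitOrEqZero fun a => by
    obtain ⟨x, rfl⟩ := hR.surjective a
    by_cases hx : res x = 0
    · exact Or.inr hx
    left
    rw [hres0] at hx
    have hx0 : (x : D) ≠ 0 := by rintro h; exact hx (h ▸ zero_mem _)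
    have hx1 := (mem_ideal_of_ne hv hx0).1 x.2
    rw [mem_ideal_of_ne hv hx0] at hx
    let y : hv.integers := ⟨(x : D)⁻¹, by
      rw [hv.mem_integers, mem_ideal_of_ne hv (inv_ne_zero hx0), hv.map_inv hx0]; omega⟩
    exact ⟨⟨res x, res y,
      by rw [← _root_.map_mul, ← _root_.map_one res]
         congr 1; exact Subtype.ext (mul_inv_cancel₀ hx0),
      by rw [← _root_.map_mul, ← _root_.map_one res]
         congr 1; exact Subtype.ext (inv_mul_cancel₀ hx0)⟩, rfl⟩
  let instM : Module 𝓀[F] k := Module.compHom k ι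
  have hfin : Module.Finite 𝓀[F] k := by
    have hle : Module.rank 𝓀[F] k ≤ (Module.finrank F D : ℕ) := by
      refine rank_le fun s hs => ?_
      choose y hy using fun a : k => hR.surjective a
      have := hR.linearIndependent (fun a : s => y a) (by
        rw [Fintype.linearIndependent_iff] at hs
        intro c hc
        apply hs c
        rw [← hc]
        refine Finset.sum_congr rfl fun i _ => ?_
        rw [hy]
        rfl)
      simpa using this.fintype_card_le_finrank
    exact Module.rank_lt_aleph0_iff.1 (hle.trans_lt Cardinal.natCast_lt_aleph0)
  have : Finite k := Module.finite_of_finite 𝓀[F]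
  let instF : Field k := littleWedderburn k
  exact ⟨k, instF, this, RingHom.toAlgebra ι, res, hR⟩

end IsNormalizedValuation

/-! ### Splittings of a division algebra -/

section FiniteField

lemma nextCoeff_map_of_monic {A B : Type*} [CommRing A] [CommRing B] [Nontrivial B] (φ : A →+* B)
    {p : Polynomial A} (hp : p.Monic) : (p.map φ).nextCoeff = φ p.nextCoeff := by
  rw [Polynomial.nextCoeff, Polynomial.nextCoeff, hp.natDegree_map]
  split_ifs <;> simp

/-- A finite extension of a finite field has a generator with non-zero trace, namely an element of
a normal basis. -/
lemma exists_natDegree_minpoly_eq_finrank (k l : Type*) [Field k] [Field l] [Algebra k l]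
    [Finite l] : ∃ α : l, (minpoly k α).natDegree = Module.finrank k l ∧
      (minpoly k α).nextCoeff ≠ 0 := by
  classical
  have : Finite k := Finite.of_injective _ (algebraMap k l).injective
  let b := IsGalois.normalBasis k l
  let α := b 1
  have hα : ∀ σ, b σ = σ α := IsGalois.normalBasis_apply
  have hint : IsIntegral k α := .of_finite k α
  have hinj : Function.Injective fun σ : Gal(l/k) => σ α := fun σ τ h => by
    apply b.injective
    rw [hα, hα]; exact h
  refine ⟨α, le_antisymm (minpoly.natDegree_le α) ?_, fun h => ?_⟩
  · have h1 : ∀ σ : Gal(l/k), σ α ∈ (minpoly k α).rootSet l := fun σ => by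
      rw [Polynomial.mem_rootSet_of_ne (minpoly.ne_zero hint)]
      have := Polynomial.aeval_algHom_apply σ.toAlgHom α (minpoly k α)
      rw [minpoly.aeval, map_zero] at this
      exact this
    rw [← IsGalois.card_aut_eq_finrank]
    refine le_trans ?_ ((minpoly k α).ncard_rootSet_le l)
    rw [← Set.ncard_univ, ← Set.ncard_image_of_injective Set.univ hinj]
    refine Set.ncard_le_ncard ?_ (Polynomial.rootSet_finite _ _)
    rintro _ ⟨σ, -, rfl⟩
    exact h1 σ
  · have h1 : Algebra.trace k l α = 0 := by
      rw [trace_eq_finrank_mul_minpoly_nextCoeff, h, neg_zero, mul_zero]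
    have h2 := trace_eq_sum_automorphisms (K := k) α
    rw [h1, map_zero] at h2
    have h3 := Fintype.linearIndependent_iff.1 b.linearIndependent (fun _ => 1) (by
      simp only [one_smul, hα]
      exact h2.symm) 1
    exact one_ne_zero h3

end FiniteField

section Splitting

variable {F : Type u} [Field F] {D : Type v} [DivisionRing D] [Algebra F D]
  {K : Type*} [Field K] [Algebra F K] {r : ℕ}

/-- The `F`-algebra map `ρ : D → M_r(K)` induces an isomorphism `K ⊗_F D ≃ M_r(K)`: it turns
`F`-independence into `K`-independence and its image spans. -/
structure IsSplitting (ρ : D →ₐ[F] Matrix (Fin r) (Fin r) K) : Prop where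
  linearIndependent : ∀ {n : ℕ} (x : Fin n → D), LinearIndependent F x →
    LinearIndependent K fun i => ρ (x i)
  span_eq_top : Submodule.span K (Set.range ρ) = ⊤

variable {ρ : D →ₐ[F] Matrix (Fin r) (Fin r) K} (hρ : IsSplitting ρ)

include hρ

lemma IsSplitting.span_basis {n : ℕ} (b : Module.Basis (Fin n) F D) :
    ⊤ ≤ Submodule.span K (Set.range fun i => ρ (b i)) := by
  rw [← hρ.span_eq_top, Submodule.span_le]
  rintro _ ⟨x, rfl⟩
  rw [← b.sum_repr x, map_sum]
  refine Submodule.sum_mem _ fun i _ => ?_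
  rw [map_smul, ← algebraMap_smul K]
  exact Submodule.smul_mem _ _ (Submodule.subset_span ⟨i, rfl⟩)

/-- The image in `M_r(K)` of an `F`-basis of `D`. -/
noncomputable def IsSplitting.basis {n : ℕ} (b : Module.Basis (Fin n) F D) :
    Module.Basis (Fin n) K (Matrix (Fin r) (Fin r) K) :=
  Module.Basis.mk (hρ.linearIndependent b b.linearIndependent) (hρ.span_basis b)

lemma IsSplitting.basis_apply {n : ℕ} (b : Module.Basis (Fin n) F D) (i : Fin n) :
    hρ.basis b i = ρ (b i) := by
  simp [basis]

lemma IsSplitting.finrank_eq [FiniteDimensional F D] : Module.finrank F D = r * r := by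
  have := Module.finrank_eq_card_basis (hρ.basis (Module.finBasis F D))
  rw [Module.finrank_matrix] at this
  simpa using this.symm

/-- The degree of an element of `D` over `F` is at most `r`, by Cayley-Hamilton. -/
lemma IsSplitting.le_of_linearIndependent_pow {x : D} {s : ℕ}
    (hx : LinearIndependent F fun i : Fin s => x ^ (i : ℕ)) : s ≤ r := by
  by_contra hlt
  push Not at hlt
  have h1 := hρ.linearIndependent _ hx
  simp only [map_pow] at h1
  have h2 := Matrix.aeval_self_charpoly (ρ x)
  have hd : (ρ x).charpoly.natDegree = r := by simp
  rw [Polynomial.aeval_eq_sum_range' (n := s) (by omega), ← Fin.sum_univ_eq_sum_range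
    (fun i => (ρ x).charpoly.coeff i • ρ x ^ i)] at h2
  have h3 := Fintype.linearIndependent_iff.1 h1 _ h2 ⟨r, hlt⟩
  have h4 := (Matrix.charpoly_monic (ρ x)).coeff_natDegree
  rw [hd] at h4
  exact one_ne_zero (h4.symm.trans h3)

/-- If `x : D` has degree `r` over `F`, then the characteristic polynomial of `ρ x` is the minimal
polynomial of `x`. -/
lemma IsSplitting.charpoly_eq [FiniteDimensional F D] {x : D}
    (hx : (minpoly F x).natDegree = r) :
    (ρ x).charpoly = (minpoly F x).map (algebraMap F K) := by
  set g := (minpoly F x).map (algebraMap F K) with hg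
  have hgm : g.Monic := (minpoly.monic (.of_finite F x)).map _
  have hgd : g.natDegree = r := by rw [hg, Polynomial.natDegree_map, hx]
  have hg0 : Polynomial.aeval (ρ x) g = 0 := by
    rw [hg, Polynomial.aeval_map_algebraMap, Polynomial.aeval_algHom_apply, minpoly.aeval, map_zero]
  have hcm := Matrix.charpoly_monic (ρ x)
  have hcd : (ρ x).charpoly.natDegree = r := by simp
  have h1 := hρ.linearIndependent _ (linearIndependent_pow (K := F) x)
  simp only [map_pow] at h1
  by_contra hne
  set q := (ρ x).charpoly - g
  have hq : q ≠ 0 := sub_ne_zero.2 hne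
  have hqd : q.natDegree < r := by
    have hdeg : (ρ x).charpoly.degree = g.degree := by
      rw [Polynomial.degree_eq_natDegree hcm.ne_zero, Polynomial.degree_eq_natDegree hgm.ne_zero,
        hcd, hgd]
    have := Polynomial.degree_sub_lt_left hdeg hcm.ne_zero
      (by rw [hcm.leadingCoeff, hgm.leadingCoeff])
    rw [Polynomial.degree_eq_natDegree hcm.ne_zero, hcd] at this
    exact (Polynomial.natDegree_lt_iff_degree_lt hq).2 this
  have hq0 : Polynomial.aeval (ρ x) q = 0 := by
    rw [map_sub, hg0, Matrix.aeval_self_charpoly, sub_zero]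
  rw [Polynomial.aeval_eq_sum_range' (n := (minpoly F x).natDegree) (by omega),
    ← Fin.sum_univ_eq_sum_range (fun i => q.coeff i • ρ x ^ i)] at hq0
  have h3 := Fintype.linearIndependent_iff.1 h1 _ hq0
  apply hq
  ext i
  by_cases hi : i < (minpoly F x).natDegree
  · exact h3 ⟨i, hi⟩
  · exact Polynomial.coeff_eq_zero_of_natDegree_lt (by omega)

end Splitting

namespace IsNormalizedValuation

variable {F : Type u} [Field F] [ValuativeRel F] [TopologicalSpace F]
  [IsNonarchimedeanLocalField F] {D : Type v} [DivisionRing D] [Algebra F D]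
  {v : D → ℤ} {e : ℕ} (hv : IsNormalizedValuation F D v e)

include hv

/-- The powers `1, ϖ, …, ϖ ^ (e - 1)` of a uniformizer are independent over `F`. -/
lemma linearIndependent_pow_uniformizer {ϖ : D} (hϖ0 : ϖ ≠ 0) (hϖ : v ϖ = 1) :
    LinearIndependent F fun i : Fin e => ϖ ^ (i : ℕ) := by
  classical
  rw [Fintype.linearIndependent_iff]
  intro g hg
  by_contra! hne
  obtain ⟨j, hj⟩ := hne
  have hval : ∀ i, g i ≠ 0 → g i • ϖ ^ (i : ℕ) ≠ 0 ∧
      v (g i • ϖ ^ (i : ℕ)) = e * ord F (g i) + i := by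
    intro i hi
    have h1 : algebraMap F D (g i) ≠ 0 := by simpa using hi
    have h2 := pow_ne_zero (i : ℕ) hϖ0
    rw [Algebra.smul_def, hv.map_mul _ _ h1 h2, hv.map_algebraMap _ hi, hv.map_pow hϖ0, hϖ, mul_one]
    exact ⟨mul_ne_zero h1 h2, rfl⟩
  have hnon : (Finset.univ.filter fun i => g i ≠ 0).Nonempty := ⟨j, by simpa using hj⟩
  obtain ⟨i₀, hi₀, hmin⟩ := Finset.exists_min_image _ (fun i => v (g i • ϖ ^ (i : ℕ))) hnon
  have hi₀' : g i₀ ≠ 0 := by simpa using hi₀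
  -- the valuations of the terms are distinct, so that the smallest one is not cancelled
  have hrest : ∀ i ∈ Finset.univ.erase i₀,
      g i • ϖ ^ (i : ℕ) ∈ hv.ideal (v (g i₀ • ϖ ^ (i₀ : ℕ)) + 1) := by
    intro i hi
    by_cases h : g i = 0
    · simp [h, zero_mem]
    rw [mem_ideal_of_ne hv (hval i h).1]
    have h1 := hmin i (by simpa using h)
    suffices v (g i • ϖ ^ (i : ℕ)) ≠ v (g i₀ • ϖ ^ (i₀ : ℕ)) by omega
    rw [(hval i h).2, (hval i₀ hi₀').2]
    intro heq
    apply Finset.ne_of_mem_erase hi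
    have h2 : ((i : ℕ) : ℤ) % e = ((i₀ : ℕ) : ℤ) % e := by
      have := congrArg (· % (e : ℤ)) heq
      simpa using this
    rw [Int.emod_eq_of_lt (by omega) (by omega), Int.emod_eq_of_lt (by omega) (by omega)] at h2
    exact Fin.ext (by omega)
  have h3 := sum_mem hrest
  rw [← Finset.add_sum_erase _ _ (Finset.mem_univ i₀)] at hg
  rw [← neg_eq_of_add_eq_zero_right hg, neg_mem_iff, mem_ideal_of_ne hv (hval i₀ hi₀').1] at h3
  omega

variable [FiniteDimensional F D]

/-- The inequality `[D : F] ≤ e f`: in an orthogonal basis of `D`, at most `f` vectors have a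
valuation in a given class modulo `e`. -/
lemma finrank_le {k : Type*} [Field k] [Finite k] [Algebra 𝓀[F] k]
    {res : hv.integers →+* k} (hres : hv.IsResidueField (algebraMap 𝓀[F] k) res) :
    Module.finrank F D ≤ Module.finrank 𝓀[F] k * e := by
  classical
  obtain ⟨n, b, hb⟩ := hv.exists_orthogonal_basis
  have he : (0 : ℤ) < e := by exact_mod_cast hv.ramification_pos
  have hb0 : ∀ i, b i ≠ 0 := fun i => b.ne_zero i
  have hmaps : ∀ i ∈ (Finset.univ : Finset (Fin n)),
      (v (b i) % e).toNat ∈ Finset.range e := fun i _ => by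
    have := Int.emod_lt_of_pos (v (b i)) he
    have := Int.emod_nonneg (v (b i)) he.ne'
    rw [Finset.mem_range]
    omega
  rw [Module.finrank_eq_card_basis b, Fintype.card_fin, ← Finset.card_fin n, ← Finset.card_range e]
  refine (Finset.card_le_mul_card_image_of_maps_to hmaps (Module.finrank 𝓀[F] k) ?_)
  intro j hj
  set S := Finset.univ.filter fun i => (v (b i) % e).toNat = j
  obtain ⟨ϖ, hϖ0, hϖ⟩ := hv.exists_eq (-j)
  -- scale each basis vector of the class `j` to a unit
  have hsc : ∀ i : S, ∃ t : F, t ≠ 0 ∧ v (t • b i * ϖ) = 0 ∧ t • b i * ϖ ≠ 0 := by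
    rintro ⟨i, hi⟩
    have hi' : (v (b i) % e).toNat = j := by simpa [S] using hi
    obtain ⟨t, ht0, ht⟩ := exists_ord_eq F (-(v (b i) / e))
    have h1 : algebraMap F D t ≠ 0 := by simpa using ht0
    have h2 := mul_ne_zero h1 (hb0 i)
    refine ⟨t, ht0, ?_, ?_⟩
    · rw [Algebra.smul_def, hv.map_mul _ _ h2 hϖ0, hv.map_mul _ _ h1 (hb0 i),
        hv.map_algebraMap t ht0, ht, hϖ]
      have := Int.emod_nonneg (v (b i)) he.ne'
      have := Int.emod_add_mul_ediv (v (b i)) e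
      have h3 : (j : ℤ) = v (b i) % e := by omega
      rw [h3]
      linarith
    · rw [Algebra.smul_def]
      exact mul_ne_zero h2 hϖ0
  choose t ht0 htv htne using hsc
  let x : S → hv.integers := fun i => ⟨t i • b i * ϖ, by
    rw [hv.mem_integers, mem_ideal_of_ne hv (htne i), htv i]⟩
  have hli : LinearIndependent 𝓀[F] fun i => res (x i) := by
    rw [Fintype.linearIndependent_iff]
    intro c hc i
    choose c' hc' using fun i => IsLocalRing.residue_surjective (R := 𝒪[F]) (c i)
    have h1 : res (∑ i, hv.integersMap (c' i) * x i) = 0 := by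
      rw [map_sum, ← hc]
      refine Finset.sum_congr rfl fun i _ => ?_
      rw [_root_.map_mul, hres.compat, hc', Algebra.smul_def]
    rw [hres.eq_zero_iff] at h1
    have h2 : ((∑ i, hv.integersMap (c' i) * x i : hv.integers) : D) =
        (∑ i : S, ((c' i : F) * t i) • b i) * ϖ := by
      push_cast
      rw [Finset.sum_mul]
      refine Finset.sum_congr rfl fun i _ => ?_
      change algebraMap F D (c' i) * (t i • b i * ϖ) = _
      rw [← Algebra.smul_def, mul_smul, smul_mul_assoc (c' i : F)]
    rw [h2] at h1
    have h3 : (∑ i : S, ((c' i : F) * t i) • b i) ∈ hv.ideal (1 + j) := by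
      have h4 : ϖ⁻¹ ∈ hv.ideal j := by
        rw [mem_ideal_of_ne hv (inv_ne_zero hϖ0), hv.map_inv hϖ0, hϖ, neg_neg]
      have := hv.mul_mem_ideal h1 h4
      rwa [mul_inv_cancel_right₀ hϖ0] at this
    have h4 := (hb _ _).1 h3 i
    have h5 : b.repr (∑ i : S, ((c' i : F) * t i) • b i) i = (c' i : F) * t i := by
      rw [map_sum, Finsupp.finsetSum_apply, Finset.sum_eq_single i]
      · simp
      · intro l _ hl
        have : (l : Fin n) ≠ i := fun h => hl (Subtype.ext h)
        simp [this]
      · simp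
    rw [h5] at h4
    rw [← hc', IsLocalRing.residue_eq_zero_iff, PrincipalOrder.mem_maximalIdeal_iff]
    by_cases h0 : (c' i : F) = 0
    · exact Or.inl h0
    right
    have h6 : algebraMap F D (c' i) ≠ 0 := by simpa using h0
    have h7 : t i • b i ≠ 0 := left_ne_zero_of_mul (htne i)
    rw [mul_smul, Algebra.smul_def, mem_ideal_of_ne hv (mul_ne_zero h6 h7),
      hv.map_mul _ _ h6 h7, hv.map_algebraMap _ h0] at h4
    have h8 := htv i
    rw [hv.map_mul _ _ h7 hϖ0, hϖ] at h8
    have h9 : 0 < (e : ℤ) * ord F (c' i : F) := by omega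
    exact pos_of_mul_pos_right h9 he.le
  have : Module.Finite 𝓀[F] k := .of_finite
  simpa using hli.fintype_card_le_finrank

/-- The trace of a splitting of `D` takes a unit value on some integer: a lift of a generator of the
residue field `k_D` with non-zero trace has degree `f = e = r`, and its minimal polynomial is both
its characteristic polynomial in `M_r(K)` and a lift of the minimal polynomial in `k_D`. -/
theorem exists_trace_eq_unit {K : Type*} [Field K] [Algebra F K] {r : ℕ}
    {ρ : D →ₐ[F] Matrix (Fin r) (Fin r) K} (hρ : IsSplitting ρ) :
    ∃ z ∈ hv.ideal 0, ∃ t : F, t ≠ 0 ∧ ord F t = 0 ∧ (ρ z).trace = algebraMap F K t := by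
  obtain ⟨k, _, _, _, res, hres⟩ := hv.exists_isResidueField
  have : Module.Finite 𝓀[F] k := .of_finite
  set f := Module.finrank 𝓀[F] k with hf
  have hef : r * r ≤ f * e := by
    rw [← hρ.finrank_eq]; exact hv.finrank_le hres
  obtain ⟨ϖ, hϖ0, hϖ⟩ := hv.exists_eq_one
  have her : e ≤ r := hρ.le_of_linearIndependent_pow (hv.linearIndependent_pow_uniformizer hϖ0 hϖ)
  have hr : 0 < r := hv.ramification_pos.trans_le her
  have hrf : r ≤ f := by
    have : r * r ≤ f * r := hef.trans (Nat.mul_le_mul_left f her)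
    exact Nat.le_of_mul_le_mul_right this hr
  obtain ⟨α, hα, hα'⟩ := exists_natDegree_minpoly_eq_finrank 𝓀[F] k
  rw [← hf] at hα
  obtain ⟨z, rfl⟩ := hres.surjective α
  have hzint : IsIntegral 𝒪[F] (z : D) := hv.mem_ringOfIntegers_iff.2 z.2
  set g := minpoly F (z : D) with hg
  have hgm : g.Monic := minpoly.monic (.of_finite F _)
  -- the minimal polynomial of `z` has coefficients in `𝔬_F`
  obtain ⟨g', hg'⟩ : ∃ g' : Polynomial 𝒪[F], g'.map (algebraMap 𝒪[F] F) = g := by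
    obtain ⟨p, hp, hpz⟩ := hzint
    have hdvd : g ∣ p.map (algebraMap 𝒪[F] F) := minpoly.dvd F _ (by
      rw [Polynomial.aeval_map_algebraMap]; exact hpz)
    obtain ⟨g', hg'⟩ := IsIntegrallyClosed.eq_map_mul_C_of_dvd F hp hdvd
    rw [hgm.leadingCoeff, Polynomial.C_1, mul_one] at hg'
    exact ⟨g', hg'⟩
  have hinj : Function.Injective (algebraMap 𝒪[F] F) := Subtype.val_injective
  have hg'm : g'.Monic := by
    refine Polynomial.monic_of_injective hinj ?_
    rw [hg']; exact hgm
  have hg'd : g'.natDegree = g.natDegree := by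
    rw [← hg', Polynomial.natDegree_map_eq_of_injective hinj]
  have hz0 : Polynomial.eval₂ hv.integersMap z g' = 0 := by
    apply Subtype.ext
    change hv.integers.subtype _ = 0
    rw [Polynomial.hom_eval₂]
    have : Polynomial.aeval (z : D) g = 0 := minpoly.aeval F _
    rw [← hg', Polynomial.aeval_map_algebraMap] at this
    exact this
  have hα0 : Polynomial.aeval (res z) (g'.map (IsLocalRing.residue 𝒪[F])) = 0 := by
    rw [Polynomial.aeval_def, Polynomial.eval₂_map]
    have h1 := congrArg res hz0
    rw [Polynomial.hom_eval₂, map_zero] at h1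
    rw [← h1]
    congr 1
    ext c
    exact (hres.compat c).symm
  have hdvd := minpoly.dvd _ _ hα0
  have hgr : g.natDegree ≤ r := hρ.le_of_linearIndependent_pow
    (linearIndependent_pow (K := F) (z : D))
  have hredm : (g'.map (IsLocalRing.residue 𝒪[F])).Monic := hg'm.map _
  have hredd : (g'.map (IsLocalRing.residue 𝒪[F])).natDegree = g.natDegree := by
    rw [hg'm.natDegree_map, hg'd]
  have hfg : f ≤ g.natDegree := by
    rw [← hα, ← hredd]
    exact Polynomial.natDegree_le_of_dvd hdvd hredm.ne_zero
  have hmin : minpoly 𝓀[F] (res z) = g'.map (IsLocalRing.residue 𝒪[F]) :=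
    (Polynomial.eq_of_monic_of_dvd_of_natDegree_le (minpoly.monic (.of_finite _ _)) hredm hdvd
      (by rw [hredd, hα]; exact hgr.trans hrf)).symm
  have hchar := hρ.charpoly_eq (hgr.antisymm (hrf.trans hfg))
  rw [hmin, nextCoeff_map_of_monic _ hg'm, Ne, IsLocalRing.residue_eq_zero_iff,
    PrincipalOrder.mem_maximalIdeal_iff, mem_fracIdeal, not_or] at hα'
  refine ⟨z, z.2, -(g'.nextCoeff : F), neg_ne_zero.2 hα'.1, ?_, ?_⟩
  · have := integer_ord_nonneg g'.nextCoeff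
    rw [ord_neg]
    omega
  · rw [Matrix.trace_eq_neg_charpoly_nextCoeff, hchar, ← hg, ← hg', Polynomial.map_map,
      nextCoeff_map_of_monic _ hg'm, _root_.map_neg]
    rfl

end IsNormalizedValuation

/-! ### Existence of the reduced trace -/

section CentralSimple

/-- The base change `A ⊗_F K` of a central simple algebra `A` to a field `K` is simple: an element
of smallest length of a non-zero two-sided ideal, normalized to have a coefficient `1`, commutes
with `A`, so that its coefficients lie in `F`. -/
theorem isSimpleRing_tensorProduct (F K A : Type*) [Field F] [Field K] [Algebra F K] [Ring A]
    [Algebra F A] [IsSimpleRing A] [Algebra.IsCentral F A] : IsSimpleRing (A ⊗[F] K) := by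
  classical
  let κ := Module.Free.chooseBasis F K
  let B := Algebra.TensorProduct.basis A κ
  have hleft : ∀ (a : A) (w : A ⊗[F] K) i, B.repr ((a ⊗ₜ 1) * w) i = a * B.repr w i := by
    intro a w i
    have : (a ⊗ₜ[F] (1 : K)) * w = a • w := by
      induction w with
      | zero => simp
      | tmul x y => simp [TensorProduct.smul_tmul']
      | add x y hx hy => rw [mul_add, hx, hy, smul_add]
    rw [this, map_smul]
    rfl
  have hright : ∀ (a : A) (w : A ⊗[F] K) i, B.repr (w * (a ⊗ₜ 1)) i = B.repr w i * a := by
    intro a w i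
    induction w with
    | zero => simp
    | tmul x y =>
      simp only [B, Algebra.TensorProduct.tmul_mul_tmul, Algebra.TensorProduct.basis_repr_tmul,
        mul_one, Finsupp.smul_apply, Finsupp.mapRange_apply, smul_eq_mul]
      rw [mul_assoc, mul_assoc, Algebra.commutes]
    | add x y hx hy => rw [add_mul, map_add, map_add, Finsupp.add_apply, Finsupp.add_apply, hx, hy,
        add_mul]
  have : Nontrivial A := inferInstance
  have : Nontrivial (A ⊗[F] K) := inferInstance
  rw [isSimpleRing_iff_isTwoSided_imp]
  refine ⟨this, fun I hI => ?_⟩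
  by_cases hbot : I = ⊥
  · exact Or.inl hbot
  right
  obtain ⟨w₀, hw₀, hw₀0⟩ := Submodule.exists_mem_ne_zero_of_ne_bot hbot
  have hex : ∃ n, ∃ w ∈ I, w ≠ 0 ∧ (B.repr w).support.card = n := ⟨_, w₀, hw₀, hw₀0, rfl⟩
  obtain ⟨w, hw, hw0, hcard⟩ := Nat.find_spec hex
  have hmin : ∀ w' ∈ I, w' ≠ 0 → (B.repr w).support.card ≤ (B.repr w').support.card :=
    fun w' h1 h2 => hcard ▸ Nat.find_min' hex ⟨w', h1, h2, rfl⟩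
  obtain ⟨i₀, hi₀⟩ : (B.repr w).support.Nonempty := by
    rw [Finsupp.support_nonempty_iff]
    simpa using hw0
  let J : Ideal A :=
    { carrier := {c | ∃ w' ∈ I, (∀ i, B.repr w i = 0 → B.repr w' i = 0) ∧ B.repr w' i₀ = c}
      zero_mem' := ⟨0, zero_mem _, by simp, by simp⟩
      add_mem' := by
        rintro _ _ ⟨x, hx, hx', rfl⟩ ⟨y, hy, hy', rfl⟩
        exact ⟨x + y, add_mem hx hy, fun i hi => by simp [hx' i hi, hy' i hi], by simp⟩
      smul_mem' := by
        rintro a _ ⟨x, hx, hx', rfl⟩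
        exact ⟨(a ⊗ₜ 1) * x, I.mul_mem_left _ hx, fun i hi => by rw [hleft, hx' i hi, mul_zero],
          by rw [hleft]; rfl⟩ }
  have hJ : J.IsTwoSided := ⟨by
    rintro _ a ⟨x, hx, hx', rfl⟩
    exact ⟨x * (a ⊗ₜ 1), I.mul_mem_right _ hx, fun i hi => by rw [hright, hx' i hi, zero_mul],
      by rw [hright]⟩⟩
  have hJtop : J = ⊤ := by
    refine ((isSimpleRing_iff_isTwoSided_imp.1 ‹IsSimpleRing A›).2 J hJ).resolve_left fun h => ?_
    have : B.repr w i₀ ∈ J := ⟨w, hw, fun _ => id, rfl⟩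
    rw [h, Submodule.mem_bot] at this
    exact (Finsupp.mem_support_iff.1 hi₀) this
  obtain ⟨w', hw', hsupp, hone⟩ : (1 : A) ∈ J := hJtop ▸ Submodule.mem_top
  have hcomm : ∀ b : A, (b ⊗ₜ 1) * w' - w' * (b ⊗ₜ 1) = 0 := by
    intro b
    by_contra hne
    have h1 := hmin _ (sub_mem (I.mul_mem_left _ hw') (I.mul_mem_right _ hw')) hne
    have h2 : (B.repr ((b ⊗ₜ 1) * w' - w' * (b ⊗ₜ 1))).support ⊂ (B.repr w).support := by
      rw [Finset.ssubset_iff_of_subset]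
      · refine ⟨i₀, hi₀, ?_⟩
        rw [Finsupp.notMem_support_iff, map_sub, Finsupp.sub_apply, hleft, hright, hone]
        simp
      · intro i hi
        rw [Finsupp.mem_support_iff] at hi ⊢
        intro h
        apply hi
        rw [map_sub, Finsupp.sub_apply, hleft, hright, hsupp i h]
        simp
    exact absurd (Finset.card_lt_card h2) (not_lt.2 h1)
  have hcentral : ∀ i, ∃ f : F, algebraMap F A f = B.repr w' i := by
    intro i
    have : B.repr w' i ∈ Subalgebra.center F A := by
      rw [Subalgebra.mem_center_iff]
      intro b
      have := congrArg (fun u => B.repr u i) (hcomm b)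
      simp only [map_sub, Finsupp.sub_apply, hleft, hright, map_zero, Finsupp.zero_apply] at this
      exact sub_eq_zero.1 this
    rw [Algebra.IsCentral.center_eq_bot] at this
    exact Algebra.mem_bot.1 this
  choose f hf using hcentral
  obtain ⟨k, hk⟩ : ∃ k : K, w' = 1 ⊗ₜ k := by
    refine ⟨∑ i ∈ (B.repr w').support, f i • κ i, ?_⟩
    conv_lhs => rw [← B.linearCombination_repr w']
    rw [Finsupp.linearCombination_apply, Finsupp.sum, TensorProduct.tmul_sum]
    refine Finset.sum_congr rfl fun i _ => ?_
    rw [← hf, algebraMap_smul, TensorProduct.tmul_smul]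
    simp [B]
  have hk0 : k ≠ 0 := by
    rintro rfl
    rw [hk, TensorProduct.tmul_zero] at hone
    simp at hone
  rw [Ideal.eq_top_iff_one]
  have := I.mul_mem_right ((1 : A) ⊗ₜ[F] k⁻¹) hw'
  rwa [hk, Algebra.TensorProduct.tmul_mul_tmul, one_mul, mul_inv_cancel₀ hk0,
    ← Algebra.TensorProduct.one_def] at this

/-- A linear form on `M_N(K)` that vanishes on commutators is a multiple of the trace. -/
lemma exists_eq_mul_trace {K : Type*} [Field K] {N : ℕ} (H : Matrix (Fin N) (Fin N) K →ₗ[K] K)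
    (hH : ∀ X Y, H (X * Y) = H (Y * X)) : ∃ κ : K, ∀ X, H X = κ * X.trace := by
  classical
  rcases Nat.eq_zero_or_pos N with rfl | hN
  · refine ⟨0, fun X => ?_⟩
    rw [Subsingleton.elim X 0]
    simp
  let o : Fin N := ⟨0, hN⟩
  obtain ⟨κ, hκ⟩ : ∃ κ, H (Matrix.single o o 1) = κ := ⟨_, rfl⟩
  refine ⟨κ, fun X => ?_⟩
  have h1 : ∀ i j c, H (Matrix.single i j c) = if i = j then c * κ else 0 := by
    intro i j c
    have e1 : (Matrix.single i j c : Matrix (Fin N) (Fin N) K) =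
        Matrix.single i o c * Matrix.single o j 1 := by simp
    rw [e1, hH]
    split_ifs with h
    · subst h
      rw [Matrix.single_mul_single_same, one_mul, ← mul_one c, ← smul_eq_mul, ← Matrix.smul_single,
        map_smul, hκ, smul_eq_mul, smul_eq_mul, mul_one]
    · rw [Matrix.single_mul_single_of_ne _ _ _ _ (Ne.symm h), map_zero]
  conv_lhs => rw [Matrix.matrix_eq_sum_single X]
  simp only [map_sum, h1, Finset.sum_ite_eq, Finset.mem_univ, if_true]
  rw [← Finset.sum_mul, mul_comm]
  rfl

/-- Existence of the reduced trace, given a splitting whose trace takes one non-zero value in `F`: a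
linear form on `A` that vanishes on commutators and takes the same value extends to a multiple of
the trace of `M_N(K)`, and the factor is `1`. -/
lemma exists_isReducedTrace {F : Type u} [Field F] {A : Type v} [Ring A] [Algebra F A]
    {K : Type u} [Field K] [Algebra F K] {N : ℕ} (φ : (K ⊗[F] A) ≃ₐ[K] Matrix (Fin N) (Fin N) K)
    {a : A} {c : F} (hc : c ≠ 0) (ha : (φ (1 ⊗ₜ a)).trace = algebraMap F K c) :
    ∃ t : A →ₗ[F] F, IsReducedTrace F A t := by
  let T : A →ₗ[F] K := (Matrix.traceLinearMap (Fin N) F K).comp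
    ((φ.toLinearMap.restrictScalars F).comp (Algebra.TensorProduct.includeRight (R := F) (A := K)
      (B := A)).toLinearMap)
  have hT : ∀ x, T x = (φ (1 ⊗ₜ x)).trace := fun x => rfl
  let S : Submodule F A := Submodule.span F {z | ∃ x y, z = x * y - y * x}
  have hS : S ≤ LinearMap.ker T := by
    rw [Submodule.span_le]
    rintro _ ⟨x, y, rfl⟩
    rw [SetLike.mem_coe, LinearMap.mem_ker, map_sub, sub_eq_zero, hT, hT]
    have : ∀ x y : A, (1 : K) ⊗ₜ[F] (x * y) = (1 ⊗ₜ x) * (1 ⊗ₜ y) := fun x y => by simp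
    rw [this, this, map_mul, map_mul, Matrix.trace_mul_comm]
  have haS : a ∉ S := by
    intro h
    have := hS h
    rw [LinearMap.mem_ker, hT, ha, map_eq_zero] at this
    exact hc this
  obtain ⟨f, hfa, hf⟩ := Submodule.exists_le_ker_of_notMem haS
  let t : A →ₗ[F] F := (c / f a) • f
  have hta : t a = c := by simp [t, hfa]
  have htc : ∀ x y, t (x * y) = t (y * x) := fun x y => by
    have : f (x * y - y * x) = 0 := hf (Submodule.subset_span ⟨x, y, rfl⟩)
    rw [map_sub, sub_eq_zero] at this
    simp [t, this]
  let G : K ⊗[F] A →ₗ[K] K := LinearMap.liftBaseChange K ((Algebra.linearMap F K).comp t)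
  have hG : ∀ k x, G (k ⊗ₜ x) = k * algebraMap F K (t x) := fun k x => by simp [G]
  have hGc : ∀ x y, G (x * y) = G (y * x) := by
    intro x y
    induction x with
    | zero => simp
    | add x₁ x₂ h1 h2 => rw [add_mul, mul_add, map_add, map_add, h1, h2]
    | tmul k x =>
      induction y with
      | zero => simp
      | add y₁ y₂ h1 h2 => rw [add_mul, mul_add, map_add, map_add, h1, h2]
      | tmul l y =>
        rw [Algebra.TensorProduct.tmul_mul_tmul, Algebra.TensorProduct.tmul_mul_tmul, hG, hG, htc,
          mul_comm k l]
  obtain ⟨κ, hκ⟩ := exists_eq_mul_trace (G.comp φ.symm.toLinearMap) (fun X Y => by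
    simp only [LinearMap.comp_apply, AlgEquiv.toLinearMap_apply, map_mul]
    exact hGc _ _)
  have hκ' : ∀ x, algebraMap F K (t x) = κ * (φ (1 ⊗ₜ x)).trace := fun x => by
    rw [← hκ]
    simp [hG]
  have hκ1 : κ = 1 := by
    have := hκ' a
    rw [hta, ha] at this
    have h0 : algebraMap F K c ≠ 0 := by simpa using hc
    exact (mul_eq_right₀ h0).1 this.symm
  refine ⟨t, K, inferInstance, inferInstance, N, φ, fun x => ?_⟩
  rw [hκ', hκ1, one_mul]

end CentralSimple

/-! ### Splittings of a corner -/

section Corner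

variable {F : Type u} [Field F] {D : Type v} [DivisionRing D] [Algebra F D]
  {K : Type*} [Field K] [Algebra F K] {A : Type*} [Ring A] [Algebra F A]

/-- An idempotent matrix factors through its range. -/
lemma exists_factorization_of_isIdempotentElem {N : ℕ} {E : Matrix (Fin N) (Fin N) K}
    (hE : E * E = E) : ∃ (r : ℕ) (P : Matrix (Fin N) (Fin r) K) (Q : Matrix (Fin r) (Fin N) K),
      P * Q = E ∧ Q * P = 1 := by
  let f := E.toLin'
  have hf : f ∘ₗ f = f := by rw [← Matrix.toLin'_mul, hE]
  let W := LinearMap.range f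
  let b := Module.finBasis K W
  let s := Pi.basisFun K (Fin N)
  refine ⟨_, LinearMap.toMatrix b s W.subtype, LinearMap.toMatrix s b f.rangeRestrict, ?_, ?_⟩
  · rw [← LinearMap.toMatrix_comp]
    have : W.subtype ∘ₗ f.rangeRestrict = f := by ext; rfl
    rw [this, LinearMap.toMatrix_eq_toMatrix', LinearMap.toMatrix'_toLin']
  · rw [← LinearMap.toMatrix_comp]
    have : f.rangeRestrict ∘ₗ W.subtype = LinearMap.id := by
      ext ⟨_, x, rfl⟩ : 2
      exact LinearMap.congr_fun hf x
    rw [this, LinearMap.toMatrix_id]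

lemma linearIndependent_one_tmul {n : ℕ} {x : Fin n → A} (hx : LinearIndependent F x)
    (c : Fin n → K) (hc : ∑ i, c i ⊗ₜ[F] x i = 0) : ∀ i, c i = 0 := by
  intro i
  have hinj : LinearMap.ker (Fintype.linearCombination F x) = ⊥ := by
    rw [LinearMap.ker_eq_bot]
    exact linearIndependent_iff_injective_fintypeLinearCombination.1 hx
  obtain ⟨g, hg⟩ := LinearMap.exists_leftInverse_of_injective _ hinj
  let G : K ⊗[F] A →ₗ[K] K :=
    LinearMap.liftBaseChange K ((Algebra.linearMap F K).comp ((LinearMap.proj i).comp g))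
  have hgx : ∀ j, g (x j) = Pi.single j 1 := fun j => by
    have := congrArg (fun h : _ →ₗ[F] _ => h (Pi.single j 1)) hg
    simpa [Fintype.linearCombination_apply_single] using this
  have h1 := congrArg G hc
  simp only [map_sum, map_zero, G, LinearMap.liftBaseChange_tmul, LinearMap.comp_apply, hgx,
    LinearMap.proj_apply, Algebra.linearMap_apply, smul_eq_mul] at h1
  rw [Finset.sum_eq_single i] at h1
  · simpa using h1
  · intro j _ hj
    simp [Pi.single_eq_of_ne (Ne.symm hj)]
  · simp

/-- A splitting `φ` of `A` restricts to a splitting of a corner `e A e` isomorphic to `D`, and the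
trace of the latter is the restriction of the trace of the former. -/
theorem exists_isSplitting {N : ℕ} (φ : (K ⊗[F] A) ≃ₐ[K] Matrix (Fin N) (Fin N) K)
    (ι : D →ₗ[F] A) (hinj : Function.Injective ι) (hmul : ∀ x y, ι (x * y) = ι x * ι y)
    (hcorner : ∀ a, ∃ x, ι 1 * a * ι 1 = ι x) :
    ∃ (r : ℕ) (ρ : D →ₐ[F] Matrix (Fin r) (Fin r) K), IsSplitting ρ ∧
      ∀ x, (ρ x).trace = (φ (1 ⊗ₜ ι x)).trace := by
  let θ : A →ₐ[F] Matrix (Fin N) (Fin N) K :=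
    (φ.toAlgHom.restrictScalars F).comp Algebra.TensorProduct.includeRight
  have hθ : ∀ a, θ a = φ (1 ⊗ₜ a) := fun a => rfl
  have hE : θ (ι 1) * θ (ι 1) = θ (ι 1) := by rw [← map_mul, ← hmul, mul_one]
  obtain ⟨r, P, Q, hPQ, hQP⟩ := exists_factorization_of_isIdempotentElem hE
  have hEl : ∀ x, P * Q * θ (ι x) = θ (ι x) := fun x => by
    rw [hPQ, ← map_mul, ← hmul, one_mul]
  have hEr : ∀ x, θ (ι x) * (P * Q) = θ (ι x) := fun x => by
    rw [hPQ, ← map_mul, ← hmul, mul_one]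
  let ρ₀ : D →ₗ[F] Matrix (Fin r) (Fin r) K :=
    { toFun := fun x => Q * θ (ι x) * P
      map_add' := fun x y => by simp [Matrix.mul_add, Matrix.add_mul]
      map_smul' := fun c x => by simp }
  let ρ : D →ₐ[F] Matrix (Fin r) (Fin r) K := AlgHom.ofLinearMap ρ₀
    (by
      change Q * θ (ι 1) * P = 1
      rw [← hPQ, Matrix.mul_assoc, Matrix.mul_assoc, hQP, Matrix.mul_one, hQP])
    (fun x y => by
      change Q * θ (ι (x * y)) * P = Q * θ (ι x) * P * (Q * θ (ι y) * P)
      rw [hmul, map_mul]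
      conv_lhs => rw [← hEr x]
      simp only [Matrix.mul_assoc])
  have hρ : ∀ x, ρ x = Q * θ (ι x) * P := fun x => rfl
  have hPρQ : ∀ x, P * ρ x * Q = θ (ι x) := fun x => by
    rw [hρ]
    calc P * (Q * θ (ι x) * P) * Q = P * Q * θ (ι x) * (P * Q) := by simp only [Matrix.mul_assoc]
      _ = θ (ι x) := by rw [hEl, hEr]
  refine ⟨r, ρ, ⟨?_, ?_⟩, fun x => ?_⟩
  · intro n x hx
    rw [Fintype.linearIndependent_iff]
    intro c hc
    have hιx : LinearIndependent F fun i => ι (x i) :=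
      hx.map' ι (LinearMap.ker_eq_bot.2 hinj)
    apply linearIndependent_one_tmul hιx c
    apply φ.injective
    have h1 : P * (∑ i, c i • ρ (x i)) * Q = 0 := by rw [hc]; simp
    rw [Matrix.mul_sum, Matrix.sum_mul] at h1
    simp only [Matrix.mul_smul, Matrix.smul_mul, hPρQ, hθ] at h1
    rw [map_zero, ← h1, map_sum]
    refine Finset.sum_congr rfl fun i _ => ?_
    rw [← map_smul, TensorProduct.smul_tmul', smul_eq_mul, mul_one]
  · have key : ∀ w : K ⊗[F] A, Q * φ w * P ∈ Submodule.span K (Set.range ρ) := by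
      intro w
      induction w with
      | zero => simp
      | add x y hx hy => rw [map_add, Matrix.mul_add, Matrix.add_mul]; exact add_mem hx hy
      | tmul k a =>
        obtain ⟨x, hx⟩ := hcorner a
        have h1 : k ⊗ₜ[F] a = k • ((1 : K) ⊗ₜ[F] a) := by
          rw [TensorProduct.smul_tmul', smul_eq_mul, mul_one]
        have h2 : Q * θ a * P = ρ x := by
          rw [hρ, ← hx, map_mul, map_mul, ← hPQ]
          calc Q * θ a * P = (Q * P) * Q * θ a * (P * (Q * P)) := by
                rw [hQP, Matrix.one_mul, Matrix.mul_one]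
            _ = _ := by simp only [Matrix.mul_assoc]
        rw [h1, map_smul, Matrix.mul_smul, Matrix.smul_mul, ← hθ, h2]
        exact Submodule.smul_mem _ _ (Submodule.subset_span ⟨x, rfl⟩)
    rw [eq_top_iff]
    rintro X -
    have h := key (φ.symm (P * X * Q))
    rw [AlgEquiv.apply_symm_apply] at h
    have h3 : Q * (P * X * Q) * P = X := by
      calc Q * (P * X * Q) * P = (Q * P) * X * (Q * P) := by simp only [Matrix.mul_assoc]
        _ = X := by rw [hQP, Matrix.one_mul, Matrix.mul_one]
    rwa [h3] at h
  · rw [hρ, Matrix.trace_mul_comm, ← Matrix.mul_assoc, hEl, hθ]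

end Corner

/-! ### The Casimir identity -/

section Casimir

variable {K : Type*} [Field K] {r n : ℕ}

/-- The Casimir element of the trace form of `M_r(K)`: if `A`, `B` are dual bases, then
`∑ i, A i * W * B i = tr W` and `∑ i, B i * W * A i = tr W`. -/
lemma sum_mul_mul_eq_trace (A : Module.Basis (Fin n) K (Matrix (Fin r) (Fin r) K))
    (B : Fin n → Matrix (Fin r) (Fin r) K)
    (hAB : ∀ i j, (A i * B j).trace = if i = j then 1 else 0) (W : Matrix (Fin r) (Fin r) K) :
    ∑ i, A i * W * B i = Matrix.scalar (Fin r) W.trace ∧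
      ∑ i, B i * W * A i = Matrix.scalar (Fin r) W.trace := by
  classical
  have hexp : ∀ X : Matrix (Fin r) (Fin r) K, ∑ i, (X * B i).trace • A i = X := by
    intro X
    conv_rhs => rw [← A.sum_repr X]
    refine Finset.sum_congr rfl fun j _ => ?_
    congr 1
    conv_lhs => rw [← A.sum_repr X]
    rw [Finset.sum_mul, Matrix.trace_sum]
    simp [hAB]
  -- expanding the matrix unit `e_pq` in the basis `A`
  have hunit : ∀ p q x y, ∑ i, B i q p * A i x y = if p = x ∧ q = y then 1 else 0 := by
    intro p q x y
    have h := congrFun (congrFun (hexp (Matrix.single p q 1)) x) y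
    rw [Matrix.sum_apply, Matrix.single_apply] at h
    rw [← h]
    refine Finset.sum_congr rfl fun i _ => ?_
    rw [Matrix.smul_apply, smul_eq_mul, Matrix.trace_single_mul, one_smul]
  have hsc : ∀ x y, (Matrix.scalar (Fin r) W.trace) x y = if x = y then W.trace else 0 := by
    intro x y
    rw [Matrix.scalar_apply, Matrix.diagonal_apply]
  constructor
  · ext x y
    rw [hsc, Matrix.sum_apply]
    calc ∑ i, (A i * W * B i) x y = ∑ q, ∑ p, W p q * ∑ i, B i q y * A i x p := by
          simp only [Matrix.mul_apply, Finset.sum_mul, Finset.mul_sum]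
          rw [Finset.sum_comm]
          refine Finset.sum_congr rfl fun q _ => ?_
          rw [Finset.sum_comm]
          refine Finset.sum_congr rfl fun p _ => Finset.sum_congr rfl fun i _ => by ring
      _ = _ := by
          simp only [hunit]
          split_ifs with h
          · subst h
            simp [Matrix.trace]
          · simp [Ne.symm h]
  · ext x y
    rw [hsc, Matrix.sum_apply]
    calc ∑ i, (B i * W * A i) x y = ∑ q, ∑ p, W p q * ∑ i, B i x p * A i q y := by
          simp only [Matrix.mul_apply, Finset.sum_mul, Finset.mul_sum]
          rw [Finset.sum_comm]
          refine Finset.sum_congr rfl fun q _ => ?_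
          rw [Finset.sum_comm]
          refine Finset.sum_congr rfl fun p _ => Finset.sum_congr rfl fun i _ => by ring
      _ = _ := by
          simp only [hunit]
          split_ifs with h
          · subst h
            simp [Matrix.trace]
          · simp [h]

end Casimir

section TraceForm

variable {F : Type u} [Field F] [ValuativeRel F] [TopologicalSpace F]
  [IsNonarchimedeanLocalField F] {D : Type v} [DivisionRing D] [Algebra F D]
  {v : D → ℤ} {e : ℕ}

/-- The properties of the reduced trace `τ` of the division algebra `D` on which the argument
rests: `τ` maps `𝔭_D ^ (e m + 1)` to `𝔭_F ^ (m + 1)`, it takes the value `1` on the ring of integers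
of `D`, and its Casimir element is given by dual bases of opposite valuations. -/
structure IsTraceForm (hv : IsNormalizedValuation F D v e) (τ : D →ₗ[F] F) : Prop where
  mem_succ : ∀ m x, x ∈ hv.ideal (e * m + 1) → τ x ∈ fracIdeal F (m + 1)
  exists_eq_one : ∃ u ∈ hv.ideal 0, τ u = 1
  casimir : ∃ (n : ℕ) (a b : Fin n → D), (∀ i, b i ≠ 0 ∧ a i * b i ∈ hv.ideal 0) ∧
    (∀ w, ∑ i, a i * w * b i = algebraMap F D (τ w)) ∧
    ∀ w, ∑ i, b i * w * a i = algebraMap F D (τ w)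

variable [FiniteDimensional F D]

/-- The trace of a splitting has these properties. The dual basis with respect to `τ` of an
orthogonal basis `a` of `D` is orthogonal too, with `v (b i) ≥ - v (a i)`, and the Casimir identity
is the one of `M_r(K)`. -/
theorem isTraceForm_of_isSplitting (hv : IsNormalizedValuation F D v e) {K : Type*} [Field K]
    [Algebra F K] {r : ℕ} {ρ : D →ₐ[F] Matrix (Fin r) (Fin r) K} (hρ : IsSplitting ρ)
    {τ : D →ₗ[F] F} (hτ : ∀ x, algebraMap F K (τ x) = (ρ x).trace) : IsTraceForm hv τ := by
  have hinjK : Function.Injective (algebraMap F K) := (algebraMap F K).injective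
  have hint : ∀ x ∈ hv.ideal 0, IsIntegral 𝒪[F] (ρ x) := fun x hx =>
    (hv.mem_ringOfIntegers_iff.2 hx).map (ρ.restrictScalars 𝒪[F])
  obtain ⟨π, hπ0, hπ⟩ := exists_ord_eq F 1
  have h1 : ∀ x ∈ hv.ideal 1, τ x ∈ fracIdeal F 1 := fun x hx => by
    refine trace_mem_of_isIntegral (m := e) (hint x (hv.ideal_anti (by norm_num) hx)) (hτ x) hπ0
      (Or.inr hπ.ge) ?_
    have hmem : π⁻¹ • x ^ e ∈ hv.ideal 0 := by
      by_cases hx0 : x = 0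
      · rw [hx0, zero_pow hv.ramification_pos.ne', smul_zero]; exact zero_mem _
      have h2 : x ^ e ∈ hv.ideal (e : ℤ) := by
        rw [IsNormalizedValuation.mem_ideal_of_ne hv hx0] at hx
        rw [IsNormalizedValuation.mem_ideal_of_ne hv (pow_ne_zero _ hx0), hv.map_pow hx0]
        nlinarith
      have h3 := (hv.smul_eq_iff (inv_ne_zero hπ0) (x ^ e) e).2 h2
      rwa [ord_inv, hπ, mul_neg, mul_one, add_neg_cancel] at h3
    have := hint _ hmem
    rwa [map_smul, map_pow] at this
  have hscale : ∀ (m : ℤ), ∀ x ∈ hv.ideal (e * m + 1), τ x ∈ fracIdeal F (m + 1) := by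
    intro m x hx
    obtain ⟨t, ht0, ht⟩ := exists_ord_eq F m
    have h2 : t⁻¹ • x ∈ hv.ideal 1 := by
      rw [← hv.smul_eq_iff ht0, smul_inv_smul₀ ht0, ht, add_comm]
      exact hx
    have h3 := h1 _ h2
    rw [map_smul, smul_eq_mul, ← mul_mem_fracIdeal_iff ht0, mul_inv_cancel_left₀ ht0, ht] at h3
    rwa [add_comm]
  obtain ⟨u, hu, hu1⟩ : ∃ u ∈ hv.ideal 0, τ u = 1 := by
    obtain ⟨z, hz, t, ht0, ht, htr⟩ := hv.exists_trace_eq_unit hρ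
    refine ⟨t⁻¹ • z, ?_, ?_⟩
    · have := (hv.smul_eq_iff (inv_ne_zero ht0) z 0).2 hz
      rwa [ord_inv, ht, neg_zero, mul_zero, add_zero] at this
    · have : τ z = t := hinjK (by rw [hτ, htr])
      rw [map_smul, this, smul_eq_mul, inv_mul_cancel₀ ht0]
  refine ⟨hscale, ⟨u, hu, hu1⟩, ?_⟩
  obtain ⟨n, a, ha⟩ := hv.exists_orthogonal_basis
  -- the form `(x, y) ↦ τ (x y)` is non-degenerate
  let Φ : D →ₗ[F] Module.Dual F D := (LinearMap.mul F D).flip.compr₂ τ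
  have hΦ : ∀ y x, Φ y x = τ (x * y) := fun y x => rfl
  have hΦinj : Function.Injective Φ := by
    rw [injective_iff_map_eq_zero]
    intro y hy
    by_contra hy0
    have := LinearMap.congr_fun hy (u * y⁻¹)
    rw [hΦ, inv_mul_cancel_right₀ hy0, hu1] at this
    exact one_ne_zero this
  have hΦsurj : Function.Surjective Φ :=
    (LinearMap.injective_iff_surjective_of_finrank_eq_finrank Subspace.dual_finrank_eq.symm).1 hΦinj
  choose b hb using fun i => hΦsurj (a.coord i)
  have hab : ∀ x i, τ (x * b i) = a.repr x i := fun x i => by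
    rw [← hΦ, hb]; rfl
  have hb0 : ∀ i, b i ≠ 0 := fun i h => by
    have := hab (a i) i
    rw [h, mul_zero, map_zero] at this
    simp at this
  have hr : 0 < r := by
    by_contra h
    have h1 := hρ.finrank_eq
    have h2 : 0 < Module.finrank F D := Module.finrank_pos
    have : r = 0 := by omega
    simp [this] at h1
    omega
  have : Nonempty (Fin r) := ⟨⟨0, hr⟩⟩
  have hρinj : Function.Injective ρ := ρ.toRingHom.injective
  have hmat := fun w => sum_mul_mul_eq_trace (hρ.basis a) (fun i => ρ (b i)) (fun i j => by
    rw [hρ.basis_apply, ← map_mul, ← hτ, hab]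
    classical
    simp [Finsupp.single_apply]) (ρ w)
  have hscalar : ∀ w, ρ (algebraMap F D (τ w)) = Matrix.scalar (Fin r) (ρ w).trace := fun w => by
    rw [← hτ, AlgHom.commutes]
    rfl
  refine ⟨n, a, b, fun i => ⟨hb0 i, ?_⟩, fun w => ?_, fun w => ?_⟩
  · -- test the orthogonality of `a` on an element `x` with `x * b i = u`
    have hx : u * (b i)⁻¹ ∈ hv.ideal (- v (b i)) := by
      have := hv.mul_mem_ideal hu (Or.inr (hv.map_inv (hb0 i)).ge)
      rwa [zero_add] at this
    have h2 := (ha _ _).1 hx i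
    rw [← hab, inv_mul_cancel_right₀ (hb0 i), hu1, one_smul] at h2
    have := hv.mul_mem_ideal h2 (Or.inr (le_refl (v (b i))))
    rwa [neg_add_cancel] at this
  · apply hρinj
    rw [hscalar, ← (hmat w).1, map_sum]
    simp only [map_mul, hρ.basis_apply]
  · apply hρinj
    rw [hscalar, ← (hmat w).2, map_sum]
    simp only [map_mul, hρ.basis_apply]

end TraceForm

/-! ### Lattice chains as filtrations -/

open MulOpposite

section Chain

variable {F : Type u} [Field F] [ValuativeRel F] [TopologicalSpace F]
  [IsNonarchimedeanLocalField F] {D : Type v} [DivisionRing D] [Algebra F D]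
  {V : Type w} [AddCommGroup V] [Module Dᵐᵒᵖ V] [Module F V]
  {v : D → ℤ} {e : ℕ}

/-- A periodic lattice chain in `V`, seen as a filtration on which `D` acts through its normalized
valuation `v`; here `d` is the period of the chain. -/
structure IsPeriodicFiltration (v : D → ℤ) (d : ℕ) (L : ℤ → AddSubgroup V) : Prop
    extends IsFiltration L where
  smul_mem_iff : ∀ a : D, a ≠ 0 → ∀ x i, op a • x ∈ L (i + d * v a) ↔ x ∈ L i
  exists_notMem : ∀ i, ∃ x ∈ L i, x ∉ L (i + 1)
  period_pos : 0 < d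

/-- The filtration `L` splits along the basis `b`. -/
def IsAdapted (L : ℤ → AddSubgroup V) {k : ℕ} (b : Module.Basis (Fin k) Dᵐᵒᵖ V) : Prop :=
  ∀ i x, x ∈ L i ↔ ∀ j, b.repr x j • b j ∈ L i

/-- Units of `𝔬_D` preserve every lattice of the chain, and a uniformizer shifts the chain by its
period. -/
lemma smul_mem_iff_of_isUniformChain (hv : IsNormalizedValuation F D v e)
    {L : ℤ → AddSubgroup V} (hL : IsUniformChain F D L) {d : ℕ}
    (hd : ∀ i, L (i + d) = mulMaximalIdeal F D (L i)) (a : D) (ha : a ≠ 0) (x : V) (i : ℤ) :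
    op a • x ∈ L (i + d * v a) ↔ x ∈ L i := by
  have hmul : ∀ (a b : D) (x : V), op (a * b) • x = op b • op a • x := fun a b x => by
    rw [op_mul, mul_smul]
  have hinv : ∀ (a : D) (x : V), a ≠ 0 → op a⁻¹ • op a • x = x := fun a x ha => by
    rw [← hmul, mul_inv_cancel₀ ha, op_one, one_smul]
  have hint : ∀ a ∈ hv.ideal 0, ∀ i, ∀ x ∈ L i, op a • x ∈ L i := fun a ha i x hx =>
    (hL.isLattice i).smul_mem a (hv.mem_ringOfIntegers_iff.2 ha) x hx
  have hunit : ∀ a : D, a ≠ 0 → v a = 0 → ∀ x i, op a • x ∈ L i ↔ x ∈ L i := by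
    intro a ha h0 x i
    refine ⟨fun h => ?_, hint a (Or.inr h0.ge) i x⟩
    rw [← hinv a x ha]
    exact hint _ (Or.inr (by rw [hv.map_inv ha, h0, neg_zero])) _ _ h
  obtain ⟨ϖ, hϖ0, hϖ⟩ := hv.exists_eq_one
  have hϖL : ∀ x i, op ϖ • x ∈ L (i + d) ↔ x ∈ L i := by
    intro x i
    rw [hd]
    constructor
    · intro h
      have key : ∀ y ∈ mulMaximalIdeal F D (L i), op ϖ⁻¹ • y ∈ L i := by
        intro y hy
        induction hy using AddSubgroup.closure_induction with
        | mem y hy =>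
          obtain ⟨x, hx, a, ha, rfl⟩ := hy
          rw [← hmul]
          refine hint _ ?_ _ _ hx
          have := hv.mul_mem_ideal (hv.mem_maximalIdeal_iff.1 ha)
            (show ϖ⁻¹ ∈ hv.ideal (-1) from Or.inr (by rw [hv.map_inv hϖ0, hϖ]))
          rwa [add_neg_cancel] at this
        | zero => rw [smul_zero]; exact zero_mem _
        | add y z _ _ hy hz => rw [smul_add]; exact add_mem hy hz
        | neg y _ hy => rw [smul_neg]; exact neg_mem hy
      have := key _ h
      rwa [hinv ϖ x hϖ0] at this
    · intro h
      exact AddSubgroup.subset_closure ⟨x, h, ϖ, hv.mem_maximalIdeal_iff.2 (Or.inr hϖ.ge), rfl⟩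
  have hpow : ∀ (n : ℕ) x i, op (ϖ ^ n) • x ∈ L (i + d * n) ↔ x ∈ L i := by
    intro n
    induction n with
    | zero => intro x i; simp
    | succ n ih =>
      intro x i
      rw [pow_succ, hmul, ← ih x i, ← hϖL _ (i + d * n)]
      push_cast
      rw [mul_add, mul_one, add_assoc]
  have hnonneg : ∀ (n : ℕ) (a : D), a ≠ 0 → v a = n → ∀ x i,
      op a • x ∈ L (i + d * n) ↔ x ∈ L i := by
    intro n a ha hn x i
    have hp := pow_ne_zero n hϖ0
    have h1 : a = (a * (ϖ ^ n)⁻¹) * ϖ ^ n := by rw [inv_mul_cancel_right₀ hp]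
    rw [h1, hmul, hpow, hunit _ (mul_ne_zero ha (inv_ne_zero hp))]
    rw [hv.map_mul _ _ ha (inv_ne_zero hp), hv.map_inv hp, hv.map_pow hϖ0, hn, hϖ]
    ring
  rcases Int.eq_nat_or_neg (v a) with ⟨n, hn | hn⟩
  · rw [hn]; exact hnonneg n a ha hn x i
  · have h1 := hnonneg n a⁻¹ (inv_ne_zero ha) (by rw [hv.map_inv ha, hn, neg_neg]) (op a • x)
      (i - d * n)
    rw [hinv a x ha, sub_add_cancel] at h1
    rw [h1, hn, mul_neg, sub_eq_add_neg]

lemma exists_smul_mem_of_isLattice {L : AddSubgroup V} (hL : IsLattice F D L) (x : V) :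
    ∃ t : F, t ≠ 0 ∧ t • x ∈ L := by
  let : TopologicalSpace V := moduleTopology F V
  have : IsModuleTopology F V := ⟨rfl⟩
  have hc : Continuous fun t : F => t • x := by fun_prop
  have hU : (fun t : F => t • x) ⁻¹' (L : Set V) ∈ nhds (0 : F) :=
    (hL.isOpen.preimage hc).mem_nhds (by simp [zero_mem])
  obtain ⟨n, hn⟩ := exists_fracIdeal_subset hU
  obtain ⟨t, ht0, ht⟩ := exists_ord_eq F n
  exact ⟨t, ht0, hn (Or.inr ht.ge)⟩

lemma bounded_of_isLattice {L : AddSubgroup V} (hL : IsLattice F D L) (f : V →ₗ[F] F) :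
    ∃ n, ∀ x ∈ L, f x ∈ fracIdeal F n := by
  let : TopologicalSpace V := moduleTopology F V
  have : IsModuleTopology F V := ⟨rfl⟩
  have hc : Continuous f := IsModuleTopology.continuous_of_linearMap f
  obtain ⟨n, hn⟩ := exists_subset_fracIdeal (hL.isCompact.image hc)
  exact ⟨n, fun x hx => hn ⟨x, hx, rfl⟩⟩

variable [IsScalarTower F Dᵐᵒᵖ V]

lemma smul_mem_iff_of_op_smul_mem_iff (hv : IsNormalizedValuation F D v e) {d : ℕ}
    {L : ℤ → AddSubgroup V}
    (hL : ∀ a : D, a ≠ 0 → ∀ x i, op a • x ∈ L (i + d * v a) ↔ x ∈ L i) {c : F} (hc : c ≠ 0)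
    (x : V) (i : ℤ) : c • x ∈ L (i + (d * e : ℕ) * ord F c) ↔ x ∈ L i := by
  rw [← hL (algebraMap F D c) (by simpa using hc) x i, hv.map_algebraMap c hc,
    ← MulOpposite.algebraMap_apply, algebraMap_smul]
  push_cast
  rw [mul_assoc]

/-- A uniform chain is a periodic filtration, and `V` has a `D`-basis adapted to it. -/
theorem exists_isPeriodicFiltration [FiniteDimensional F V]
    (hv : IsNormalizedValuation F D v e) {L : ℤ → AddSubgroup V} (hL : IsUniformChain F D L) :
    ∃ d, IsPeriodicFiltration v d L ∧ ∃ (k : ℕ) (b : Module.Basis (Fin k) Dᵐᵒᵖ V),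
      IsAdapted L b := by
  obtain ⟨d, hd0, hd⟩ := hL.periodic
  have hsD := smul_mem_iff_of_isUniformChain hv hL hd
  have hsF := fun c (hc : c ≠ 0) => smul_mem_iff_of_op_smul_mem_iff hv hsD hc
  have hb := bounded_of_isLattice (hL.isLattice 0)
  have hfil : IsFiltration L :=
    { anti := hL.strictAnti.antitone
      exhaustive := fun x => by
        obtain ⟨t, ht0, ht⟩ := exists_smul_mem_of_isLattice (hL.isLattice 0) x
        refine ⟨- ((d * e : ℕ) * ord F t), ?_⟩
        rw [← hsF t ht0, neg_add_cancel]
        exact ht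
      separated := exists_notMem_of_bounded hsF hb }
  refine ⟨d, ⟨hfil, hsD, fun i => ?_, hd0⟩, ?_⟩
  · exact SetLike.exists_of_lt (hL.strictAnti (lt_add_one i))
  · have : FiniteDimensional Dᵐᵒᵖ V := Module.Finite.of_restrictScalars_finite F Dᵐᵒᵖ V
    refine exists_orthogonal_basis hfil (fun a => d * v (unop a)) (fun a ha x i => ?_)
      fun W x hx => ?_
    · exact hsD (unop a) (by simpa using ha) x i
    · exact exists_add_notMem_of_bounded hsF hb (W.restrictScalars F) x hx

end Chain

/-! ### Matrix units in `End_D(V)` -/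

section Units

variable {D : Type v} [DivisionRing D] {V : Type w} [AddCommGroup V] [Module Dᵐᵒᵖ V] {k : ℕ}
  (b : Module.Basis (Fin k) Dᵐᵒᵖ V)

/-- The endomorphism of rank one with `b j ↦ x`, which kills the other basis vectors. -/
noncomputable def rankOne (j : Fin k) (x : V) : Module.End Dᵐᵒᵖ V :=
  (LinearMap.toSpanSingleton Dᵐᵒᵖ V x).comp (b.coord j)

lemma rankOne_apply (j : Fin k) (x y : V) : rankOne b j x y = b.repr y j • x := rfl

lemma rankOne_basis (j l : Fin k) (x : V) : rankOne b j x (b l) = if l = j then x else 0 := by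
  rw [rankOne_apply, b.repr_self, Finsupp.single_apply]
  split_ifs <;> simp

/-- The matrix with entry `x` in position `(i, j)` and `0` elsewhere. -/
noncomputable def unit (i j : Fin k) (x : D) : Module.End Dᵐᵒᵖ V := rankOne b j (op x • b i)

/-- The entry of `y` in position `(i, j)`. -/
noncomputable def entry (y : Module.End Dᵐᵒᵖ V) (i j : Fin k) : D := unop (b.repr (y (b j)) i)

lemma unit_basis (i j l : Fin k) (x : D) :
    unit b i j x (b l) = if l = j then op x • b i else 0 := rankOne_basis b j l _

lemma unit_add (i j : Fin k) (x y : D) : unit b i j (x + y) = unit b i j x + unit b i j y := by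
  refine b.ext fun l => ?_
  simp only [LinearMap.add_apply, unit_basis]
  split_ifs <;> simp [add_smul]

lemma unit_zero (i j : Fin k) : unit b i j 0 = 0 := by
  have := unit_add b i j 0 0
  rwa [add_zero, left_eq_add] at this

lemma unit_mul_unit (i j l : Fin k) (x y : D) :
    unit b i j x * unit b j l y = unit b i l (x * y) := by
  refine b.ext fun m => ?_
  simp only [Module.End.mul_apply, unit_basis]
  split_ifs
  · rw [map_smul, unit_basis, if_pos rfl, op_mul, mul_smul]
  · simp

lemma unit_mul_unit_of_ne (i l : Fin k) {j j' : Fin k} (h : j ≠ j') (x y : D) :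
    unit b i j x * unit b j' l y = 0 := by
  refine b.ext fun m => ?_
  simp only [Module.End.mul_apply, unit_basis]
  split_ifs
  · rw [map_smul, unit_basis, if_neg h.symm, smul_zero, LinearMap.zero_apply]
  · simp

lemma unit_mul_mul_unit (i p q l : Fin k) (x z : D) (y : Module.End Dᵐᵒᵖ V) :
    unit b i p x * y * unit b q l z = unit b i l (x * entry b y p q * z) := by
  refine b.ext fun m => ?_
  simp only [Module.End.mul_apply, unit_basis]
  split_ifs
  · simp only [unit, rankOne_apply, map_smul, entry, op_mul, mul_smul, op_unop]
  · simp

lemma apply_basis (y : Module.End Dᵐᵒᵖ V) (j : Fin k) :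
    ∑ i, op (entry b y i j) • b i = y (b j) := b.sum_repr _

lemma sum_unit_entry (y : Module.End Dᵐᵒᵖ V) : ∑ j, ∑ i, unit b i j (entry b y i j) = y := by
  refine b.ext fun m => ?_
  simp only [LinearMap.sum_apply, unit_basis]
  rw [← apply_basis b y m, Finset.sum_eq_single m]
  · simp
  · intro j _ hj
    simp [hj.symm]
  · simp

lemma sum_unit_one : ∑ j, unit b j j (1 : D) = 1 := by
  refine b.ext fun m => ?_
  simp [unit_basis]

lemma unit_injective (i j : Fin k) : Function.Injective (unit b i j) := by
  intro x y h
  have := congrArg (fun f => f (b j)) h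
  simp only [unit_basis, if_true] at this
  exact op_injective (smul_left_injective _ (b.ne_zero i) this)

lemma unit_ne_zero (i j : Fin k) {x : D} (hx : x ≠ 0) : unit b i j x ≠ 0 := by
  rw [← unit_zero b i j]
  exact (unit_injective b i j).ne hx

lemma isSimpleRing_end [NeZero k] (b : Module.Basis (Fin k) Dᵐᵒᵖ V) :
    IsSimpleRing (Module.End Dᵐᵒᵖ V) := by
  have : Nontrivial (Module.End Dᵐᵒᵖ V) :=
    ⟨unit b 0 0 1, 0, unit_ne_zero b 0 0 one_ne_zero⟩
  refine ⟨⟨fun I => or_iff_not_imp_left.2 fun hI => ?_⟩⟩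
  obtain ⟨y, hy, hy0⟩ : ∃ y ∈ I, y ≠ 0 := by
    by_contra! h
    exact hI (eq_bot_iff.2 fun y hy => by simpa using h y hy)
  obtain ⟨p, q, hpq⟩ : ∃ p q, entry b y p q ≠ 0 := by
    by_contra! h
    refine hy0 ?_
    rw [← sum_unit_entry b y]
    simp [h, unit_zero]
  rw [eq_top_iff]
  intro z _
  have h1 : (1 : Module.End Dᵐᵒᵖ V) ∈ I := by
    rw [← sum_unit_one b]
    refine sum_mem fun j _ => ?_
    have h2 := I.mul_mem_right _ (unit b q j 1) (I.mul_mem_left (unit b j p (entry b y p q)⁻¹) _ hy)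
    rwa [unit_mul_mul_unit, inv_mul_cancel₀ hpq, mul_one] at h2
  simpa using I.mul_mem_left z _ h1

variable {F : Type u} [Field F] [Algebra F D] [Module F V] [IsScalarTower F Dᵐᵒᵖ V]

lemma unit_smul (i j : Fin k) (c : F) (x : D) : unit b i j (c • x) = c • unit b i j x := by
  refine b.ext fun l => ?_
  simp only [LinearMap.smul_apply, unit_basis]
  split_ifs
  · rw [op_smul, smul_assoc]
  · simp

/-- The embedding of `D` in the corner of `End_D(V)` given by the first basis vector. -/
noncomputable def corner [NeZero k] : D →ₗ[F] Module.End Dᵐᵒᵖ V where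
  toFun := unit b 0 0
  map_add' := unit_add b 0 0
  map_smul' := unit_smul b 0 0

end Units

/-! ### The filtration of `End_D(V)` by the powers of the radical -/

section Stab

variable {D : Type v} [DivisionRing D] {V : Type w} [AddCommGroup V] [Module Dᵐᵒᵖ V]

/-- The endomorphisms that raise the level by at least `r` in the filtration `L`. -/
def stab (L : ℤ → AddSubgroup V) (r : ℤ) : AddSubgroup (Module.End Dᵐᵒᵖ V) where
  carrier := {a | ∀ i, ∀ x ∈ L i, a x ∈ L (i + r)}
  zero_mem' := fun i x _ => by simp [zero_mem]
  neg_mem' := fun {a} ha i x hx => by simpa using ha i x hx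
  add_mem' := fun {a b} ha hb i x hx => add_mem (ha i x hx) (hb i x hx)

variable {L : ℤ → AddSubgroup V}

lemma mem_stab {r : ℤ} {a : Module.End Dᵐᵒᵖ V} :
    a ∈ stab L r ↔ ∀ i, ∀ x ∈ L i, a x ∈ L (i + r) := Iff.rfl

lemma stab_anti (hL : Antitone L) : Antitone (stab (D := D) L) := fun r s h _ ha i x hx =>
  hL (by omega) (ha i x hx)

lemma mul_mem_stab {r s : ℤ} {a c : Module.End Dᵐᵒᵖ V} (ha : a ∈ stab L r) (hc : c ∈ stab L s) :
    a * c ∈ stab L (r + s) := fun i x hx => by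
  have := ha _ _ (hc i x hx)
  rwa [add_assoc, add_comm s] at this

lemma one_mem_stab : (1 : Module.End Dᵐᵒᵖ V) ∈ stab L 0 := fun i x hx => by
  rw [add_zero]
  exact hx

/-- `1 + y` is injective and preserves levels if `y` raises them. -/
lemma IsFiltration.one_add_mem_iff (hL : IsFiltration L) {y : Module.End Dᵐᵒᵖ V}
    (hy : y ∈ stab L 1) (x : V) (i : ℤ) : (1 + y) x ∈ L i ↔ x ∈ L i := by
  by_cases hx : x = 0
  · simp [hx, zero_mem]
  rw [LinearMap.add_apply, Module.End.one_apply]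
  have hmem : ∀ j, j ≤ level L x → y x ∈ L (j + 1) := fun j hj => hy j x ((hL.mem_iff hx j).2 hj)
  constructor
  · intro h
    by_contra hi
    rw [hL.mem_iff hx] at hi
    -- at level `level x + 1` the vectors `(1 + y) x` and `y x` are both small
    have h1 := hL.anti (show level L x + 1 ≤ i by omega) h
    have h2 := sub_mem h1 (hmem _ le_rfl)
    rw [add_sub_cancel_right, hL.mem_iff hx] at h2
    omega
  · intro h
    exact add_mem h (hL.anti (by omega) (hmem i ((hL.mem_iff hx i).1 h)))

variable {v : D → ℤ} {d : ℕ} (hL : IsPeriodicFiltration v d L)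

include hL

lemma IsPeriodicFiltration.op_smul_mem_iff {x : V} (hx : x ≠ 0) (a : D) (i : ℤ) :
    op a • x ∈ L i ↔ a = 0 ∨ i ≤ d * v a + level L x := by
  by_cases ha : a = 0
  · simp [ha, zero_mem]
  rw [← sub_add_cancel i (d * v a), hL.smul_mem_iff a ha, hL.mem_iff hx]
  simp only [ha, false_or]
  omega

/-- `1 + 𝔓` consists of units of the order. -/
lemma exists_inverse_one_add [FiniteDimensional Dᵐᵒᵖ V] {y : Module.End Dᵐᵒᵖ V}
    (hy : y ∈ stab L 1) : ∃ g : (Module.End Dᵐᵒᵖ V)ˣ, (g : Module.End Dᵐᵒᵖ V) = 1 + y ∧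
      ((g⁻¹ : (Module.End Dᵐᵒᵖ V)ˣ) : Module.End Dᵐᵒᵖ V) ∈ stab L 0 := by
  have hu : IsUnit (1 + y) := by
    rw [LinearMap.isUnit_iff_ker_eq_bot, LinearMap.ker_eq_bot']
    intro x hx
    refine hL.eq_zero_of_forall fun i => ?_
    rw [← hL.one_add_mem_iff hy, hx]
    exact zero_mem _
  obtain ⟨g, hg⟩ := hu
  refine ⟨g, hg, fun i x hx => ?_⟩
  rw [add_zero, ← hL.one_add_mem_iff hy, ← hg, ← Module.End.mul_apply, Units.mul_inv]
  exact hx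

variable {k : ℕ} {b : Module.Basis (Fin k) Dᵐᵒᵖ V} (hb : IsAdapted L b)

include hb

lemma rankOne_mem_stab_iff (j : Fin k) (x : V) (r : ℤ) :
    rankOne b j x ∈ stab L r ↔ x ∈ L (level L (b j) + r) := by
  constructor
  · intro h
    have := h _ _ (hL.mem_level (b.ne_zero j))
    rwa [rankOne_basis, if_pos rfl] at this
  · intro h i y hy
    rw [rankOne_apply]
    have h1 := (hb i y).1 hy j
    rw [← op_unop (b.repr y j), hL.op_smul_mem_iff (b.ne_zero j)] at h1
    by_cases h0 : unop (b.repr y j) = 0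
    · rw [unop_eq_zero_iff] at h0
      simp [h0, zero_mem]
    have h2 := (hL.smul_mem_iff _ h0 _ _).2 h
    refine hL.anti ?_ h2
    have := h1.resolve_left h0
    omega

lemma unit_mem_stab_iff (i j : Fin k) (x : D) (r : ℤ) :
    unit b i j x ∈ stab L r ↔ x = 0 ∨ level L (b j) + r ≤ d * v x + level L (b i) := by
  rw [unit, rankOne_mem_stab_iff hL hb, hL.op_smul_mem_iff (b.ne_zero i)]

lemma unit_diag_mem_stab_iff (j : Fin k) (x : D) (r : ℤ) :
    unit b j j x ∈ stab L r ↔ x = 0 ∨ r ≤ d * v x := by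
  rw [unit_mem_stab_iff hL hb, add_comm, add_le_add_iff_right]

lemma unit_entry_mem_stab {y : Module.End Dᵐᵒᵖ V} {r : ℤ} (hy : y ∈ stab L r) (i j : Fin k) :
    unit b i j (entry b y i j) ∈ stab L r := by
  rw [unit, rankOne_mem_stab_iff hL hb, entry, op_unop]
  exact (hb _ _).1 (hy _ _ (hL.mem_level (b.ne_zero j))) i

/-- An endomorphism of rank one that raises no level by less than `r` can map a vector of level `i`
to any given vector of level at least `i + r`. -/
lemma exists_mem_stab_apply_eq {w x : V} {i r : ℤ} (hw : w ∈ L i) (hw' : w ∉ L (i + 1))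
    (hx : x ∈ L (i + r)) : ∃ a ∈ stab (D := D) L r, a w = x := by
  rw [hb] at hw'
  push Not at hw'
  obtain ⟨j, hj⟩ := hw'
  have h1 := (hb i w).1 hw j
  rw [← op_unop (b.repr w j), hL.op_smul_mem_iff (b.ne_zero j)] at hj h1
  push Not at hj
  have h2 := h1.resolve_left hj.1
  have hne : b.repr w j ≠ 0 := fun h => hj.1 (by rw [h, unop_zero])
  refine ⟨rankOne b j ((b.repr w j)⁻¹ • x), ?_, ?_⟩
  · rw [rankOne_mem_stab_iff hL hb, ← hL.smul_mem_iff _ hj.1, op_unop, smul_inv_smul₀ hne]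
    exact hL.anti (by omega) hx
  · rw [rankOne_apply, smul_inv_smul₀ hne]

end Stab

section Scalar

variable {F : Type u} [Field F] [ValuativeRel F] [TopologicalSpace F]
  [IsNonarchimedeanLocalField F] {D : Type v} [DivisionRing D] [Algebra F D]
  {V : Type w} [AddCommGroup V] [Module Dᵐᵒᵖ V] [Module F V] [IsScalarTower F Dᵐᵒᵖ V]
  {L : ℤ → AddSubgroup V} {v : D → ℤ} {d e : ℕ}

lemma smul_mem_stab_iff (hL : IsPeriodicFiltration v d L)
    (hv : IsNormalizedValuation F D v e) {c : F} (hc : c ≠ 0)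
    (y : Module.End Dᵐᵒᵖ V) (r : ℤ) :
    c • y ∈ stab L (r + (d * e : ℕ) * ord F c) ↔ y ∈ stab L r := by
  refine forall_congr' fun i => forall_congr' fun x => imp_congr_right fun _ => ?_
  rw [LinearMap.smul_apply, ← add_assoc]
  exact smul_mem_iff_of_op_smul_mem_iff hv hL.smul_mem_iff hc _ _

end Scalar

section Radical

variable {F : Type u} [Field F] [ValuativeRel F] {D : Type v} [DivisionRing D] [Algebra F D]
  {V : Type w} [AddCommGroup V] [Module Dᵐᵒᵖ V] [Module F V] [IsScalarTower F Dᵐᵒᵖ V]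
  {L : ℤ → AddSubgroup V} {v : D → ℤ} {d e : ℕ}
  {𝔄 : Subalgebra 𝒪[F] (Module.End Dᵐᵒᵖ V)}
  (h𝔄 : ∀ a : Module.End Dᵐᵒᵖ V, a ∈ 𝔄 ↔ a ∈ stab L 0)

/-- `stab L r`, for `r ≥ 0`, as an ideal of the stabilizer `𝔄` of `L`. -/
def stabIdeal (h𝔄 : ∀ a : Module.End Dᵐᵒᵖ V, a ∈ 𝔄 ↔ a ∈ stab L 0) (r : ℕ) :
    Ideal 𝔄 where
  carrier := {y | (y : Module.End Dᵐᵒᵖ V) ∈ stab L r}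
  zero_mem' := zero_mem (stab L r)
  add_mem' := fun {x y} hx hy => (stab L r).add_mem hx hy
  smul_mem' := fun c x hx => by
    have := mul_mem_stab ((h𝔄 c).1 c.2) hx
    rwa [zero_add] at this

lemma mem_stabIdeal {r : ℕ} {y : 𝔄} :
    y ∈ stabIdeal h𝔄 r ↔ (y : Module.End Dᵐᵒᵖ V) ∈ stab L r := Iff.rfl

variable (hL : IsPeriodicFiltration v d L) {k : ℕ} {b : Module.Basis (Fin k) Dᵐᵒᵖ V}
  (hb : IsAdapted L b)

include hL

include hb

/-- The radical of `𝔄` consists of the endomorphisms that raise all levels. -/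
lemma radical_eq : radical 𝔄 = stabIdeal h𝔄 1 := by
  have : FiniteDimensional Dᵐᵒᵖ V := .of_basis b
  ext y
  rw [radical, ← Ideal.jacobson_bot, Ideal.mem_jacobson_iff, mem_stabIdeal]
  simp only [Ideal.mem_bot]
  constructor
  · intro h i x hx
    by_contra hyx
    have hyx0 : (y : Module.End Dᵐᵒᵖ V) x ∈ L i := by
      have := (h𝔄 y).1 y.2 i x hx
      rwa [add_zero] at this
    -- if `y` does not raise the level of `x`, some `a` in the order maps `y x` back to `- x`
    obtain ⟨a, ha, hax⟩ := exists_mem_stab_apply_eq (r := 0) hL hb hyx0 (by exact_mod_cast hyx)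
      (show -x ∈ L (i + 0) by rw [add_zero]; exact neg_mem hx)
    obtain ⟨z, hz⟩ := h ⟨a, (h𝔄 a).2 ha⟩
    have h1 := congrArg (fun f : 𝔄 => (f : Module.End Dᵐᵒᵖ V) x) hz
    simp [hax] at h1
    exact hyx (by rw [h1, map_zero]; exact zero_mem _)
  · intro hy a
    have hay : (a : Module.End Dᵐᵒᵖ V) * y ∈ stab L 1 := by
      have := mul_mem_stab ((h𝔄 a).1 a.2) hy
      rwa [zero_add] at this
    obtain ⟨g, hg, hg'⟩ := exists_inverse_one_add hL hay
    refine ⟨⟨_, (h𝔄 _).2 hg'⟩, Subtype.ext ?_⟩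
    have h1 := g.inv_mul
    rw [hg, mul_add, mul_one] at h1
    push_cast
    rw [mul_assoc, add_comm, h1, sub_self]

/-- The powers of the radical of `𝔄` are the steps of the filtration `stab L`. -/
theorem radical_pow (r : ℕ) : radical 𝔄 ^ r = stabIdeal h𝔄 r := by
  induction r with
  | zero =>
    rw [Submodule.pow_zero, Ideal.one_eq_top, eq_comm, Ideal.eq_top_iff_one, mem_stabIdeal]
    exact one_mem_stab
  | succ r ih =>
    rw [Submodule.pow_succ, ih, radical_eq h𝔄 hL hb]
    apply le_antisymm
    · rw [Ideal.mul_le]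
      intro y hy z hz
      have := mul_mem_stab hy hz
      rw [mem_stabIdeal]
      exact_mod_cast this
    · intro y hy
      have hunit : ∀ i j (x : 𝔄), (x : Module.End Dᵐᵒᵖ V) = unit b i j (entry b (y : _) i j) →
          x ∈ stabIdeal h𝔄 r * stabIdeal h𝔄 1 := by
        intro i j x hx
        have h1 := unit_entry_mem_stab hL hb hy i j
        rw [unit, rankOne_mem_stab_iff hL hb] at h1
        -- factor the matrix unit through a vector `w` of level `level (b j) + 1`
        obtain ⟨w, hw, hw'⟩ := hL.exists_notMem (level L (b j) + 1)
        obtain ⟨a, ha, haw⟩ := exists_mem_stab_apply_eq (r := r) hL hb hw hw'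
          (x := op (entry b (y : Module.End Dᵐᵒᵖ V) i j) • b i) (by
            push_cast at h1; rwa [add_assoc, add_comm 1])
        have hc := (rankOne_mem_stab_iff hL hb j w 1).2 hw
        have ha' : a ∈ 𝔄 := (h𝔄 a).2 (stab_anti hL.anti (by positivity) ha)
        have hc' : rankOne b j w ∈ 𝔄 := (h𝔄 _).2 (stab_anti hL.anti zero_le_one hc)
        have : x = ⟨a, ha'⟩ * ⟨_, hc'⟩ := by
          apply Subtype.ext
          rw [hx]
          refine b.ext fun l => ?_
          rw [MulMemClass.coe_mul, Module.End.mul_apply, unit, rankOne_basis, rankOne_basis]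
          split_ifs
          · exact haw.symm
          · rw [map_zero]
        rw [this]
        exact Ideal.mul_mem_mul ((mem_stabIdeal h𝔄).2 ha) ((mem_stabIdeal h𝔄).2 hc)
      have hmem : ∀ i j, unit b i j (entry b (y : Module.End Dᵐᵒᵖ V) i j) ∈ 𝔄 := fun i j =>
        (h𝔄 _).2 (stab_anti hL.anti (by positivity) (unit_entry_mem_stab hL hb hy i j))
      have hsum : y = ∑ j, ∑ i, ⟨_, hmem i j⟩ := by
        apply Subtype.ext
        push_cast
        exact (sum_unit_entry b _).symm
      rw [hsum]
      exact sum_mem fun j _ => sum_mem fun i _ => hunit i j _ rfl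

/-- The steps of the filtration are distinct, as every level occurs. -/
lemma stabIdeal_injective [NeZero k] : Function.Injective (stabIdeal h𝔄) := by
  have hlt : ∀ r s : ℕ, r < s → stabIdeal h𝔄 r ≠ stabIdeal h𝔄 s := by
    intro r s hrs h
    obtain ⟨w, hw, hw'⟩ := hL.exists_notMem (level L (b 0) + r)
    have h1 := (rankOne_mem_stab_iff hL hb 0 w r).2 hw
    have h2 : (⟨_, (h𝔄 _).2 (stab_anti hL.anti (by positivity) h1)⟩ : 𝔄) ∈
        stabIdeal h𝔄 r := h1
    rw [h, mem_stabIdeal, rankOne_mem_stab_iff hL hb] at h2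
    exact hw' (hL.anti (by omega) h2)
  intro r s h
  by_contra hne
  rcases Nat.lt_or_gt_of_ne hne with hlt' | hlt'
  · exact hlt r s hlt' h
  · exact hlt s r hlt' h.symm

variable [TopologicalSpace F] [IsNonarchimedeanLocalField F]

include h𝔄 in
/-- `e(𝔄 | 𝔬_F)` is the period of the chain over `D` times the ramification index of `D`. -/
theorem ramificationIndex_eq [NeZero k] (hv : IsNormalizedValuation F D v e) :
    ramificationIndex 𝔄 = d * e := by
  have hmap : 𝓂[F].map (algebraMap 𝒪[F] 𝔄) = stabIdeal h𝔄 (d * e) := by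
    obtain ⟨π, hπ0, hπ⟩ := exists_ord_eq F 1
    have hstab := fun y r => smul_mem_stab_iff hL hv hπ0 y r
    rw [hπ, mul_one] at hstab
    apply le_antisymm
    · rw [Ideal.map_le_iff_le_comap]
      intro c hc
      rw [Ideal.mem_comap, mem_stabIdeal]
      have hc1 := mem_maximalIdeal_iff.1 hc
      have h1 : (c : F) • (1 : Module.End Dᵐᵒᵖ V) ∈ stab L (d * e : ℕ) := by
        rcases hc1 with h0 | h0
        · rw [h0, zero_smul]; exact zero_mem _
        by_cases hne : (c : F) = 0
        · rw [hne, zero_smul]; exact zero_mem _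
        refine stab_anti hL.anti ?_ ((smul_mem_stab_iff hL hv hne 1 0).2 one_mem_stab)
        rw [zero_add]
        exact le_mul_of_one_le_right (by positivity) h0
      exact h1
    · intro y hy
      have h1 : π⁻¹ • (y : Module.End Dᵐᵒᵖ V) ∈ stab L 0 := by
        rw [← hstab, smul_inv_smul₀ hπ0, zero_add]
        exact hy
      have hπO : π ∈ 𝒪[F] := mem_integer_iff.2 (Or.inr (by omega))
      have h2 : y = ⟨_, (h𝔄 _).2 h1⟩ * algebraMap 𝒪[F] 𝔄 ⟨π, hπO⟩ := by
        apply Subtype.ext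
        have h3 : ((algebraMap 𝒪[F] 𝔄 ⟨π, hπO⟩ : 𝔄) : Module.End Dᵐᵒᵖ V) =
          π • (1 : Module.End Dᵐᵒᵖ V) := rfl
        rw [MulMemClass.coe_mul, h3, mul_smul_comm, mul_one, smul_inv_smul₀ hπ0]
      rw [h2]
      exact Ideal.mul_mem_left _ _ (Ideal.mem_map_of_mem _
        (mem_maximalIdeal_iff.2 (Or.inr hπ.ge)))
  have hset : {n : ℕ | radical 𝔄 ^ n = 𝓂[F].map (algebraMap 𝒪[F] 𝔄)} = {d * e} := by
    ext n
    rw [Set.mem_ofPred_eq, hmap, radical_pow h𝔄 hL hb, (stabIdeal_injective h𝔄 hL hb).eq_iff,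
      Set.mem_singleton_iff]
  rw [ramificationIndex, hset, csInf_singleton]

end Radical

/-! ### The reduced trace of `End_D(V)` -/

section CornerTrace

variable {F : Type u} [Field F] {D : Type v} [DivisionRing D] [Algebra F D]
  {V : Type w} [AddCommGroup V] [Module Dᵐᵒᵖ V] [Module F V] [IsScalarTower F Dᵐᵒᵖ V]

lemma IsReducedTrace.mul_comm {t : Module.End Dᵐᵒᵖ V →ₗ[F] F}
    (ht : IsReducedTrace F (Module.End Dᵐᵒᵖ V) t) (x y : Module.End Dᵐᵒᵖ V) :
    t (x * y) = t (y * x) := by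
  obtain ⟨K, _, _, N, φ, hφ⟩ := ht
  apply (algebraMap F K).injective
  have h : ∀ x y : Module.End Dᵐᵒᵖ V, (1 : K) ⊗ₜ[F] (x * y) = (1 ⊗ₜ x) * (1 ⊗ₜ y) :=
    fun x y => by rw [Algebra.TensorProduct.tmul_mul_tmul, mul_one]
  rw [hφ, hφ, h, h, map_mul, map_mul, Matrix.trace_mul_comm]

variable {k : ℕ} [NeZero k] (b : Module.Basis (Fin k) Dᵐᵒᵖ V)

lemma IsReducedTrace.eq_sum {t : Module.End Dᵐᵒᵖ V →ₗ[F] F}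
    (ht : IsReducedTrace F (Module.End Dᵐᵒᵖ V) t) (y : Module.End Dᵐᵒᵖ V) :
    t y = ∑ j, t (unit b 0 0 (entry b y j j)) := by
  conv_lhs => rw [← sum_unit_entry b y]
  rw [map_sum]
  refine Finset.sum_congr rfl fun j _ => ?_
  rw [map_sum, Finset.sum_eq_single j]
  · have h1 := ht.mul_comm (unit b j 0 (entry b y j j)) (unit b 0 j 1)
    rwa [unit_mul_unit, unit_mul_unit, one_mul, mul_one] at h1
  · intro i _ hij
    have h1 := ht.mul_comm (unit b i i 1) (unit b i j (entry b y i j))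
    rwa [unit_mul_unit, unit_mul_unit_of_ne b _ _ hij.symm, one_mul, map_zero] at h1
  · simp

lemma exists_isSplitting_corner {K : Type*} [Field K] [Algebra F K] {N : ℕ}
    (φ : (K ⊗[F] Module.End Dᵐᵒᵖ V) ≃ₐ[K] Matrix (Fin N) (Fin N) K) :
    ∃ (r : ℕ) (ρ : D →ₐ[F] Matrix (Fin r) (Fin r) K), IsSplitting ρ ∧
      ∀ x, (ρ x).trace = (φ (1 ⊗ₜ corner (F := F) b x)).trace :=
  exists_isSplitting φ (corner b) (unit_injective b 0 0)
    (fun x y => (unit_mul_unit b 0 0 0 x y).symm)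
    fun a => ⟨_, unit_mul_mul_unit b 0 0 0 0 1 1 a⟩

end CornerTrace

section ReducedTrace

variable {F : Type u} [Field F] [ValuativeRel F] [TopologicalSpace F]
  [IsNonarchimedeanLocalField F] {D : Type v} [DivisionRing D] [Algebra F D]
  {V : Type w} [AddCommGroup V] [Module Dᵐᵒᵖ V] [Module F V] [IsScalarTower F Dᵐᵒᵖ V]
  {v : D → ℤ} {e k : ℕ} [NeZero k] (b : Module.Basis (Fin k) Dᵐᵒᵖ V)

variable [FiniteDimensional F D]

include b in
/-- `reducedTrace` is the reduced trace: `End_D(V)` splits over an algebraic closure of `F`. -/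
theorem isReducedTrace_reducedTrace [FiniteDimensional F V] [Algebra.IsCentral F D] :
    IsReducedTrace F (Module.End Dᵐᵒᵖ V) (reducedTrace F (Module.End Dᵐᵒᵖ V)) := by
  obtain ⟨v, e, hv⟩ := exists_isNormalizedValuation F D
  suffices h : ∃ t : Module.End Dᵐᵒᵖ V →ₗ[F] F, IsReducedTrace F (Module.End Dᵐᵒᵖ V) t by
    rw [reducedTrace, dif_pos h]
    exact h.choose_spec
  let K := AlgebraicClosure F
  have : IsSimpleRing (Module.End Dᵐᵒᵖ V) := isSimpleRing_end b
  have : Module.Finite F (Module.End Dᵐᵒᵖ V) :=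
    Module.Finite.of_injective (LinearMap.restrictScalarsₗ F Dᵐᵒᵖ V V F)
      (LinearMap.restrictScalars_injective F)
  have h1 := isSimpleRing_tensorProduct F K (Module.End Dᵐᵒᵖ V)
  have : IsSimpleRing (K ⊗[F] Module.End Dᵐᵒᵖ V) :=
    IsSimpleRing.of_ringEquiv
      (Algebra.TensorProduct.comm F (Module.End Dᵐᵒᵖ V) K).toRingEquiv h1
  obtain ⟨N, -, ⟨φ⟩⟩ :=
    IsSimpleRing.exists_algEquiv_matrix_of_isAlgClosed K (K ⊗[F] Module.End Dᵐᵒᵖ V)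
  obtain ⟨r, ρ, hρ, htr⟩ := exists_isSplitting_corner b φ
  obtain ⟨z, -, t, ht0, -, ht⟩ := hv.exists_trace_eq_unit hρ
  exact exists_isReducedTrace φ ht0 (by rw [← htr, ht])

variable {t : Module.End Dᵐᵒᵖ V →ₗ[F] F} (ht : IsReducedTrace F (Module.End Dᵐᵒᵖ V) t)

include ht

/-- On a corner of `End_D(V)` the reduced trace is the one of `D`. -/
lemma IsReducedTrace.isTraceForm (hv : IsNormalizedValuation F D v e) :
    IsTraceForm hv (t ∘ₗ corner b) := by
  obtain ⟨K, _, _, N, φ, hφ⟩ := ht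
  obtain ⟨r, ρ, hρ, htr⟩ := exists_isSplitting_corner b φ
  exact isTraceForm_of_isSplitting hv hρ fun x => by rw [htr, ← hφ]; rfl

variable {L : ℤ → AddSubgroup V} {d : ℕ} (hL : IsPeriodicFiltration v d L) (hb : IsAdapted L b)
  (hv : IsNormalizedValuation F D v e)

include hL hb

include hv

/-- The reduced trace maps `𝔓 ^ (E m + 1)` to `𝔭_F ^ (m + 1)`, where `E = e(𝔄 | 𝔬_F)`. -/
lemma IsReducedTrace.mem_fracIdeal {y : Module.End Dᵐᵒᵖ V} {m : ℤ}
    (hy : y ∈ stab L ((d * e : ℕ) * m + 1)) : t y ∈ fracIdeal F (m + 1) := by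
  rw [ht.eq_sum b]
  refine sum_mem fun j _ => (ht.isTraceForm b hv).mem_succ m _ ?_
  have h1 := (unit_diag_mem_stab_iff hL hb j _ _).1 (unit_entry_mem_stab hL hb hy j j)
  refine h1.imp_right fun h => ?_
  push_cast at h
  have hd : (0 : ℤ) < d := by exact_mod_cast hL.period_pos
  by_contra hlt
  have h2 : v (entry b y j j) ≤ e * m := by omega
  nlinarith

/-- Every element of `𝔭_F ^ m` is the reduced trace of an element of `𝔓 ^ (E m)`. -/
lemma IsReducedTrace.exists_eq {c : F} {m s : ℤ} (hc : c ∈ fracIdeal F m)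
    (hs : s ≤ (d * e : ℕ) * m) : ∃ y ∈ stab L s, t y = c := by
  obtain ⟨u, hu, hu1⟩ := (ht.isTraceForm b hv).exists_eq_one
  refine ⟨corner (F := F) b (c • u), ?_, ?_⟩
  · refine (unit_diag_mem_stab_iff hL hb 0 _ _).2 ?_
    refine (hv.smul_mem hc hu).imp_right fun h => ?_
    push_cast at hs
    have hd : (0 : ℤ) < d := by exact_mod_cast hL.period_pos
    nlinarith
  · rw [map_smul, map_smul, ← LinearMap.comp_apply, hu1, smul_eq_mul, mul_one]

end ReducedTrace

/-! ### Characters of `GL_m(D)` on the filtration -/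

section Conj

variable {D : Type v} [DivisionRing D] {V : Type w} [AddCommGroup V] [Module Dᵐᵒᵖ V]
  {k : ℕ} (b : Module.Basis (Fin k) Dᵐᵒᵖ V)

lemma one_add_unit_mul_one_add_unit (i : Fin k) (x y : D) :
    (1 + unit b i i (x - 1)) * (1 + unit b i i (y - 1)) = 1 + unit b i i (x * y - 1) := by
  have h : x * y - 1 = (x - 1) + (y - 1) + (x - 1) * (y - 1) := by noncomm_ring
  rw [h, unit_add, unit_add, ← unit_mul_unit b i i i]
  noncomm_ring

/-- The diagonal matrix with entry `a` in position `i` and `1` elsewhere. -/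
noncomputable def diagUnit (i : Fin k) (a : D) (ha : a ≠ 0) : (Module.End Dᵐᵒᵖ V)ˣ where
  val := 1 + unit b i i (a - 1)
  inv := 1 + unit b i i (a⁻¹ - 1)
  val_inv := by
    rw [one_add_unit_mul_one_add_unit, mul_inv_cancel₀ ha, sub_self, unit_zero, add_zero]
  inv_val := by
    rw [one_add_unit_mul_one_add_unit, inv_mul_cancel₀ ha, sub_self, unit_zero, add_zero]

lemma diagUnit_mul_unit (i j : Fin k) {a : D} (ha : a ≠ 0) (x : D) :
    (diagUnit b i a ha : Module.End Dᵐᵒᵖ V) * unit b i j x = unit b i j (a * x) := by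
  change (1 + unit b i i (a - 1)) * _ = _
  rw [add_mul, one_mul, unit_mul_unit, ← unit_add]
  congr 1
  noncomm_ring

lemma unit_mul_diagUnit (i j : Fin k) {a : D} (ha : a ≠ 0) (x : D) :
    unit b j i x * (diagUnit b i a ha : Module.End Dᵐᵒᵖ V) = unit b j i (x * a) := by
  change _ * (1 + unit b i i (a - 1)) = _
  rw [mul_add, mul_one, unit_mul_unit, ← unit_add]
  congr 1
  noncomm_ring

lemma unit_mul_diagUnit_of_ne {i j : Fin k} (hij : i ≠ j) (l : Fin k) {a : D} (ha : a ≠ 0)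
    (x : D) : unit b l j x * (diagUnit b i a ha : Module.End Dᵐᵒᵖ V) = unit b l j x := by
  change _ * (1 + unit b i i (a - 1)) = _
  rw [mul_add, mul_one, unit_mul_unit_of_ne b _ _ hij.symm, add_zero]

/-- The permutation of the basis that exchanges the vectors `i` and `j`. -/
noncomputable def swapUnit (i j : Fin k) : (Module.End Dᵐᵒᵖ V)ˣ :=
  LinearMap.GeneralLinearGroup.ofLinearEquiv (b.equiv b (Equiv.swap i j))

lemma swapUnit_mul_unit (i j : Fin k) (x : D) :
    (swapUnit b i j : Module.End Dᵐᵒᵖ V) * unit b j j x = unit b i i x * swapUnit b i j := by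
  have h : ∀ l, (swapUnit b i j : Module.End Dᵐᵒᵖ V) (b l) = b (Equiv.swap i j l) := fun l =>
    b.equiv_apply l b (Equiv.swap i j)
  refine b.ext fun l => ?_
  simp only [Module.End.mul_apply, h, unit_basis]
  have hiff : Equiv.swap i j l = i ↔ l = j := by
    rw [Equiv.swap_apply_eq_iff, Equiv.swap_apply_left]
  simp only [hiff]
  split_ifs
  · rw [map_smul, h, Equiv.swap_apply_right]
  · simp

end Conj

section Char

variable {A : Type*} [Ring A] (χ : Aˣ →* ℂˣ)

open Classical in
/-- The function `y ↦ χ (1 + y)`, extended by `1` to those `y` for which `1 + y` is not a unit. -/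
noncomputable def oneAddChar (y : A) : ℂ := if h : IsUnit (1 + y) then χ h.unit else 1

variable {χ}

lemma oneAddChar_eq {g : Aˣ} {y : A} (hg : (g : A) = 1 + y) : oneAddChar χ y = χ g := by
  have h : IsUnit (1 + y) := hg ▸ g.isUnit
  rw [oneAddChar, dif_pos h]
  congr 2
  exact Units.ext (by rw [IsUnit.unit_spec, hg])

/-- `y ↦ χ (1 + y)` is invariant under conjugation. -/
lemma oneAddChar_eq_of_mul_eq_mul {g : Aˣ} {y z : A} (h : (g : A) * y = z * g) :
    oneAddChar χ y = oneAddChar χ z := by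
  have hz : 1 + z = g * (1 + y) * (g⁻¹ : Aˣ) := by
    rw [mul_add, mul_one, h, add_mul, Units.mul_inv, mul_assoc, Units.mul_inv, mul_one]
  by_cases hy : IsUnit (1 + y)
  · rw [oneAddChar_eq hy.unit_spec,
      oneAddChar_eq (g := g * hy.unit * g⁻¹) (by rw [hz]; simp), map_mul, map_mul, map_inv,
      mul_inv_cancel_comm]
  · have hz' : ¬ IsUnit (1 + z) := by
      rintro ⟨s, hs⟩
      refine hy ⟨g⁻¹ * s * g, ?_⟩
      push_cast
      rw [hs, hz]
      simp [mul_assoc]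
    rw [oneAddChar, dif_neg hy, oneAddChar, dif_neg hz']

end Char

section Level

variable {D : Type v} [DivisionRing D] {V : Type w} [AddCommGroup V] [Module Dᵐᵒᵖ V]
  {L : ℤ → AddSubgroup V} {v : D → ℤ} {d : ℕ} {χ : (Module.End Dᵐᵒᵖ V)ˣ →* ℂˣ} {n m : ℕ}

/-- The character `χ` of `G` is trivial on `1 + 𝔓 ^ (n + 1)`, the filtration being given by `L`. -/
def IsTrivialAbove (L : ℤ → AddSubgroup V) (χ : (Module.End Dᵐᵒᵖ V)ˣ →* ℂˣ) (n : ℕ) : Prop :=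
  ∀ g : (Module.End Dᵐᵒᵖ V)ˣ, ∀ y ∈ stab L (n + 1), (g : Module.End Dᵐᵒᵖ V) = 1 + y → χ g = 1

variable (hL : IsPeriodicFiltration v d L) (hχ : IsTrivialAbove L χ n)

include hL hχ

lemma oneAddChar_eq_one [FiniteDimensional Dᵐᵒᵖ V] {y : Module.End Dᵐᵒᵖ V}
    (hy : y ∈ stab L (n + 1)) : oneAddChar χ y = 1 := by
  obtain ⟨g, hg, -⟩ := exists_inverse_one_add hL (stab_anti hL.anti (by omega) hy)
  rw [oneAddChar_eq hg, hχ g y hy hg, Units.val_one]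

variable (hm : 1 ≤ m) (hnm : n + 1 ≤ 2 * m)

include hm hnm

/-- `y ↦ χ (1 + y)` is additive on `𝔓 ^ m` if `2 m ≥ n + 1`. -/
lemma oneAddChar_add [FiniteDimensional Dᵐᵒᵖ V] {y z : Module.End Dᵐᵒᵖ V}
    (hy : y ∈ stab L m) (hz : z ∈ stab L m) :
    oneAddChar χ (y + z) = oneAddChar χ y * oneAddChar χ z := by
  have h1 : stab (D := D) L m ≤ stab L 1 := stab_anti hL.anti (by exact_mod_cast hm)
  obtain ⟨g, hg, -⟩ := exists_inverse_one_add hL (h1 hy)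
  obtain ⟨h, hh, -⟩ := exists_inverse_one_add hL (h1 hz)
  obtain ⟨s, hs, hs'⟩ := exists_inverse_one_add hL (h1 (add_mem hy hz))
  rw [oneAddChar_eq hg, oneAddChar_eq hh, oneAddChar_eq hs, ← Units.val_mul, ← map_mul]
  -- `(1 + y) (1 + z) = (1 + y + z) (1 + (1 + y + z)⁻¹ y z)`, and the last factor is in the kernel
  have hone : χ (s⁻¹ * (g * h)) = 1 := by
    refine hχ _ ((s⁻¹ : (Module.End Dᵐᵒᵖ V)ˣ) * (y * z)) ?_ ?_
    · exact stab_anti hL.anti (by omega) (mul_mem_stab hs' (mul_mem_stab hy hz))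
    · have : (g : Module.End Dᵐᵒᵖ V) * h = s + y * z := by
        rw [hg, hh, hs]
        noncomm_ring
      push_cast
      rw [this, mul_add, Units.inv_mul]
  rw [map_mul, map_inv, inv_mul_eq_one] at hone
  rw [hone]

lemma oneAddChar_sum [FiniteDimensional Dᵐᵒᵖ V] {ι : Type*} (s : Finset ι)
    (y : ι → Module.End Dᵐᵒᵖ V) (hy : ∀ i ∈ s, y i ∈ stab L m) :
    oneAddChar χ (∑ i ∈ s, y i) = ∏ i ∈ s, oneAddChar χ (y i) := by
  classical
  induction s using Finset.induction_on with
  | empty => simpa using oneAddChar_eq_one hL hχ (zero_mem _)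
  | insert a s ha ih =>
    have hs : ∀ i ∈ s, y i ∈ stab L m := fun i hi => hy i (Finset.mem_insert_of_mem hi)
    rw [Finset.sum_insert ha, Finset.prod_insert ha, ← ih hs]
    exact oneAddChar_add hL hχ hm hnm (hy a (Finset.mem_insert_self a s)) (sum_mem hs)

end Level

section Abelian

variable {F : Type u} [Field F] [ValuativeRel F] [TopologicalSpace F]
  [IsNonarchimedeanLocalField F] {D : Type v} [DivisionRing D] [Algebra F D]
  {V : Type w} [AddCommGroup V] [Module Dᵐᵒᵖ V]
  {v : D → ℤ} {e : ℕ} (hv : IsNormalizedValuation F D v e)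
  {L : ℤ → AddSubgroup V} {d : ℕ} {χ : (Module.End Dᵐᵒᵖ V)ˣ →* ℂˣ} {n m : ℕ}
  (hL : IsPeriodicFiltration v d L) (hχ : IsTrivialAbove L χ n)
  (hm : 1 ≤ m) (hnm : n + 1 ≤ 2 * m)
  {k : ℕ} {b : Module.Basis (Fin k) Dᵐᵒᵖ V} (hb : IsAdapted L b)

include hv hL hχ hm hnm hb

/-- `χ` is trivial on the elementary matrices `1 + x e_ij`: by conjugation with a diagonal matrix,
its value there does not change if `x` is replaced by `ϖ x` or by `(1 + ϖ) x`. -/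
lemma oneAddChar_unit_of_ne {i j : Fin k} (hij : i ≠ j) {x : D} (hx : unit b i j x ∈ stab L m) :
    oneAddChar χ (unit b i j x) = 1 := by
  have : FiniteDimensional Dᵐᵒᵖ V := .of_basis b
  obtain ⟨a, ha0, ha⟩ := hv.exists_eq_one
  have ha1 : 1 + a ≠ 0 := fun h => by
    rw [eq_neg_of_add_eq_zero_right h, hv.map_neg, hv.map_one] at ha
    omega
  have hconj : ∀ c : D, c ≠ 0 →
      oneAddChar χ (unit b i j x) = oneAddChar χ (unit b i j (c * x)) := fun c hc => by
    refine oneAddChar_eq_of_mul_eq_mul (g := diagUnit b i c hc) ?_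
    rw [diagUnit_mul_unit, unit_mul_diagUnit_of_ne b hij]
  have hax : unit b i j (a * x) ∈ stab L m := by
    by_cases hx0 : x = 0
    · rw [hx0, mul_zero, unit_zero]; exact zero_mem _
    rw [unit_mem_stab_iff hL hb] at hx ⊢
    have h1 := hx.resolve_left hx0
    right
    rw [hv.map_mul _ _ ha0 hx0, ha, mul_add]
    have := hL.period_pos
    omega
  have h1 := hconj (1 + a) ha1
  rw [add_mul, one_mul, unit_add, oneAddChar_add hL hχ hm hnm hx hax, ← hconj a ha0] at h1
  have h2 : oneAddChar χ (unit b i j x) ≠ 0 := by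
    rw [oneAddChar]
    split_ifs <;> simp
  exact (mul_eq_left₀ h2).1 h1.symm

/-- `χ (1 + y)` depends on the diagonal of `y` only, and permutation matrices move the diagonal
entries to the first corner. -/
lemma oneAddChar_eq_prod [NeZero k] {y : Module.End Dᵐᵒᵖ V} (hy : y ∈ stab L m) :
    oneAddChar χ y = ∏ j, oneAddChar χ (unit b 0 0 (entry b y j j)) := by
  have : FiniteDimensional Dᵐᵒᵖ V := .of_basis b
  have hmem := unit_entry_mem_stab hL hb hy
  conv_lhs => rw [← sum_unit_entry b y]
  rw [oneAddChar_sum hL hχ hm hnm _ _ fun j _ => sum_mem fun i _ => hmem i j]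
  refine Finset.prod_congr rfl fun j _ => ?_
  rw [oneAddChar_sum hL hχ hm hnm _ _ fun i _ => hmem i j, Finset.prod_eq_single j]
  · exact oneAddChar_eq_of_mul_eq_mul (swapUnit_mul_unit b 0 j _)
  · intro i _ hij
    exact oneAddChar_unit_of_ne hv hL hχ hm hnm hb hij (hmem i j)
  · simp

/-- On the corner `D` of `End_D(V)`, the character `x ↦ χ (1 + x)` is invariant under conjugation;
by the Casimir identity it depends on `τ x` only. -/
lemma oneAddChar_unit_eq [NeZero k] {τ : D →ₗ[F] F} (hτ : IsTraceForm hv τ) {u : D}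
    (hu : u ∈ hv.ideal 0) (hu1 : τ u = 1) {x : D} (hx : unit b 0 0 x ∈ stab L m) :
    oneAddChar χ (unit b 0 0 x) = oneAddChar χ (unit b 0 0 (τ x • u)) := by
  have : FiniteDimensional Dᵐᵒᵖ V := .of_basis b
  have hsum : ∀ {N : ℕ} (z : Fin N → D),
      unit b 0 0 (∑ l, z l) = ∑ l, unit b 0 0 (z l) := fun z =>
    map_sum (AddMonoidHom.mk' (unit b 0 0) (unit_add b 0 0)) z _
  by_cases hx0 : x = 0
  · rw [hx0, map_zero, zero_smul]
  have hxv := ((unit_diag_mem_stab_iff hL hb 0 x m).1 hx).resolve_left hx0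
  have hmem : ∀ z ∈ hv.ideal (v x), unit b 0 0 z ∈ stab L m := fun z hz =>
    (unit_diag_mem_stab_iff hL hb 0 z m).2
      (hz.imp_right fun h => hxv.trans (mul_le_mul_of_nonneg_left h (by positivity)))
  obtain ⟨N, α, β, hαβ, h1, h2⟩ := hτ.casimir
  have hxe : x = ∑ l, (x * α l * u) * β l := by
    calc x = x * algebraMap F D (τ u) := by rw [hu1, _root_.map_one, mul_one]
      _ = _ := by
        rw [← h1, Finset.mul_sum]
        simp only [mul_assoc]
  have hxe' : τ x • u = ∑ l, β l * (x * α l * u) := by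
    rw [Algebra.smul_def, ← h2, Finset.sum_mul]
    simp only [mul_assoc]
  have hswap : ∀ l, (x * α l * u) * β l ∈ hv.ideal (v x) ∧
      β l * (x * α l * u) ∈ hv.ideal (v x) := by
    intro l
    obtain ⟨hβ, hab⟩ := hαβ l
    by_cases hα : α l = 0
    · simp [hα, zero_mem]
    by_cases hu0 : u = 0
    · simp [hu0, zero_mem]
    rw [hv.mem_ideal_of_ne (mul_ne_zero hα hβ), hv.map_mul _ _ hα hβ] at hab
    rw [hv.mem_ideal_of_ne hu0] at hu
    have hxα := mul_ne_zero hx0 hα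
    have hxαu := mul_ne_zero hxα hu0
    rw [hv.mem_ideal_of_ne (mul_ne_zero hxαu hβ), hv.mem_ideal_of_ne (mul_ne_zero hβ hxαu),
      hv.map_mul _ _ hxαu hβ, hv.map_mul _ _ hβ hxαu, hv.map_mul _ _ hxα hu0,
      hv.map_mul _ _ hx0 hα]
    omega
  conv_lhs => rw [hxe]
  rw [hxe', hsum, hsum, oneAddChar_sum hL hχ hm hnm _ _ fun l _ => hmem _ (hswap l).1,
    oneAddChar_sum hL hχ hm hnm _ _ fun l _ => hmem _ (hswap l).2]
  refine Finset.prod_congr rfl fun l _ => ?_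
  refine oneAddChar_eq_of_mul_eq_mul (g := diagUnit b 0 (β l) (hαβ l).1) ?_
  rw [diagUnit_mul_unit, unit_mul_diagUnit, mul_assoc (β l)]

variable [FiniteDimensional F D] [Module F V] [IsScalarTower F Dᵐᵒᵖ V]

/-- On `1 + 𝔓 ^ m` with `2 m ≥ n + 1`, the character `χ` has the form `1 + y ↦ ψ (c Trd y)`. -/
theorem exists_oneAddChar_eq [NeZero k] {t : Module.End Dᵐᵒᵖ V →ₗ[F] F}
    (ht : IsReducedTrace F (Module.End Dᵐᵒᵖ V) t) (ψ : AddChar F ℂ)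
    (hψ : IsSmoothOfConductorMaximalIdeal F ψ) :
    ∃ c : F, ∀ y ∈ stab L m, oneAddChar χ y = ψ (c * t y) := by
  have : FiniteDimensional Dᵐᵒᵖ V := .of_basis b
  have hτ := ht.isTraceForm b hv
  obtain ⟨u, hu, hu1⟩ := hτ.exists_eq_one
  have hE : (0 : ℤ) < (d * e : ℕ) := by exact_mod_cast Nat.mul_pos hL.period_pos hv.ramification_pos
  -- `q + 1` is the least integer that is at least `m / (d e)`
  obtain ⟨q, hq1, hq2⟩ : ∃ q : ℤ, (d * e : ℕ) * q + 1 ≤ m ∧ (m : ℤ) ≤ (d * e : ℕ) * (q + 1) := by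
    refine ⟨(m - 1) / (d * e : ℕ), ?_, ?_⟩
    · have := Int.mul_ediv_self_le (x := (m : ℤ) - 1) hE.ne'
      omega
    · have := Int.lt_mul_ediv_self_add (x := (m : ℤ) - 1) hE
      rw [mul_add, mul_one]
      omega
  have hmem : ∀ (s : ℤ) (p : ℤ), s ≤ (d * e : ℕ) * p → ∀ c ∈ fracIdeal F p,
      unit b 0 0 (c • u) ∈ stab L s := by
    intro s p hsp c hc
    refine (unit_diag_mem_stab_iff hL hb 0 _ _).2 ?_
    refine (hv.smul_mem hc hu).imp_right fun h => ?_
    push_cast at hsp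
    have hd : (0 : ℤ) < d := by exact_mod_cast hL.period_pos
    nlinarith
  obtain ⟨c, hc⟩ := exists_eq_char_mul ψ hψ (q + 1) (n + 1)
    (fun s => oneAddChar χ (unit b 0 0 (s • u)))
    (fun x hx y hy => by
      rw [add_smul, unit_add]
      exact oneAddChar_add hL hχ hm hnm (hmem _ _ hq2 x hx) (hmem _ _ hq2 y hy))
    (fun x hx => oneAddChar_eq_one hL hχ (hmem _ _ (by push_cast at *; nlinarith) x hx))
  refine ⟨c, fun y hy => ?_⟩
  rw [oneAddChar_eq_prod hv hL hχ hm hnm hb hy, ht.eq_sum b, Finset.mul_sum]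
  refine Eq.trans ?_ (map_prod ψ.toMonoidHom (fun j => Multiplicative.ofAdd
    (c * t (unit b 0 0 (entry b y j j)))) Finset.univ).symm
  refine Finset.prod_congr rfl fun j _ => ?_
  have hj : unit b 0 0 (entry b y j j) ∈ stab L m := by
    rw [unit_diag_mem_stab_iff hL hb, ← unit_diag_mem_stab_iff hL hb j]
    exact unit_entry_mem_stab hL hb hy j j
  rw [oneAddChar_unit_eq hv hL hχ hm hnm hb hτ hu hu1 hj]
  exact hc _ (ht.mem_fracIdeal b hL hb hv (stab_anti hL.anti hq1 hj))

end Abelian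

/-! ### The level of the character -/

variable {F : Type u} [Field F] [ValuativeRel F] [TopologicalSpace F]
  [IsNonarchimedeanLocalField F]

/-- If `x ↦ ψ (c x)` is trivial on the traces of `𝔓 ^ (n + 1)` but not on those of `𝔓 ^ n`, the
traces of `𝔓 ^ s` being `𝔭_F ^ ⌈s / E⌉`, then `E` divides `n` and `v_F(c) = - n / E`. -/
lemma ord_eq_neg_div {ψ : AddChar F ℂ} (hψ : IsSmoothOfConductorMaximalIdeal F ψ) {c : F} {E n : ℕ}
    (hE : 0 < E) (htriv : ∀ m : ℤ, (n : ℤ) + 1 ≤ E * m → ∀ x ∈ fracIdeal F m, ψ (c * x) = 1)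
    (hnontriv : ∀ m : ℤ, (E : ℤ) * m + 1 ≤ n → ∃ x ∈ fracIdeal F (m + 1), ψ (c * x) ≠ 1) :
    c ≠ 0 ∧ (ord F c : ℚ) = -(n : ℚ) / E := by
  have hE' : (0 : ℤ) < E := by exact_mod_cast hE
  -- `q + 1 = ⌈n / E⌉`
  obtain ⟨q, hq1, hq2⟩ : ∃ q : ℤ, (E : ℤ) * q + 1 ≤ n ∧ (n : ℤ) ≤ E * (q + 1) := by
    refine ⟨((n : ℤ) - 1) / E, ?_, ?_⟩
    · have := Int.mul_ediv_self_le (x := (n : ℤ) - 1) hE'.ne'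
      omega
    · have := Int.lt_mul_ediv_self_add (x := (n : ℤ) - 1) hE'
      rw [mul_add, mul_one]
      omega
  obtain ⟨x, hx, hx1⟩ := hnontriv q hq1
  have hc : c ≠ 0 := by
    rintro rfl
    simp at hx1
  have hx0 : x ≠ 0 := by
    rintro rfl
    simp at hx1
  have hle : ord F c + (q + 1) ≤ 0 := by
    by_contra! h
    have hmem : c * x ∈ fracIdeal F 1 := by
      rw [mem_fracIdeal_of_ne hx0] at hx
      rw [mem_fracIdeal_of_ne (mul_ne_zero hc hx0), ord_mul hc hx0]
      omega
    have hint : c * x ∈ 𝒪[F] := mem_integer_iff.2 (fracIdeal_anti zero_le_one hmem)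
    exact hx1 (hψ.trivial_on ⟨c * x, hint⟩ (mem_maximalIdeal_iff.2 hmem))
  have hge : ∀ m : ℤ, (n : ℤ) + 1 ≤ E * m → 1 ≤ ord F c + m := by
    intro m hm
    by_contra! h
    obtain ⟨z, hz⟩ := hψ.nontrivial_on
    refine hz ?_
    have h1 := htriv m hm (c⁻¹ * z) ?_
    · rwa [mul_inv_cancel_left₀ hc] at h1
    · rw [← mul_mem_fracIdeal_iff hc, mul_inv_cancel_left₀ hc]
      exact fracIdeal_anti (by omega) (mem_integer_iff.1 z.2)
  have heq : (n : ℤ) = E * (q + 1) := by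
    by_contra hne
    have := hge (q + 1) (by omega)
    omega
  have hord : ord F c = -(q + 1) := by
    have := hge (q + 2) (by rw [heq]; nlinarith)
    omega
  refine ⟨hc, ?_⟩
  rw [eq_div_iff (by exact_mod_cast hE.ne'), hord]
  have : (n : ℚ) = E * (q + 1) := by exact_mod_cast heq
  rw [this]
  push_cast
  ring

end PrincipalOrder

theorem mainTheorem9
    {F : Type u} [Field F] [ValuativeRel F] [TopologicalSpace F] [IsNonarchimedeanLocalField F]
    {D : Type v} [DivisionRing D] [Algebra F D] [Algebra.IsCentral F D] [FiniteDimensional F D]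
    {V : Type w} [AddCommGroup V] [Module Dᵐᵒᵖ V] [Module F V] [IsScalarTower F Dᵐᵒᵖ V]
    [FiniteDimensional F V]
    (ψ : AddChar F ℂ) (hψ : PrincipalOrder.IsSmoothOfConductorMaximalIdeal F ψ)
    (χ : (Module.End Dᵐᵒᵖ V)ˣ →* ℂˣ) (hχ : PrincipalOrder.IsSmoothCharacter F χ)
    (𝔄 : Subalgebra 𝒪[F] (Module.End Dᵐᵒᵖ V))
    (h𝔄 : PrincipalOrder.IsPrincipalHereditaryOrder 𝔄)
    (n : ℕ)
    (htriv : ∀ g ∈ PrincipalOrder.unitFiltration 𝔄 (n + 1), χ g = 1)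
    (hnontriv : ∃ g ∈ PrincipalOrder.unitFiltration 𝔄 n, χ g ≠ 1) :
    ∃ c : F, c ≠ 0 ∧
      (PrincipalOrder.ord F c : ℚ) = -(n : ℚ) / (PrincipalOrder.ramificationIndex 𝔄 : ℚ) ∧
      ∀ y ∈ PrincipalOrder.radical 𝔄 ^ (n / 2 + 1),
        ∃ g : (Module.End Dᵐᵒᵖ V)ˣ,
          (g : Module.End Dᵐᵒᵖ V) = 1 + (y : Module.End Dᵐᵒᵖ V) ∧
          (χ g : ℂ) = ψ (PrincipalOrder.reducedTrace F (Module.End Dᵐᵒᵖ V)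
            (c • (y : Module.End Dᵐᵒᵖ V))) := by
  classical
  obtain ⟨L, hL₀, h𝔄'⟩ := h𝔄.exists_chain
  obtain ⟨v, e, hv⟩ := PrincipalOrder.exists_isNormalizedValuation F D
  obtain ⟨d, hL, k, b, hb⟩ := PrincipalOrder.exists_isPeriodicFiltration hv hL₀
  have h𝔄 : ∀ a : Module.End Dᵐᵒᵖ V, a ∈ 𝔄 ↔ a ∈ PrincipalOrder.stab L 0 := fun a => by
    rw [h𝔄', PrincipalOrder.mem_stab]
    simp only [add_zero]
  have : NeZero k := by
    refine ⟨?_⟩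
    rintro rfl
    obtain ⟨x, -, hx⟩ := hL.exists_notMem 0
    have hx0 : x = 0 := b.ext_elem fun i => i.elim0
    exact hx (hx0 ▸ zero_mem _)
  have : FiniteDimensional Dᵐᵒᵖ V := .of_basis b
  have hrad : ∀ (r : ℕ) (y : 𝔄), y ∈ PrincipalOrder.radical 𝔄 ^ r ↔
      (y : Module.End Dᵐᵒᵖ V) ∈ PrincipalOrder.stab L r := fun r y => by
    rw [PrincipalOrder.radical_pow h𝔄 hL hb, PrincipalOrder.mem_stabIdeal]
  have ht := PrincipalOrder.isReducedTrace_reducedTrace (F := F) b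
  set t := PrincipalOrder.reducedTrace F (Module.End Dᵐᵒᵖ V)
  have hE : 0 < d * e := Nat.mul_pos hL.period_pos hv.ramification_pos
  have hχ1 : PrincipalOrder.IsTrivialAbove L χ n := by
    intro g y hy hg
    refine htriv g ?_
    rw [PrincipalOrder.unitFiltration, if_neg n.succ_ne_zero]
    exact ⟨⟨y, (h𝔄 y).2 (PrincipalOrder.stab_anti hL.anti (by omega) hy)⟩,
      (hrad _ _).2 (by exact_mod_cast hy), hg⟩
  have hunit : ∀ y ∈ PrincipalOrder.radical 𝔄 ^ (n / 2 + 1),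
      ∃ g : (Module.End Dᵐᵒᵖ V)ˣ, (g : Module.End Dᵐᵒᵖ V) = 1 + (y : Module.End Dᵐᵒᵖ V) := by
    intro y hy
    obtain ⟨g, hg, -⟩ := PrincipalOrder.exists_inverse_one_add hL
      (PrincipalOrder.stab_anti hL.anti (by push_cast; omega) ((hrad _ _).1 hy))
    exact ⟨g, hg⟩
  rw [PrincipalOrder.ramificationIndex_eq h𝔄 hL hb hv]
  rcases Nat.eq_zero_or_pos n with rfl | hn
  · -- both sides are trivial on `𝔓`
    refine ⟨1, one_ne_zero, by simp, fun y hy => ?_⟩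
    obtain ⟨g, hg⟩ := hunit y hy
    have hy1 := (hrad _ _).1 hy
    refine ⟨g, hg, ?_⟩
    have hmem : t y ∈ PrincipalOrder.fracIdeal F 1 := by
      have := ht.mem_fracIdeal b hL hb hv (m := 0) (by simpa using hy1)
      rwa [zero_add] at this
    have hint : t y ∈ 𝒪[F] :=
      PrincipalOrder.mem_integer_iff.2 (PrincipalOrder.fracIdeal_anti zero_le_one hmem)
    rw [one_smul, hχ1 g y (by simpa using hy1) hg, Units.val_one]
    exact (hψ.trivial_on ⟨t y, hint⟩ (PrincipalOrder.mem_maximalIdeal_iff.2 hmem)).symm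
  obtain ⟨c, hc⟩ := PrincipalOrder.exists_oneAddChar_eq hv hL hχ1 (m := n / 2 + 1) (by omega)
    (by omega) hb ht ψ hψ
  obtain ⟨hc0, hord⟩ := PrincipalOrder.ord_eq_neg_div hψ (c := c) (n := n) hE
    (fun m hm x hx => by
      obtain ⟨y, hy, rfl⟩ := ht.exists_eq b hL hb hv hx hm
      rw [← hc y (PrincipalOrder.stab_anti hL.anti (by push_cast; omega) hy)]
      exact PrincipalOrder.oneAddChar_eq_one hL hχ1 hy)
    (fun m hm => by
      obtain ⟨g, hg, hg1⟩ := hnontriv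
      rw [PrincipalOrder.unitFiltration, if_neg hn.ne'] at hg
      obtain ⟨y, hy, hgy⟩ := hg
      have hy' := (hrad _ _).1 hy
      refine ⟨t y, ht.mem_fracIdeal b hL hb hv (PrincipalOrder.stab_anti hL.anti hm hy'), ?_⟩
      rw [← hc y (PrincipalOrder.stab_anti hL.anti (by push_cast; omega) hy'),
        PrincipalOrder.oneAddChar_eq hgy]
      exact fun h => hg1 (Units.ext h))
  refine ⟨c, hc0, hord, fun y hy => ?_⟩
  obtain ⟨g, hg⟩ := hunit y hy
  refine ⟨g, hg, ?_⟩
  rw [← PrincipalOrder.oneAddChar_eq hg, hc y ((hrad _ _).1 hy), map_smul, smul_eq_mul]
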